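/- Let $N\ge 1$ and $p\in[1,\infty)$, and let $\underline d$ be a complete metric on $\mathbb R$ that induces the usual topology. For a metric space $(R,\rho)$ let $\mathcal P^p(R)$ be the set of Borel probability measures $P$ on $R$ with $\int\rho(x,x_0)^p\,P(\mathrm dx)<\infty$ for some $x_0\in R$, and let $W_{\rho,p}(P,Q)=\big(\inf_{\Gamma\in\Pi(P,Q)}\int\rho^p\,\mathrm d\Gamma\big)^{1/p}$, where $\Pi(P,Q)$ is the set of couplings of $P$ and $Q$. On $\mathbb R^N$ put $d(x,y)=\big(\sum_{t=1}^N\underline d(x_t,y_t)^p\big)^{1/p}$ and let $\mathcal F_t$ be the $\sigma$-algebra generated by the first $t$ coordinates. A coupling $\gamma$ of $\mu,\nu\in\mathcal P^p(\mathbb R^N)$ is called bicausal if for all $t<N$ and $B\in\mathcal F_t$ the map $x\mapsto\gamma^x(B)$ is, up to a $\mu$-null set, $\mathcal F_t$-measurable, and the map $y\mapsto\gamma^y(B)$ is, up to a $\nu$-null set, $\mathcal F_t$-measurable; here $\gamma^x$ (resp. $\gamma^y$) is the regular conditional law, under $\gamma$, of the second (resp. first) $\mathbb R^N$-component given that the first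 (resp. second) one equals $x$ (resp. $y$). The nested distance is $$d_p^{\mathrm{nd}}(\mu,\nu)=\Big(\inf_{\gamma\ \text{bicausal}}\int d^p\,\mathrm d\gamma\Big)^{1/p}.$$ Define metric spaces recursively by $R_{N:N}=(\mathbb R,\underline d)$ with $d_{(N:N)}=\underline d$ and, for $t<N$, $R_{t:N}=\mathbb R\times\mathcal P^p(R_{t+1:N})$ with $d_{(t:N)}=\big[\underline d^p+W_{d_{(t+1:N)},p}^p\big]^{1/p}$, each $\mathcal P^p(R_{t+1:N})$ being endowed with the metric $W_{d_{(t+1:N)},p}$. For $\mu\in\mathcal P^p(\mathbb R^N)$ and a vector $(X_1,\dots,X_N)$ with law $\mu$, let $$I[\mu]=\mathcal L\Big(X_1,\ \mathcal L^{X_1}\big(X_2,\ \cdots,\ \mathcal L^{X_{1:N-2}}\big(X_{N-1},\ \mathcal L^{X_{1:N-1}}(X_N)\big)\big)\Big),$$ where $\mathcal L$ denotes the law and $\mathcal L^{X_{1:k}}$ the conditional law given $(X_1,\dots,X_k)$. Theorem. $d_p^{\mathrm{nd}}$ is a metric on $\mathcal P^p(\mathbb R^N)$, and the space of nested distributions $\big(\mathcal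 P^p(R_{1:N}),W_{d_{(1:N)},p}\big)$ is its metric completion: $W_{d_{(1:N)},p}$ is a complete metric on $\mathcal P^p(R_{1:N})$, and $I$ is a well-defined isometry from $\big(\mathcal P^p(\mathbb R^N),d_p^{\mathrm{nd}}\big)$ into $\big(\mathcal P^p(R_{1:N}),W_{d_{(1:N)},p}\big)$ with dense range. -/

import Mathlib

open MeasureTheory ProbabilityTheory
open scoped ENNReal

noncomputable section

/-- The usual topology of the real line, named so that it can be compared with the topology of
another metric on `ℝ`. -/
abbrev usualTopology : TopologicalSpace ℝ := inferInstance

/-- A set with a `σ`-algebra and an extended distance function. This is only the bundle used to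
carry out the recursion `nestedSpace` below; no law of a metric is assumed anywhere (that the
functions so obtained are metrics is part of the theorem). -/
structure DistSpace where
  carrier : Type
  meas : MeasurableSpace carrier
  edist : carrier → carrier → ℝ≥0∞

instance (X : DistSpace) : MeasurableSpace X.carrier := X.meas

/-- The Borel `σ`-algebra of the topology of a distance function `e`: it is generated by the
open sets, i.e. the sets containing an `e`-ball around each of their points. -/
abbrev borelOf {X : Type} (e : X → X → ℝ≥0∞) : MeasurableSpace X :=
  MeasurableSpace.generateFrom {U | ∀ x ∈ U, ∃ ε : ℝ≥0∞, 0 < ε ∧ ∀ y, e x y < ε → y ∈ U}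

/-- The set `Π(P, Q)` of couplings (transport plans) of `P` and `Q`. -/
def couplings {X : Type} [MeasurableSpace X] (P Q : ProbabilityMeasure X) :
    Set (ProbabilityMeasure (X × X)) :=
  {γ | (γ : Measure (X × X)).map Prod.fst = (P : Measure X) ∧
    (γ : Measure (X × X)).map Prod.snd = (Q : Measure X)}

/-- The `p`-Wasserstein distance on probability measures on `X`, for the distance of `X`. -/
def wasserstein (p : ℝ) (X : DistSpace) (P Q : ProbabilityMeasure X.carrier) : ℝ≥0∞ :=
  (⨅ γ ∈ couplings P Q, ∫⁻ z, X.edist z.1 z.2 ^ p ∂(γ : Measure (X.carrier × X.carrier))) ^ (1 / p)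

/-- `𝒫^p(X)`: the probability measures on `X` with finite `p`-th moment. -/
def Pp (p : ℝ) (X : DistSpace) : Type :=
  {P : ProbabilityMeasure X.carrier //
    ∃ x₀ : X.carrier, ∫⁻ x, X.edist x x₀ ^ p ∂(P : Measure X.carrier) < ∞}

/-- `𝒫^p(X)` carries the Borel `σ`-algebra of the `p`-Wasserstein distance. -/
instance (p : ℝ) (X : DistSpace) : MeasurableSpace (Pp p X) :=
  borelOf fun P Q : Pp p X => wasserstein p X P.1 Q.1

/-- One step of the recursion: `ℝ × 𝒫^p(X)` with the distance `(d^p + W_p^p)^{1/p}`, where `d` is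
the base metric `m` on `ℝ`, and its Borel `σ`-algebra. -/
def nestedStep (p : ℝ) (m : MetricSpace ℝ) (X : DistSpace) : DistSpace where
  carrier := ℝ × Pp p X
  meas := borelOf fun a b : ℝ × Pp p X =>
    (m.edist a.1 b.1 ^ p + wasserstein p X a.2.1 b.2.1 ^ p) ^ (1 / p)
  edist := fun a b => (m.edist a.1 b.1 ^ p + wasserstein p X a.2.1 b.2.1 ^ p) ^ (1 / p)

/-- The spaces `R_{t:N}`: `nestedSpace p m k` is `R_{N-k:N}` (it has `k + 1` stages and depends on
`N` and `t` only through `k = N - t`), so that `R_{1:N}` is `nestedSpace p m (N - 1)`. The last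
stage is `ℝ` with the base metric; its `σ`-algebra is the usual one, i.e. the Borel `σ`-algebra of
every metric compatible with the usual topology. -/
def nestedSpace (p : ℝ) (m : MetricSpace ℝ) : ℕ → DistSpace
  | 0 => { carrier := ℝ, meas := inferInstance, edist := m.edist }
  | k + 1 => nestedStep p m (nestedSpace p m k)

/-- `ℝ^N` for `N = n + 1`, with the `ℓ^p`-type product metric of the base metric. -/
abbrev pathSpace (p : ℝ) (m : MetricSpace ℝ) (n : ℕ) : DistSpace where
  carrier := Fin (n + 1) → ℝ
  meas := inferInstance
  edist := fun x y => (∑ i, m.edist (x i) (y i) ^ p) ^ (1 / p)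

/-- The canonical filtration on `ℝ^(n+1)`: for `i : Fin (n + 1)` (counted from `0`), the
`σ`-algebra generated by the coordinates with index at most `i`. -/
abbrev coordFiltration (n : ℕ) (i : Fin (n + 1)) : MeasurableSpace (Fin (n + 1) → ℝ) :=
  Filtration.piLE (X := fun _ : Fin (n + 1) => ℝ) i

/-- One half of bicausality of `γ`: for every time `i` and every event `B` of the past up to
time `i`, the map `x ↦ γ^x(B)` agrees, up to a null set of the first marginal of `γ`, with a
function that is measurable for the past up to time `i`. (For the last `i` this holds trivially.) -/
def IsCausal (n : ℕ) (γ : ProbabilityMeasure ((Fin (n + 1) → ℝ) × (Fin (n + 1) → ℝ))) : Prop :=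
  ∀ (i : Fin (n + 1)) (B : Set (Fin (n + 1) → ℝ)), MeasurableSet[coordFiltration n i] B →
    ∃ g : (Fin (n + 1) → ℝ) → ℝ≥0∞, Measurable[coordFiltration n i] g ∧
      (fun x => (γ : Measure ((Fin (n + 1) → ℝ) × (Fin (n + 1) → ℝ))).condKernel x B)
        =ᵐ[(γ : Measure ((Fin (n + 1) → ℝ) × (Fin (n + 1) → ℝ))).fst] g

/-- The set `Π_bc(μ, ν)` of bicausal couplings. -/
def bicausalCouplings (n : ℕ) (μ ν : ProbabilityMeasure (Fin (n + 1) → ℝ)) :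
    Set (ProbabilityMeasure ((Fin (n + 1) → ℝ) × (Fin (n + 1) → ℝ))) :=
  {γ | γ ∈ couplings μ ν ∧ IsCausal n γ ∧ IsCausal n (γ.map measurable_swap.aemeasurable)}

/-- The `p`-nested distance on probability measures on `ℝ^(n+1)`. -/
def nestedDist (p : ℝ) (m : MetricSpace ℝ) (n : ℕ)
    (μ ν : ProbabilityMeasure (Fin (n + 1) → ℝ)) : ℝ≥0∞ :=
  (⨅ γ ∈ bicausalCouplings n μ ν, ∫⁻ z, (pathSpace p m n).edist z.1 z.2 ^ p
    ∂(γ : Measure ((Fin (n + 1) → ℝ) × (Fin (n + 1) → ℝ)))) ^ (1 / p)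

/-- `T` is a version of the conditional law, under `μ` and given the coordinates up to time `i`, of
the random element `Z` of `X`. -/
def IsCondLaw (p : ℝ) (X : DistSpace) (n : ℕ) (μ : ProbabilityMeasure (Fin (n + 1) → ℝ))
    (i : Fin (n + 1)) (Z : (Fin (n + 1) → ℝ) → X.carrier) (T : (Fin (n + 1) → ℝ) → Pp p X) : Prop :=
  Measurable[coordFiltration n i] T ∧
    ∀ A : Set (Fin (n + 1) → ℝ), MeasurableSet[coordFiltration n i] A →
      ∀ B : Set X.carrier, MeasurableSet B →
        (μ : Measure (Fin (n + 1) → ℝ)) (A ∩ Z ⁻¹' B) =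
          ∫⁻ x in A, ((T x).1 : Measure X.carrier) B ∂(μ : Measure (Fin (n + 1) → ℝ))

/-- With `X₀, …, Xₙ` the coordinates of `ℝ^(n+1)` under `μ`, the relation says that `Z` is the
random element `Z_k` of `nestedSpace p m k` obtained by the recursion
`Z_0 = Xₙ`, `Z_{k+1} = (X_t, law of Z_k given X₀, …, X_t)` with `t = n - (k + 1)`.
It is used for `k ≤ n` only, where the subtraction is not truncated. -/
def IsNestedVar (p : ℝ) (m : MetricSpace ℝ) (n : ℕ) (μ : ProbabilityMeasure (Fin (n + 1) → ℝ)) :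
    (k : ℕ) → ((Fin (n + 1) → ℝ) → (nestedSpace p m k).carrier) → Prop
  | 0, Z => Z = fun x => x (Fin.last n)
  | k + 1, Z => ∃ (Z' : (Fin (n + 1) → ℝ) → (nestedSpace p m k).carrier)
      (T : (Fin (n + 1) → ℝ) → Pp p (nestedSpace p m k)),
      IsNestedVar p m n μ k Z' ∧
      IsCondLaw p (nestedSpace p m k) n μ ⟨n - (k + 1), by omega⟩ Z' T ∧
      Z = fun x => (x ⟨n - (k + 1), by omega⟩, T x)

/-- `P = I[μ]`, i.e. `P` is the law of
`(X₀, law^{X₀}(X₁, … law^{X₀,…,Xₙ₋₂}(Xₙ₋₁, law^{X₀,…,Xₙ₋₁}(Xₙ))))` under `μ`. -/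
def IsNestedLaw (p : ℝ) (m : MetricSpace ℝ) (n : ℕ) (μ : ProbabilityMeasure (Fin (n + 1) → ℝ))
    (P : ProbabilityMeasure (nestedSpace p m n).carrier) : Prop :=
  ∃ Z : (Fin (n + 1) → ℝ) → (nestedSpace p m n).carrier, IsNestedVar p m n μ n Z ∧
    Measurable Z ∧
    (P : Measure (nestedSpace p m n).carrier) = (μ : Measure (Fin (n + 1) → ℝ)).map Z

end

/-!
The argument compares the nested distance of two path laws with the Wasserstein distance of their
nested laws, and everything else follows from the equality of the two
(`nestedDist_eq_wasserstein`).

The recursion stays within Polish spaces (`isPolish_nestedSpace`). For a complete separable metric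
space `X`, the Wasserstein distance makes `𝒫^p(X)` a complete separable metric space: couplings are
glued along common marginals, countably many at a time for completeness, and measures with finitely
many atoms and rational weights are dense. The evaluations `P ↦ P B` are Borel and separate points,
so by the Lusin–Souslin theorem they generate the Borel `σ`-algebra (`Pp.measurable_iff`). Hence
conditional laws are measurable maps into `𝒫^p(X)`.

A coupling `γ` is causal at time `t` if and only if, given the past up to `t` of both paths, the
conditional law of the first path is its conditional law given its own past (`CausalAt`,
`isCausal_iff`). Under a bicausal coupling, the conditional laws which enter the nested variables of
the two paths are therefore conditional laws given one and the same information, the joint past, and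
the conditional joint law couples them. So the expected distance of the conditional laws of two
variables is at most the expected distance of the variables (`lintegral_edist_condLaw_le`), and
backward induction in time bounds the Wasserstein distance of the nested laws by the nested distance
(`wasserstein_le_nestedDist`).

Conversely, nearly optimal couplings of two measures can be chosen as a measurable function of the
measures (`exists_measurable_coupling`). From the product coupling, a bicausal coupling is
constructed forward in time: a coupling of the pasts is prolonged by the chosen coupling of the
conditional laws of the next nested variables, and the futures are made conditionally independent
given the pasts (`exists_refined_coupling`). This keeps causality at the earlier times and adds
causality at the new one; in `N` steps it costs an arbitrarily small amount
(`nestedDist_le_wasserstein`).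

The nested law of `μ` is unique since the diagonal coupling is bicausal and costs nothing, and `I`
is injective since bicausal couplings are couplings. For density
(`exists_isNestedLaw_wasserstein_lt`), a nested distribution is approximated by one with finitely
many atoms `(aᵢ, Qᵢ)`, where by induction on `N` each `Qᵢ` is the nested law of some `μᵢ`, and the
`aᵢ` are distinct. Since the first value then determines `i`, this is the nested law of the path
which starts at `aᵢ` and continues with law `μᵢ`.
-/

open Filter Topology Set

set_option linter.unusedSectionVars false

noncomputable section

/-! ### Wasserstein distances -/

/-- The distance function of `X` is the one of the metric space structure on its carrier.
This class connects the bare bundle `DistSpace` with the metric spaces of Mathlib. -/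
class LawfulDist (X : DistSpace) [MetricSpace X.carrier] : Prop where
  edist_eq : ∀ a b : X.carrier, X.edist a b = edist a b

section Couplings

variable {p : ℝ} {X : DistSpace} {P Q R : ProbabilityMeasure X.carrier}

theorem wasserstein_rpow (hp : 0 < p) : wasserstein p X P Q ^ p =
    ⨅ γ ∈ couplings P Q, ∫⁻ z, X.edist z.1 z.2 ^ p ∂(γ : Measure (X.carrier × X.carrier)) := by
  rw [wasserstein, ← ENNReal.rpow_mul, one_div_mul_cancel hp.ne', ENNReal.rpow_one]

theorem wasserstein_rpow_le (hp : 0 < p) {γ : ProbabilityMeasure (X.carrier × X.carrier)}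
    (hγ : γ ∈ couplings P Q) : wasserstein p X P Q ^ p ≤
      ∫⁻ z, X.edist z.1 z.2 ^ p ∂(γ : Measure (X.carrier × X.carrier)) := by
  rw [wasserstein_rpow hp]
  exact iInf₂_le γ hγ

theorem exists_coupling_lt (hp : 0 < p) {c : ℝ≥0∞} (h : wasserstein p X P Q < c) :
    ∃ γ ∈ couplings P Q,
      (∫⁻ z, X.edist z.1 z.2 ^ p ∂(γ : Measure (X.carrier × X.carrier))) ^ (1 / p) < c := by
  have h' : wasserstein p X P Q ^ p < c ^ p := ENNReal.rpow_lt_rpow h hp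
  rw [wasserstein_rpow hp] at h'
  simp only [iInf_lt_iff] at h'
  obtain ⟨γ, hγ, hlt⟩ := h'
  refine ⟨γ, hγ, ?_⟩
  rw [one_div, ENNReal.rpow_inv_lt_iff hp]
  exact hlt

theorem map_apply_mem_couplings {Ω : Type*} [MeasurableSpace Ω] {μ : Measure Ω}
    [IsProbabilityMeasure μ] {f g : Ω → X.carrier} (hf : Measurable f) (hg : Measurable g)
    (hP : μ.map f = P) (hQ : μ.map g = Q) :
    (⟨μ.map (fun ω => (f ω, g ω)),
      Measure.isProbabilityMeasure_map (hf.prodMk hg).aemeasurable⟩ :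
        ProbabilityMeasure (X.carrier × X.carrier)) ∈ couplings P Q := by
  constructor
  · rw [← hP]
    exact Measure.map_map measurable_fst (hf.prodMk hg)
  · rw [← hQ]
    exact Measure.map_map measurable_snd (hf.prodMk hg)

/-- Gluing of couplings along their common marginal. -/
theorem exists_glue {A B C : Type*} [MeasurableSpace A] [MeasurableSpace B] [MeasurableSpace C]
    [StandardBorelSpace C] [Nonempty C] (γ : Measure (A × B)) (δ : Measure (B × C))
    [IsProbabilityMeasure γ] [IsProbabilityMeasure δ] (h : γ.map Prod.snd = δ.map Prod.fst) :
    ∃ π : Measure ((A × B) × C), IsProbabilityMeasure π ∧ π.map Prod.fst = γ ∧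
      π.map (fun z => (z.1.2, z.2)) = δ := by
  refine ⟨γ ⊗ₘ (δ.condKernel.comap Prod.snd measurable_snd), inferInstance,
    Measure.fst_compProd _ _, ?_⟩
  have hm : Measurable fun z : (A × B) × C => (z.1.2, z.2) := by fun_prop
  refine Measure.ext fun s hs => ?_
  rw [Measure.map_apply hm hs, Measure.compProd_apply (hm hs)]
  conv_rhs => rw [← δ.disintegrate δ.condKernel, Measure.compProd_apply hs]
  rw [Measure.fst, ← h, lintegral_map (Kernel.measurable_kernel_prodMk_left hs) measurable_snd]
  rfl

/-- Minkowski's inequality for the `L^p` distance of random elements of a metric space. -/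
theorem edist_Lp_triangle {Ω M : Type*} [MeasurableSpace Ω] [PseudoEMetricSpace M] (hp : 1 ≤ p)
    (μ : Measure Ω) {f g h : Ω → M} (hfg : AEMeasurable (fun ω => edist (f ω) (g ω)) μ)
    (hgh : AEMeasurable (fun ω => edist (g ω) (h ω)) μ) :
    (∫⁻ ω, edist (f ω) (h ω) ^ p ∂μ) ^ (1 / p) ≤
      (∫⁻ ω, edist (f ω) (g ω) ^ p ∂μ) ^ (1 / p) + (∫⁻ ω, edist (g ω) (h ω) ^ p ∂μ) ^ (1 / p) := by
  have hp0 : 0 ≤ p := by linarith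
  refine le_trans ?_ (ENNReal.lintegral_Lp_add_le hfg hgh hp)
  gcongr with ω
  exact edist_triangle _ _ _

end Couplings

section Metric

variable {p : ℝ} {X : DistSpace} [MetricSpace X.carrier] [SecondCountableTopology X.carrier]
  [BorelSpace X.carrier] [LawfulDist X] {P Q R : ProbabilityMeasure X.carrier}

/-- Any realization of `P` and `Q` on a common probability space bounds their distance. -/
theorem wasserstein_le_of_map (hp : 0 < p) {Ω : Type*} [MeasurableSpace Ω] {μ : Measure Ω}
    [IsProbabilityMeasure μ] {f g : Ω → X.carrier} (hf : Measurable f) (hg : Measurable g)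
    (hP : μ.map f = P) (hQ : μ.map g = Q) :
    wasserstein p X P Q ≤ (∫⁻ ω, edist (f ω) (g ω) ^ p ∂μ) ^ (1 / p) := by
  have h := wasserstein_rpow_le hp (map_apply_mem_couplings hf hg hP hQ)
  rw [one_div, ENNReal.le_rpow_inv_iff hp]
  refine h.trans_eq ?_
  simp only [LawfulDist.edist_eq]
  change ∫⁻ z, edist z.1 z.2 ^ p ∂(μ.map (fun ω => (f ω, g ω))) = _
  rw [lintegral_map (by fun_prop) (hf.prodMk hg)]

theorem exists_coupling_edist_lt (hp : 0 < p) {c : ℝ≥0∞} (h : wasserstein p X P Q < c) :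
    ∃ γ : Measure (X.carrier × X.carrier), IsProbabilityMeasure γ ∧ γ.map Prod.fst = P ∧
      γ.map Prod.snd = Q ∧ (∫⁻ z, edist z.1 z.2 ^ p ∂γ) ^ (1 / p) < c := by
  obtain ⟨γ, hγ, hlt⟩ := exists_coupling_lt hp h
  simp only [LawfulDist.edist_eq] at hlt
  exact ⟨γ, inferInstance, hγ.1, hγ.2, hlt⟩

theorem wasserstein_self (hp : 0 < p) : wasserstein p X P P = 0 := by
  have h := wasserstein_le_of_map hp (μ := (P : Measure X.carrier)) (P := P) (Q := P)
    measurable_id measurable_id Measure.map_id Measure.map_id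
  simpa [ENNReal.zero_rpow_of_pos, hp] using h

theorem wasserstein_comm_le (hp : 0 < p) : wasserstein p X P Q ≤ wasserstein p X Q P := by
  refine le_of_forall_gt fun c hc => ?_
  obtain ⟨γ, hγ, h1, h2, hlt⟩ := exists_coupling_edist_lt hp hc
  refine (wasserstein_le_of_map hp measurable_snd measurable_fst h2 h1).trans_lt ?_
  simpa only [edist_comm] using hlt

theorem wasserstein_comm (hp : 0 < p) : wasserstein p X P Q = wasserstein p X Q P :=
  le_antisymm (wasserstein_comm_le hp) (wasserstein_comm_le hp)

theorem wasserstein_triangle [CompleteSpace X.carrier] (hp : 1 ≤ p) :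
    wasserstein p X P R ≤ wasserstein p X P Q + wasserstein p X Q R := by
  have hp0 : 0 < p := by linarith
  have : Nonempty X.carrier := P.nonempty
  refine ENNReal.le_of_forall_pos_le_add fun ε hε hfin => ?_
  have hfin' := ENNReal.add_lt_top.1 hfin
  have hε2 : (ε / 2 : ℝ≥0∞) ≠ 0 := by simp [hε.ne']
  obtain ⟨γ, hγ, h1, h2, hlt⟩ := exists_coupling_edist_lt hp0
    (ENNReal.lt_add_right hfin'.1.ne hε2)
  obtain ⟨δ, hδ, h3, h4, hlt'⟩ := exists_coupling_edist_lt hp0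
    (ENNReal.lt_add_right hfin'.2.ne hε2)
  obtain ⟨π, hπ, hπ1, hπ2⟩ := exists_glue γ δ (h2.trans h3.symm)
  have e1 : π.map (fun z => z.1.1) = P := by
    rw [← h1, ← hπ1, Measure.map_map measurable_fst measurable_fst]; rfl
  have e2 : π.map (fun z => z.2) = R := by
    rw [← h4, ← hπ2, Measure.map_map measurable_snd (by fun_prop)]; rfl
  refine (wasserstein_le_of_map hp0 (by fun_prop) (by fun_prop) e1 e2).trans ?_
  refine (edist_Lp_triangle hp π (g := fun z => z.1.2) (by fun_prop) (by fun_prop)).trans ?_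
  have i1 : ∫⁻ z, edist z.1.1 z.1.2 ^ p ∂π = ∫⁻ z, edist z.1 z.2 ^ p ∂γ := by
    rw [← hπ1, lintegral_map (by fun_prop) measurable_fst]
  have i2 : ∫⁻ z, edist z.1.2 z.2 ^ p ∂π = ∫⁻ z, edist z.1 z.2 ^ p ∂δ := by
    rw [← hπ2, lintegral_map (by fun_prop) (by fun_prop)]
  rw [i1, i2]
  refine (add_le_add hlt.le hlt'.le).trans_eq ?_
  rw [add_add_add_comm, ENNReal.add_halves]

/-- Markov's inequality for a nearly optimal coupling: unless the two components are at distance at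
least `δ`, the second one is in the `δ`-thickening of `s` when the first one is in `s`. -/
theorem measure_le_thickening_add (hp : 0 < p) (s : Set X.carrier) (hs : MeasurableSet s)
    {δ : ℝ} (hδ : 0 < δ) :
    (P : Measure X.carrier) s ≤ (Q : Measure X.carrier) (Metric.thickening δ s) +
      (wasserstein p X P Q / ENNReal.ofReal δ) ^ p := by
  have key : ∀ c, wasserstein p X P Q < c → (P : Measure X.carrier) s ≤
      (Q : Measure X.carrier) (Metric.thickening δ s) + (c / ENNReal.ofReal δ) ^ p := by
    intro c hc
    obtain ⟨γ, hγ, h1, h2, hlt⟩ := exists_coupling_edist_lt hp hc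
    have hsub : Prod.fst ⁻¹' s ⊆ Prod.snd ⁻¹' (Metric.thickening δ s) ∪
        {z : X.carrier × X.carrier | ENNReal.ofReal δ ^ p ≤ edist z.1 z.2 ^ p} := by
      intro z hz
      by_cases h : edist z.1 z.2 < ENNReal.ofReal δ
      · left
        exact (Metric.mem_thickening_iff_exists_edist_lt _ _).2 ⟨z.1, hz, by rwa [edist_comm]⟩
      · right
        exact ENNReal.rpow_le_rpow (not_lt.1 h) hp.le
    rw [← h1, ← h2, Measure.map_apply measurable_fst hs,
      Measure.map_apply measurable_snd Metric.isOpen_thickening.measurableSet]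
    refine (measure_mono hsub).trans ((measure_union_le _ _).trans ?_)
    gcongr
    refine (meas_ge_le_lintegral_div (by fun_prop) ?_ ?_).trans ?_
    · simp [ENNReal.rpow_eq_zero_iff, hδ, not_lt.2 hp.le]
    · simp [ENNReal.rpow_eq_top_iff, not_lt.2 hp.le]
    · rw [ENNReal.div_rpow_of_nonneg _ _ hp.le]
      gcongr
      rw [one_div, ENNReal.rpow_inv_lt_iff hp] at hlt
      exact hlt.le
  have hδ' : ENNReal.ofReal δ ≠ 0 := by simpa using hδ
  by_cases hW : wasserstein p X P Q = ∞
  · simp [hW, ENNReal.top_div, hp]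
  have : Tendsto (fun c => (Q : Measure X.carrier) (Metric.thickening δ s) +
      (c / ENNReal.ofReal δ) ^ p) (𝓝[>] (wasserstein p X P Q))
      (𝓝 ((Q : Measure X.carrier) (Metric.thickening δ s) +
      (wasserstein p X P Q / ENNReal.ofReal δ) ^ p)) := by
    refine Tendsto.mono_left ?_ nhdsWithin_le_nhds
    refine Tendsto.const_add _ ?_
    refine (ENNReal.continuous_rpow_const.tendsto _).comp ?_
    exact ENNReal.Tendsto.div_const tendsto_id (Or.inr hδ')
  have hne : (𝓝[>] (wasserstein p X P Q)).NeBot := nhdsGT_neBot_of_exists_gt ⟨∞, Ne.lt_top hW⟩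
  exact ge_of_tendsto this (eventually_nhdsWithin_of_forall key)

/-- Two laws at distance zero agree on closed sets, by comparison with thickenings. -/
theorem eq_of_wasserstein_eq_zero (hp : 0 < p) (h : wasserstein p X P Q = 0) : P = Q := by
  have key : ∀ {P Q : ProbabilityMeasure X.carrier}, wasserstein p X P Q = 0 →
      ∀ s, IsClosed s → (P : Measure X.carrier) s ≤ (Q : Measure X.carrier) s := by
    intro P Q h s hs
    have hlim := tendsto_measure_thickening_of_isClosed (μ := (Q : Measure X.carrier))
      ⟨1, one_pos, measure_ne_top _ _⟩ hs
    refine ge_of_tendsto hlim (eventually_nhdsWithin_of_forall fun δ hδ => ?_)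
    refine (measure_le_thickening_add (p := p) (Q := Q) hp s hs.measurableSet hδ).trans ?_
    simp [h, ENNReal.zero_rpow_of_pos, hp]
  have hPQ : (P : Measure X.carrier) = Q := by
    refine ext_of_generate_finite {s : Set X.carrier | IsClosed s} ?_ isPiSystem_isClosed ?_ ?_
    · rw [← borel_eq_generateFrom_isClosed]
      exact BorelSpace.measurable_eq
    · intro s hs
      exact le_antisymm (key h s hs) (key (P := Q) (Q := P) (by rwa [wasserstein_comm hp]) s hs)
    · simp
  exact Subtype.ext hPQ

theorem wasserstein_dirac_le (hp : 0 < p) (x : X.carrier) :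
    wasserstein p X P ⟨Measure.dirac x, Measure.dirac.isProbabilityMeasure⟩ ≤
      (∫⁻ y, edist y x ^ p ∂(P : Measure X.carrier)) ^ (1 / p) := by
  refine wasserstein_le_of_map hp (μ := (P : Measure X.carrier)) measurable_id measurable_const
    Measure.map_id ?_
  simp [Measure.map_const]

end Metric

/-! ### The metric space `𝒫^p(X)` -/

theorem exponent_pos {p : ℝ} [hp : Fact (1 ≤ p)] : 0 < p := zero_lt_one.trans_le hp.out

section PpMetric

variable {p : ℝ} [hp : Fact (1 ≤ p)] {X : DistSpace} [MetricSpace X.carrier]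
  [CompleteSpace X.carrier] [SecondCountableTopology X.carrier] [BorelSpace X.carrier]
  [LawfulDist X]

theorem Lp_edist_const_lt_top {Q : Measure X.carrier} [IsProbabilityMeasure Q] {x : X.carrier}
    (hx : ∫⁻ z, edist z x ^ p ∂Q < ∞) (y : X.carrier) : ∫⁻ z, edist z y ^ p ∂Q < ∞ := by
  have hp0 : 0 < p := exponent_pos
  have h := edist_Lp_triangle hp.out Q (f := id) (g := fun _ => x) (h := fun _ => y)
    (by fun_prop) (by fun_prop)
  rw [← ENNReal.rpow_lt_top_iff_of_pos (one_div_pos.2 hp0)]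
  refine h.trans_lt (ENNReal.add_lt_top.2 ⟨?_, ?_⟩)
  · exact ENNReal.rpow_lt_top_of_nonneg (by positivity) hx.ne
  · refine ENNReal.rpow_lt_top_of_nonneg (by positivity) ?_
    simp [ENNReal.rpow_eq_top_iff, not_lt.2 hp0.le, edist_ne_top]

theorem Pp.lintegral_edist_lt_top (P : Pp p X) (x : X.carrier) :
    ∫⁻ z, edist z x ^ p ∂(P.1 : Measure X.carrier) < ∞ := by
  obtain ⟨x₀, hx₀⟩ := P.2
  simp only [LawfulDist.edist_eq] at hx₀
  exact Lp_edist_const_lt_top hx₀ x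

/-- The point mass at `x`, as an element of `𝒫^p(X)`. -/
def Pp.dirac (p : ℝ) [hp : Fact (1 ≤ p)] (x : X.carrier) : Pp p X :=
  ⟨⟨Measure.dirac x, Measure.dirac.isProbabilityMeasure⟩, x, by
    have hp0 : 0 < p := exponent_pos
    have : ∫⁻ y, X.edist y x ^ p ∂(Measure.dirac x) < ∞ := by
      simp only [LawfulDist.edist_eq]
      rw [lintegral_dirac' _ (by fun_prop)]
      simp [ENNReal.zero_rpow_of_pos, hp0]
    exact this⟩

theorem Pp.wasserstein_dirac_lt_top (P : Pp p X) (x : X.carrier) :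
    wasserstein p X P.1 (Pp.dirac p x).1 < ∞ :=
  (wasserstein_dirac_le exponent_pos x).trans_lt <|
    ENNReal.rpow_lt_top_of_nonneg (one_div_pos.2 exponent_pos).le
      (P.lintegral_edist_lt_top x).ne

theorem Pp.wasserstein_lt_top (P Q : Pp p X) : wasserstein p X P.1 Q.1 < ∞ := by
  obtain ⟨x⟩ : Nonempty X.carrier := P.1.nonempty
  refine (wasserstein_triangle (Q := (Pp.dirac p x).1) hp.out).trans_lt
    (ENNReal.add_lt_top.2 ⟨P.wasserstein_dirac_lt_top x, ?_⟩)
  rw [wasserstein_comm exponent_pos]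
  exact Q.wasserstein_dirac_lt_top x

/-- Finiteness of the `p`-th moment passes to measures at finite distance. -/
theorem Pp.moment_of_wasserstein_lt_top (P : Pp p X) {Q : ProbabilityMeasure X.carrier}
    (h : wasserstein p X P.1 Q < ∞) :
    ∃ x₀, ∫⁻ x, X.edist x x₀ ^ p ∂(Q : Measure X.carrier) < ∞ := by
  have hp0 : 0 < p := exponent_pos
  obtain ⟨x₀⟩ : Nonempty X.carrier := P.1.nonempty
  refine ⟨x₀, ?_⟩
  simp only [LawfulDist.edist_eq]
  obtain ⟨γ, hγ, h1, h2, hlt⟩ := exists_coupling_edist_lt hp0 h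
  have hP := P.lintegral_edist_lt_top x₀
  rw [← h1, lintegral_map (by fun_prop) measurable_fst] at hP
  rw [← h2, lintegral_map (by fun_prop) measurable_snd,
    ← ENNReal.rpow_lt_top_iff_of_pos (one_div_pos.2 hp0)]
  refine (edist_Lp_triangle hp.out γ (f := Prod.snd) (g := Prod.fst) (h := fun _ => x₀)
    (by fun_prop) (by fun_prop)).trans_lt (ENNReal.add_lt_top.2 ⟨?_, ?_⟩)
  · simpa only [edist_comm] using hlt
  · exact ENNReal.rpow_lt_top_of_nonneg (by positivity) hP.ne

/-- The Wasserstein metric on `𝒫^p(X)`. -/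
instance Pp.instMetricSpace : MetricSpace (Pp p X) :=
  letI e : EMetricSpace (Pp p X) :=
    { edist := fun P Q => wasserstein p X P.1 Q.1
      edist_self := fun _ => wasserstein_self exponent_pos
      edist_comm := fun _ _ => wasserstein_comm exponent_pos
      edist_triangle := fun _ _ _ => wasserstein_triangle hp.out
      eq_of_edist_eq_zero := fun h => Subtype.ext (eq_of_wasserstein_eq_zero exponent_pos h) }
  EMetricSpace.toMetricSpace fun P Q => (P.wasserstein_lt_top Q).ne

/-- The `σ`-algebra `borelOf` of the distance of a metric space is its Borel `σ`-algebra. -/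
theorem borelOf_edist (Y : Type) [EMetricSpace Y] : borelOf (edist : Y → Y → ℝ≥0∞) = borel Y := by
  rw [borelOf, borel]
  congr 1
  ext U
  simp only [Set.mem_ofPred_eq, EMetric.isOpen_iff]
  refine forall₂_congr fun x _ => exists_congr fun ε => and_congr_right fun _ => ?_
  simp only [Set.subset_def, Metric.mem_eball, edist_comm]

instance Pp.instBorelSpace : BorelSpace (Pp p X) := ⟨borelOf_edist (Pp p X)⟩

theorem Pp.edist_le_of_map {Ω : Type*} [MeasurableSpace Ω] {μ : Measure Ω}
    [IsProbabilityMeasure μ] {f g : Ω → X.carrier} (hf : Measurable f) (hg : Measurable g)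
    {P Q : Pp p X} (hP : μ.map f = P.1) (hQ : μ.map g = Q.1) :
    edist P Q ≤ (∫⁻ ω, edist (f ω) (g ω) ^ p ∂μ) ^ (1 / p) :=
  wasserstein_le_of_map exponent_pos hf hg hP hQ

/-- Wasserstein convergence implies weak convergence, in the form needed for measurability. -/
theorem Pp.upperSemicontinuous_apply {s : Set X.carrier} (hs : IsClosed s) :
    UpperSemicontinuous fun P : Pp p X => (P.1 : Measure X.carrier) s := by
  have hp0 : 0 < p := exponent_pos
  intro P a ha
  have hlim := tendsto_measure_thickening_of_isClosed (μ := (P.1 : Measure X.carrier))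
    ⟨1, one_pos, measure_ne_top _ _⟩ hs
  obtain ⟨δ, hδa, hδ⟩ := ((hlim.eventually_lt_const ha).and self_mem_nhdsWithin).exists
  have hδ' : ENNReal.ofReal δ ≠ 0 := by simpa using hδ
  have ht : Tendsto (fun Q : Pp p X => (P.1 : Measure X.carrier) (Metric.thickening δ s) +
      (edist Q P / ENNReal.ofReal δ) ^ p) (𝓝 P)
      (𝓝 ((P.1 : Measure X.carrier) (Metric.thickening δ s) + (0 / ENNReal.ofReal δ) ^ p)) := by
    refine Tendsto.const_add _ ((ENNReal.continuous_rpow_const.tendsto _).comp ?_)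
    refine ENNReal.Tendsto.div_const ?_ (Or.inr hδ')
    have : Tendsto (fun Q : Pp p X => edist Q P) (𝓝 P) (𝓝 (edist P P)) :=
      (continuous_id.edist continuous_const).tendsto P
    rwa [edist_self] at this
  rw [ENNReal.zero_div, ENNReal.zero_rpow_of_pos hp0, add_zero] at ht
  filter_upwards [ht.eventually_lt_const hδa] with Q hQ
  exact (measure_le_thickening_add (p := p) (P := Q.1) (Q := P.1) hp0 s hs.measurableSet
    hδ).trans_lt hQ

theorem Pp.measurable_toMeasure : Measurable fun P : Pp p X => (P.1 : Measure X.carrier) := by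
  refine Measurable.measure_of_isPiSystem_of_isProbabilityMeasure
    (S := {s : Set X.carrier | IsClosed s}) ?_ isPiSystem_isClosed ?_
  · rw [← borel_eq_generateFrom_isClosed]
    exact BorelSpace.measurable_eq
  · intro s hs
    exact (Pp.upperSemicontinuous_apply hs).measurable

end PpMetric

/-! ### Separability of `𝒫^p(X)` -/

section Approximation

variable {p : ℝ} [hp : Fact (1 ≤ p)] {X : DistSpace} [MetricSpace X.carrier]
  [CompleteSpace X.carrier] [SecondCountableTopology X.carrier] [BorelSpace X.carrier]
  [LawfulDist X]

theorem Pp.exists_map (P : Pp p X) {g : X.carrier → X.carrier} (hg : Measurable g)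
    (h : ∫⁻ x, edist x (g x) ^ p ∂(P.1 : Measure X.carrier) < ∞) :
    ∃ Q : Pp p X, (Q.1 : Measure X.carrier) = (P.1 : Measure X.carrier).map g ∧
      edist P Q ≤ (∫⁻ x, edist x (g x) ^ p ∂(P.1 : Measure X.carrier)) ^ (1 / p) := by
  let Q : ProbabilityMeasure X.carrier :=
    ⟨(P.1 : Measure X.carrier).map g, Measure.isProbabilityMeasure_map hg.aemeasurable⟩
  have hle : wasserstein p X P.1 Q ≤
      (∫⁻ x, edist x (g x) ^ p ∂(P.1 : Measure X.carrier)) ^ (1 / p) :=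
    wasserstein_le_of_map exponent_pos measurable_id hg Measure.map_id rfl
  exact ⟨⟨Q, P.moment_of_wasserstein_lt_top (hle.trans_lt
    (ENNReal.rpow_lt_top_of_nonneg (one_div_pos.2 exponent_pos).le h.ne))⟩, rfl, hle⟩

/-- The projections to the nearest of the first `N + 1` points of a dense sequence converge to the
identity in `L^p`. -/
theorem Pp.exists_nearestPt (P : Pp p X) {e : ℕ → X.carrier} (he : DenseRange e) {ε : ℝ≥0∞}
    (hε : 0 < ε) :
    ∃ N, ∫⁻ x, edist x (SimpleFunc.nearestPt e N x) ^ p ∂(P.1 : Measure X.carrier) < ε := by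
  have hp0 : 0 < p := exponent_pos
  have ht : Tendsto (fun N => ∫⁻ x, edist x (SimpleFunc.nearestPt e N x) ^ p
      ∂(P.1 : Measure X.carrier)) atTop (𝓝 (∫⁻ _, 0 ∂(P.1 : Measure X.carrier))) := by
    refine tendsto_lintegral_of_dominated_convergence (fun x => edist x (e 0) ^ p) ?_ ?_
      (P.lintegral_edist_lt_top (e 0)).ne ?_
    · intro N
      exact (measurable_id.edist (SimpleFunc.measurable _)).pow_const p
    · intro N
      refine Eventually.of_forall fun x => ?_
      change edist x _ ^ p ≤ edist x _ ^ p
      rw [edist_comm, edist_comm x]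
      exact ENNReal.rpow_le_rpow (SimpleFunc.edist_nearestPt_le e x (Nat.zero_le N)) hp0.le
    · refine Eventually.of_forall fun x => ?_
      have h1 := SimpleFunc.tendsto_nearestPt (e := e) (x := x) (he x)
      have h2 : Tendsto (fun N => edist x (SimpleFunc.nearestPt e N x)) atTop (𝓝 (edist x x)) :=
        tendsto_const_nhds.edist h1
      rw [edist_self] at h2
      have h3 := (ENNReal.continuous_rpow_const (y := p)).tendsto 0 |>.comp h2
      rwa [ENNReal.zero_rpow_of_pos hp0] at h3
  rw [lintegral_zero] at ht
  exact (ht.eventually_lt_const hε).exists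

theorem exists_rat_le_approx {w η : ℝ≥0∞} (hw : w ≠ ∞) (hη : 0 < η) :
    ∃ q : ℚ, ENNReal.ofReal q ≤ w ∧ w - ENNReal.ofReal q ≤ η := by
  rcases le_or_gt w η with h | h
  · exact ⟨0, by simp, by simpa using h⟩
  · have hlt : w - η < w := ENNReal.sub_lt_self hw (hη.trans h).ne' hη.ne'
    obtain ⟨q, -, h1, h2⟩ := ENNReal.lt_iff_exists_rat_btwn.1 hlt
    exact ⟨q, h2.le, tsub_le_iff_tsub_le.1 h1.le⟩

/-- The measure with mass `v i` at `e i`, and the remaining mass at `e 0`. -/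
def atomicMeasure (e : ℕ → X.carrier) {N : ℕ} (v : Fin (N + 1) → ℚ) : Measure X.carrier :=
  ∑ i : Fin (N + 1), ENNReal.ofReal (v i) • Measure.dirac (e i) +
    (1 - ∑ i : Fin (N + 1), ENNReal.ofReal (v i)) • Measure.dirac (e 0)

/-- The law of a random variable which factors through a finite set is a sum of point masses. -/
theorem map_eq_sum_dirac {Ω : Type*} [MeasurableSpace Ω] (μ : Measure Ω) {ι : Type*} [Fintype ι]
    [MeasurableSpace ι] [MeasurableSingletonClass ι] {f : Ω → ι} (hf : Measurable f)
    {Y : Type*} [MeasurableSpace Y] {e : ι → Y} :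
    μ.map (e ∘ f) = ∑ i, μ (f ⁻¹' {i}) • Measure.dirac (e i) := by
  classical
  have he : Measurable e := measurable_of_countable e
  refine Measure.ext fun s hs => ?_
  rw [Measure.map_apply (he.comp hf) hs, Measure.coe_finsetSum, Finset.sum_apply]
  have h := sum_measure_preimage_singleton (μ := μ) (f := f) (Finset.univ.filter fun i => e i ∈ s)
    (fun y _ => hf (measurableSet_singleton y))
  have h' : f ⁻¹' ↑(Finset.univ.filter fun i => e i ∈ s) = e ∘ f ⁻¹' s := by
    ext x; simp
  rw [h'] at h
  rw [← h, Finset.sum_filter]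
  refine Finset.sum_congr rfl fun i _ => ?_
  rw [Measure.smul_apply, Measure.dirac_apply' _ hs]
  by_cases hi : e i ∈ s <;> simp [hi]

/-- Approximation of `P` by finitely many atoms with rational weights: the points are moved to the
nearest of finitely many points, then the weights are rounded down to rational numbers and the missing
mass is moved to `e 0`. -/
theorem Pp.exists_atomicMeasure (P : Pp p X) {e : ℕ → X.carrier} (he : DenseRange e) {ε : ℝ≥0∞}
    (hε : 0 < ε) : ∃ (N : ℕ) (v : Fin (N + 1) → ℚ) (Q : Pp p X),
      (Q.1 : Measure X.carrier) = atomicMeasure e v ∧ edist P Q ≤ ε + ε := by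
  have hp0 : 0 < p := exponent_pos
  by_cases hεtop : ε = ∞
  · subst hεtop
    refine ⟨0, fun _ => 1, Pp.dirac p (e 0), ?_, by simp⟩
    simp [atomicMeasure, Pp.dirac]
  have hεp : 0 < ε ^ p := ENNReal.rpow_pos hε hεtop
  obtain ⟨N, hN⟩ := P.exists_nearestPt he hεp
  obtain ⟨P', hP', hPP'⟩ := P.exists_map (SimpleFunc.measurable _) (hN.trans_le le_top)
  let f : X.carrier → Fin (N + 1) := fun x =>
    ⟨SimpleFunc.nearestPtInd e N x, Nat.lt_succ_of_le (SimpleFunc.nearestPtInd_le e N x)⟩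
  have hf : Measurable f := by
    refine measurable_to_countable' fun i => ?_
    convert! (SimpleFunc.nearestPtInd e N).measurableSet_fiber i.1 using 1
    ext x
    simp [f, Fin.ext_iff]
  let w : Fin (N + 1) → ℝ≥0∞ := fun i => (P.1 : Measure X.carrier) (f ⁻¹' {i})
  have hP'w : (P'.1 : Measure X.carrier) = ∑ i, w i • Measure.dirac (e i) := by
    rw [hP']
    exact map_eq_sum_dirac (P.1 : Measure X.carrier) hf (e := fun i : Fin (N + 1) => e i)
  have hw1 : ∑ i, w i = 1 := by
    have : (P'.1 : Measure X.carrier) univ = 1 := measure_univ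
    rw [hP'w] at this
    simpa using this
  have hw : ∀ i, w i ≠ ∞ := fun i => measure_ne_top _ _
  let S : ℝ≥0∞ := ∑ i : Fin (N + 1), edist (e i) (e 0) ^ p
  have hS : S ≠ ∞ := ENNReal.sum_ne_top.2 fun i _ =>
    ENNReal.rpow_ne_top_of_nonneg hp0.le (edist_ne_top _ _)
  have hη : 0 < ε ^ p / (S + 1) := ENNReal.div_pos hεp.ne' (by simp [hS])
  choose v hv1 hv2 using fun i => exists_rat_le_approx (hw i) hη
  -- the coupling which leaves the mass `v i` at `e i` and moves the excess `w i - v i` to `e 0`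
  let π : Measure (X.carrier × X.carrier) := ∑ i : Fin (N + 1),
    (ENNReal.ofReal (v i) • Measure.dirac (e i, e i) +
      (w i - ENNReal.ofReal (v i)) • Measure.dirac (e i, e 0))
  have hfst : π.map Prod.fst = P'.1 := by
    rw [hP'w, Measure.map_finset_sum measurable_fst.aemeasurable]
    refine Finset.sum_congr rfl fun i _ => ?_
    rw [Measure.map_add _ _ measurable_fst, Measure.map_smul, Measure.map_smul,
      Measure.map_dirac' measurable_fst, Measure.map_dirac' measurable_fst, ← add_smul,
      add_tsub_cancel_of_le (hv1 i)]
  have hsub : ∑ i, (w i - ENNReal.ofReal (v i)) = 1 - ∑ i, ENNReal.ofReal (v i) := by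
    refine ENNReal.eq_sub_of_add_eq ?_ ?_
    · exact ENNReal.sum_ne_top.2 fun i _ => ENNReal.ofReal_ne_top
    · rw [← Finset.sum_add_distrib, ← hw1]
      exact Finset.sum_congr rfl fun i _ => tsub_add_cancel_of_le (hv1 i)
  have hsnd : π.map Prod.snd = atomicMeasure e v := by
    rw [Measure.map_finset_sum measurable_snd.aemeasurable, atomicMeasure, ← hsub, Finset.sum_smul,
      ← Finset.sum_add_distrib]
    refine Finset.sum_congr rfl fun i _ => ?_
    rw [Measure.map_add _ _ measurable_snd, Measure.map_smul, Measure.map_smul,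
      Measure.map_dirac' measurable_snd, Measure.map_dirac' measurable_snd]
  have hπ : IsProbabilityMeasure π := by
    constructor
    have : (P'.1 : Measure X.carrier) univ = 1 := measure_univ
    rwa [← hfst, Measure.map_apply measurable_fst MeasurableSet.univ] at this
  have hcost : ∫⁻ z, edist z.1 z.2 ^ p ∂π ≤ ε ^ p := by
    rw [lintegral_finsetSum_measure]
    calc ∑ i : Fin (N + 1), ∫⁻ z, edist z.1 z.2 ^ p ∂(ENNReal.ofReal (v i) • Measure.dirac (e i, e i) +
      (w i - ENNReal.ofReal (v i)) • Measure.dirac (e i, e 0))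
        ≤ ∑ i : Fin (N + 1), ε ^ p / (S + 1) * edist (e i) (e 0) ^ p := by
          refine Finset.sum_le_sum fun i _ => ?_
          rw [lintegral_add_measure, lintegral_smul_measure, lintegral_smul_measure,
            lintegral_dirac' _ (by fun_prop), lintegral_dirac' _ (by fun_prop), edist_self,
            ENNReal.zero_rpow_of_pos hp0, smul_zero, zero_add]
          exact mul_le_mul_left (hv2 i) _
      _ = ε ^ p / (S + 1) * S := by rw [← Finset.mul_sum]
      _ ≤ ε ^ p / (S + 1) * (S + 1) := by gcongr; exact le_self_add
      _ ≤ ε ^ p := (ENNReal.div_mul_cancel (by simp) (by simp [hS])).le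
  have hQprob : IsProbabilityMeasure (atomicMeasure e v) := by
    rw [← hsnd]; exact Measure.isProbabilityMeasure_map measurable_snd.aemeasurable
  have hle : wasserstein p X P'.1 ⟨atomicMeasure e v, hQprob⟩ ≤ ε := by
    refine (wasserstein_le_of_map (Q := ⟨atomicMeasure e v, hQprob⟩) hp0 measurable_fst
      measurable_snd hfst hsnd).trans ?_
    rw [one_div, ENNReal.rpow_inv_le_iff hp0]
    exact hcost
  refine ⟨N, v, ⟨⟨atomicMeasure e v, hQprob⟩, P'.moment_of_wasserstein_lt_top
    (hle.trans_lt (Ne.lt_top hεtop))⟩, rfl, ?_⟩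
  refine (edist_triangle _ P' _).trans (add_le_add (hPP'.trans ?_) hle)
  rw [one_div, ENNReal.rpow_inv_le_iff hp0]
  exact hN.le

instance Pp.instSecondCountableTopology : SecondCountableTopology (Pp p X) := by
  rcases isEmpty_or_nonempty X.carrier with hX | hX
  · have : IsEmpty (Pp p X) := ⟨fun P => hX.elim P.1.nonempty.some⟩
    infer_instance
  refine EMetric.secondCountable_of_almost_dense_set fun ε hε => ?_
  let e := TopologicalSpace.denseSeq X.carrier
  refine ⟨⋃ (N : ℕ) (v : Fin (N + 1) → ℚ),
    {Q : Pp p X | (Q.1 : Measure X.carrier) = atomicMeasure e v}, ?_, ?_⟩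
  · refine countable_iUnion fun N => countable_iUnion fun v => Set.Subsingleton.countable ?_
    intro Q hQ R hR
    exact Subtype.ext (Subtype.ext (Eq.trans hQ (Eq.symm hR)))
  · refine iUnion₂_eq_univ_iff.2 fun P => ?_
    obtain ⟨N, v, Q, hQ, hPQ⟩ := P.exists_atomicMeasure (TopologicalSpace.denseRange_denseSeq X.carrier)
      (ENNReal.half_pos hε.ne')
    rw [ENNReal.add_halves] at hPQ
    exact ⟨Q, mem_iUnion₂.2 ⟨N, v, hQ⟩, hPQ⟩

end Approximation

/-! ### Completeness and the Borel `σ`-algebra of `𝒫^p(X)` -/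

/-- Gluing of a sequence of couplings, each two consecutive ones having a common marginal: the
Markov chain whose transition kernels are the disintegrations of the couplings. -/
theorem exists_glue_seq {E : Type*} [MeasurableSpace E] [StandardBorelSpace E] [Nonempty E]
    (γ : ℕ → Measure (E × E)) [∀ n, IsProbabilityMeasure (γ n)]
    (h : ∀ n, (γ n).map Prod.snd = (γ (n + 1)).map Prod.fst) :
    ∃ μ : Measure (ℕ → E), IsProbabilityMeasure μ ∧
      ∀ n, μ.map (fun x => (x n, x (n + 1))) = γ n := by
  let κ : (n : ℕ) → Kernel (∀ _ : Finset.Iic n, E) E := fun n =>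
    (γ n).condKernel.comap (fun x => x ⟨n, Finset.mem_Iic.2 le_rfl⟩) (by fun_prop)
  have : IsProbabilityMeasure ((γ 0).map Prod.fst) :=
    Measure.isProbabilityMeasure_map measurable_fst.aemeasurable
  let μ : Measure (ℕ → E) := Kernel.trajMeasure (X := fun _ => E) ((γ 0).map Prod.fst) κ
  have step : ∀ n, μ.map (fun x => x n) = (γ n).map Prod.fst →
      μ.map (fun x => (x n, x (n + 1))) = γ n := by
    intro n hn
    have hm : Measurable fun z : (∀ _ : Finset.Iic n, E) × E =>
      (z.1 ⟨n, Finset.mem_Iic.2 le_rfl⟩, z.2) := by fun_prop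
    have h1 := congrArg (fun ρ => Measure.map (fun z : (∀ _ : Finset.Iic n, E) × E =>
      (z.1 ⟨n, Finset.mem_Iic.2 le_rfl⟩, z.2)) ρ)
      (Kernel.map_frestrictLe_trajMeasure_compProd_eq_map_trajMeasure (X := fun _ => E)
        (μ₀ := (γ 0).map Prod.fst) (κ := κ) (a := n))
    rw [Measure.map_map hm (by fun_prop)] at h1
    refine Eq.trans h1.symm ?_
    refine Measure.ext fun s hs => ?_
    rw [Measure.map_apply hm hs, Measure.compProd_apply (hm hs)]
    conv_rhs => rw [← (γ n).disintegrate (γ n).condKernel, Measure.compProd_apply hs]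
    rw [Measure.fst, ← hn, lintegral_map (Kernel.measurable_kernel_prodMk_left hs) (by fun_prop),
      lintegral_map (Kernel.measurable_kernel_prodMk_left (hm hs)) (by fun_prop)]
    rfl
  have hmarg : ∀ n, μ.map (fun x => x n) = (γ n).map Prod.fst := by
    intro n
    induction n with
    | zero =>
      have h0 : (fun x : ℕ → E => x 0) = (fun z : ∀ _ : Finset.Iic 0, E =>
        z ⟨0, Finset.mem_Iic.2 le_rfl⟩) ∘ Preorder.frestrictLe (π := fun _ => E) 0 := rfl
      have hμ : μ = Kernel.traj (X := fun _ => E) κ 0 ∘ₘ (((γ 0).map Prod.fst).map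
        (MeasurableEquiv.piUnique (fun _ : Finset.Iic 0 => E)).symm) := rfl
      rw [h0, ← Measure.map_map (by fun_prop) (by fun_prop), hμ,
        Measure.map_comp _ _ (by fun_prop), Kernel.traj_map_frestrictLe, Kernel.partialTraj_self,
        Measure.id_comp, Measure.map_map (by fun_prop) (by fun_prop)]
      exact Measure.map_id
    | succ n ih =>
      rw [← h n, ← step n ih, Measure.map_map measurable_snd (by fun_prop)]
      rfl
  exact ⟨μ, inferInstance, fun n => step n (hmarg n)⟩

section Completeness

variable {p : ℝ} [hp : Fact (1 ≤ p)] {X : DistSpace} [MetricSpace X.carrier]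
  [CompleteSpace X.carrier] [SecondCountableTopology X.carrier] [BorelSpace X.carrier]
  [LawfulDist X]

theorem lintegral_le_Lp {Ω : Type*} [MeasurableSpace Ω] (μ : Measure Ω) [IsProbabilityMeasure μ]
    {f : Ω → ℝ≥0∞} (hf : Measurable f) : ∫⁻ x, f x ∂μ ≤ (∫⁻ x, f x ^ p ∂μ) ^ (1 / p) := by
  have h := eLpNorm'_le_eLpNorm'_of_exponent_le one_pos hp.out μ hf.aestronglyMeasurable
  simpa [eLpNorm'] using h

/-- Completeness: a fast Cauchy sequence of laws is realized, by gluing nearly optimal couplings, by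
a sequence of random variables which converges almost surely and in `L^p`. -/
instance Pp.instCompleteSpace : CompleteSpace (Pp p X) := by
  have hp0 : 0 < p := exponent_pos
  rcases isEmpty_or_nonempty X.carrier with hX | hX
  · have : IsEmpty (Pp p X) := ⟨fun P => hX.elim P.1.nonempty.some⟩
    infer_instance
  -- it suffices that sequences with consecutive distances below `2⁻ⁿ` converge
  let B : ℕ → ℝ≥0∞ := fun n => 2⁻¹ ^ n
  have hBsum : ∑' n, B n ≠ ∞ := by simp [B, ENNReal.tsum_geometric]
  refine EMetric.complete_of_convergent_controlled_sequences B
    (fun n => ENNReal.pow_pos (by simp) n) fun u hu => ?_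
  have hu' : ∀ n, wasserstein p X (u n).1 (u (n + 1)).1 < B n := fun n =>
    hu n n (n + 1) le_rfl (Nat.le_succ n)
  choose γ hγ h1 h2 hlt using fun n => exists_coupling_edist_lt hp0 (hu' n)
  obtain ⟨μ, hμ, hμγ⟩ := exists_glue_seq γ (fun n => (h2 n).trans (h1 (n + 1)).symm)
  have hmarg : ∀ n, μ.map (fun x => x n) = (u n).1 := by
    intro n
    rw [← h1 n, ← hμγ n, Measure.map_map measurable_fst (by fun_prop)]
    rfl
  have hB : ∀ n, (∫⁻ x, edist (x n) (x (n + 1)) ^ p ∂μ) ^ (1 / p) ≤ B n := by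
    intro n
    refine le_trans (le_of_eq ?_) (hlt n).le
    rw [← hμγ n, lintegral_map (by fun_prop) (by fun_prop)]
  have hBnm : ∀ n k, (∫⁻ x, edist (x n) (x (n + k)) ^ p ∂μ) ^ (1 / p) ≤
      ∑ j ∈ Finset.range k, B (j + n) := by
    intro n k
    induction k with
    | zero => simp [hp0, ENNReal.zero_rpow_of_pos]
    | succ k ih =>
      rw [Finset.sum_range_succ, add_comm k n]
      exact (edist_Lp_triangle hp.out μ (g := fun x => x (n + k)) (by fun_prop)
        (by fun_prop)).trans (add_le_add ih (hB (n + k)))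
  -- the expected length of the sequence of random variables is finite, as `p ≥ 1`
  have hsum : ∀ᵐ x ∂μ, ∑' n, edist (x n) (x (n + 1)) < ∞ := by
    refine ae_lt_top (by fun_prop) (ne_top_of_le_ne_top hBsum ?_)
    rw [lintegral_tsum (fun n => by fun_prop)]
    exact ENNReal.tsum_le_tsum fun n => (lintegral_le_Lp μ (by fun_prop)).trans (hB n)
  obtain ⟨L, hLm, hL⟩ := measurable_limit_of_tendsto_metrizable_ae (μ := μ) (L := atTop)
    (f := fun n (x : ℕ → X.carrier) => x n) (fun n => (measurable_pi_apply n).aemeasurable) (by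
      filter_upwards [hsum] with x hx
      exact cauchySeq_tendsto_of_complete
        (cauchySeq_of_edist_le_of_tsum_ne_top _ (fun n => le_rfl) hx.ne))
  -- Fatou's lemma bounds the distance to the limit `L`
  have hdist : ∀ n, (∫⁻ x, edist (x n) (L x) ^ p ∂μ) ^ (1 / p) ≤ ∑' j, B (j + n) := by
    intro n
    rw [one_div, ENNReal.rpow_inv_le_iff hp0]
    calc ∫⁻ x, edist (x n) (L x) ^ p ∂μ
        = ∫⁻ x, liminf (fun k => edist (x n) (x (n + k)) ^ p) atTop ∂μ := by
          refine lintegral_congr_ae ?_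
          filter_upwards [hL] with x hx
          have hx' : Tendsto (fun k => x (n + k)) atTop (𝓝 (L x)) := by
            simpa only [add_comm] using (tendsto_add_atTop_iff_nat n).2 hx
          have h2 : Tendsto (fun k => edist (x n) (x (n + k)) ^ p) atTop
              (𝓝 (edist (x n) (L x) ^ p)) :=
            (ENNReal.continuous_rpow_const.tendsto _).comp (tendsto_const_nhds.edist hx')
          exact h2.liminf_eq.symm
      _ ≤ liminf (fun k => ∫⁻ x, edist (x n) (x (n + k)) ^ p ∂μ) atTop :=
          lintegral_liminf_le (fun k => by fun_prop)
      _ ≤ (∑' j, B (j + n)) ^ p := by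
          refine (liminf_le_liminf (v := fun _ => (∑' j, B (j + n)) ^ p)
            (Eventually.of_forall fun k => ?_)).trans_eq (liminf_const _)
          have := (hBnm n k).trans (ENNReal.sum_le_tsum (Finset.range k))
          rwa [one_div, ENNReal.rpow_inv_le_iff hp0] at this
  have hprob : IsProbabilityMeasure (μ.map L) := Measure.isProbabilityMeasure_map hLm.aemeasurable
  have hW : ∀ n, wasserstein p X (u n).1 ⟨μ.map L, hprob⟩ ≤ ∑' j, B (j + n) := fun n =>
    (wasserstein_le_of_map hp0 (measurable_pi_apply n) hLm (hmarg n) rfl).trans (hdist n)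
  have hfin : ∑' j, B (j + 0) < ∞ := by simpa using hBsum.lt_top
  refine ⟨⟨⟨μ.map L, hprob⟩, (u 0).moment_of_wasserstein_lt_top ((hW 0).trans_lt hfin)⟩, ?_⟩
  refine tendsto_iff_edist_tendsto_0.2 ?_
  exact tendsto_of_tendsto_of_tendsto_of_le_of_le tendsto_const_nhds
    (ENNReal.tendsto_sum_nat_add B hBsum) (fun _ => zero_le) hW

/-- A countably generated `σ`-algebra is generated by a countable `π`-system. -/
theorem exists_piSystem_seq (Y : Type*) [m : MeasurableSpace Y] [MeasurableSpace.CountablyGenerated Y] :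
    ∃ C : ℕ → Set Y, IsPiSystem (range C) ∧ m = MeasurableSpace.generateFrom (range C) := by
  let A := generateSetAlgebra (MeasurableSpace.countableGeneratingSet Y)
  have hA : A.Countable :=
    countable_generateSetAlgebra (MeasurableSpace.countable_countableGeneratingSet)
  have hne : A.Nonempty := ⟨∅, generateSetAlgebra.empty⟩
  obtain ⟨C, hC⟩ := hA.exists_eq_range hne
  refine ⟨C, ?_, ?_⟩
  · rw [← hC]
    exact fun s hs t ht _ => (isSetAlgebra_generateSetAlgebra).inter_mem hs ht
  · rw [← hC, generateFrom_generateSetAlgebra_eq]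
    exact (MeasurableSpace.generateFrom_countableGeneratingSet).symm

/-- By the Lusin–Souslin theorem, the Borel `σ`-algebra of the Wasserstein distance is generated by
the evaluations of measures. -/
theorem Pp.measurable_iff {Ω : Type*} [MeasurableSpace Ω] {f : Ω → Pp p X} :
    Measurable f ↔ Measurable fun ω => ((f ω).1 : Measure X.carrier) := by
  refine ⟨fun h => Pp.measurable_toMeasure.comp h, fun h => ?_⟩
  obtain ⟨C, hC, hgen⟩ := exists_piSystem_seq X.carrier
  have hCm : ∀ n, MeasurableSet (C n) := fun n => by
    rw [hgen]; exact MeasurableSpace.measurableSet_generateFrom ⟨n, rfl⟩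
  -- a Borel injection of the Polish space `𝒫^p(X)`, hence a measurable embedding
  let ev : Pp p X → ℕ → ℝ≥0∞ := fun P n => (P.1 : Measure X.carrier) (C n)
  have hev : Measurable ev := measurable_pi_lambda _ fun n =>
    (Measure.measurable_coe (hCm n)).comp Pp.measurable_toMeasure
  have hinj : Function.Injective ev := by
    intro P Q hPQ
    have h : (P.1 : Measure X.carrier) = Q.1 := by
      refine ext_of_generate_finite _ hgen hC ?_ (by simp)
      rintro _ ⟨n, rfl⟩
      exact congrFun hPQ n
    exact Subtype.ext (Subtype.ext h)
  refine (hev.measurableEmbedding hinj).measurable_comp_iff.1 ?_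
  exact measurable_pi_lambda _ fun n => (Measure.measurable_coe (hCm n)).comp h

end Completeness

/-! ### Measurable selection of nearly optimal couplings -/

section Selection

variable {A B : Type*} [MetricSpace A] [SecondCountableTopology A]
  [MeasurableSpace A] [BorelSpace A] [MetricSpace B] [SecondCountableTopology B]
  [MeasurableSpace B] [BorelSpace B] {f : A → B}

theorem measurableSet_and {Y : Type*} [MeasurableSpace Y] {P Q : Y → Prop}
    (hP : MeasurableSet {y | P y}) (hQ : MeasurableSet {y | Q y}) :
    MeasurableSet {y | P y ∧ Q y} := hP.inter hQ

/-- A map with values in a dense sequence, selected by taking the first admissible index. -/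
theorem exists_measurable_of_dense [Nonempty A] {Φ : B → A → Prop}
    (hm : ∀ a, MeasurableSet {b | Φ b a}) (ho : ∀ b, IsOpen {a | Φ b a}) (hne : ∀ b, ∃ a, Φ b a) :
    ∃ g : B → A, Measurable g ∧ ∀ b, Φ b (g b) := by
  classical
  have h : ∀ b, ∃ i, Φ b (TopologicalSpace.denseSeq A i) := fun b =>
    (TopologicalSpace.denseRange_denseSeq A).exists_mem_open (ho b) (hne b)
  refine ⟨fun b => TopologicalSpace.denseSeq A (Nat.find (h b)), ?_, fun b => Nat.find_spec (h b)⟩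
  exact (measurable_from_nat (f := TopologicalSpace.denseSeq A)).comp
    (measurable_find h fun i => hm _)

/-- A continuous map between Polish spaces which is open in a uniform sense has a measurable right
inverse, which can be chosen close to a given approximate right inverse. -/
theorem exists_measurable_rightInverse [CompleteSpace A] (hf : Continuous f)
    (hopen : ∀ (a : A) (b : B) (c : ℝ≥0∞), 2 * edist (f a) b < c → ∃ a', f a' = b ∧ edist a a' < c)
    {g₀ : B → A} (hg₀ : Measurable g₀) {r : ℝ≥0∞} (hr : 0 < r) (hr' : r ≠ ∞)
    (h₀ : ∀ b, 2 * edist (f (g₀ b)) b < r) :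
    ∃ g : B → A, Measurable g ∧ (∀ b, f (g b) = b) ∧ ∀ b, edist (g₀ b) (g b) ≤ 2 * r := by
  have hrk : ∀ k : ℕ, 0 < r / 2 ^ k := fun k => ENNReal.div_pos hr.ne' (by simp)
  -- from an approximate right inverse with twice the error below `r / 2 ^ k`, move by less than
  -- `r / 2 ^ k` to one for which that bound is halved
  have step : ∀ (k : ℕ) (g : {g : B → A // Measurable g ∧ ∀ b, 2 * edist (f (g b)) b < r / 2 ^ k}),
      ∃ g' : {g : B → A // Measurable g ∧ ∀ b, 2 * edist (f (g b)) b < r / 2 ^ (k + 1)},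
        ∀ b, edist (g.1 b) (g'.1 b) < r / 2 ^ k := by
    rintro k ⟨g, hg, hgb⟩
    have hA : IsEmpty B ∨ Nonempty A := by
      rcases isEmpty_or_nonempty B with h | ⟨⟨b⟩⟩
      · exact Or.inl h
      · exact Or.inr ⟨g b⟩
    rcases hA with hB | hA
    · exact ⟨⟨g, hg, fun b => hB.elim b⟩, fun b => hB.elim b⟩
    obtain ⟨g', hg', h'⟩ := exists_measurable_of_dense
      (Φ := fun b a => edist (g b) a < r / 2 ^ k ∧ 2 * edist (f a) b < r / 2 ^ (k + 1))
      (fun a => measurableSet_and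
        (measurableSet_lt (hg.edist measurable_const) measurable_const)
        (measurableSet_lt ((measurable_const.edist measurable_id).const_mul 2) measurable_const))
      (fun b => IsOpen.and (isOpen_lt (continuous_const.edist continuous_id) continuous_const)
        (isOpen_lt ((ENNReal.continuous_const_mul (a := 2) (by simp)).comp
          (hf.edist continuous_const)) continuous_const))
      (fun b => by
        obtain ⟨a, ha, hga⟩ := hopen (g b) b _ (hgb b)
        exact ⟨a, hga, by simpa [ha] using hrk (k + 1)⟩)
    exact ⟨⟨g', hg', fun b => (h' b).2⟩, fun b => (h' b).1⟩
  choose next hnext using step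
  let G : (k : ℕ) → {g : B → A // Measurable g ∧ ∀ b, 2 * edist (f (g b)) b < r / 2 ^ k} :=
    fun k => Nat.rec ⟨g₀, hg₀, by simpa using h₀⟩ (fun k g => next k g) k
  have hG : ∀ k b, edist ((G k).1 b) ((G (k + 1)).1 b) ≤ r / 2 ^ k := fun k b =>
    (hnext k (G k) b).le
  have hcauchy : ∀ b, CauchySeq fun k => (G k).1 b := fun b =>
    cauchySeq_of_edist_le_geometric_two r hr' fun k => hG k b
  choose g hg using fun b => cauchySeq_tendsto_of_complete (hcauchy b)
  refine ⟨g, ?_, fun b => ?_, fun b => ?_⟩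
  · exact measurable_of_tendsto_metrizable (fun k => (G k).2.1) (tendsto_pi_nhds.2 hg)
  · have h1 : Tendsto (fun k => 2 * edist (f ((G k).1 b)) b) atTop (𝓝 (2 * edist (f (g b)) b)) :=
      ENNReal.Tendsto.const_mul (((hf.tendsto _).comp (hg b)).edist tendsto_const_nhds)
        (Or.inr (by simp))
    have h2 : Tendsto (fun k : ℕ => r / 2 ^ k) atTop (𝓝 0) := by
      have := ENNReal.Tendsto.const_mul (a := r)
        (ENNReal.tendsto_pow_atTop_nhds_zero_of_lt_one (r := 2⁻¹) (by simp)) (Or.inr hr')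
      simpa [ENNReal.div_eq_inv_mul, mul_comm, ENNReal.inv_pow] using this
    have h3 := le_of_tendsto_of_tendsto h1 h2
      (Eventually.of_forall fun k => ((G k).2.2 b).le)
    simpa using h3
  · exact edist_le_of_edist_le_geometric_two_of_tendsto₀ r (fun k => hG k b) (hg b)

end Selection

/-- The square of a metric space, with the maximum metric. -/
abbrev squareDist (X : DistSpace) : DistSpace where
  carrier := X.carrier × X.carrier
  meas := inferInstance
  edist := fun a b => max (X.edist a.1 b.1) (X.edist a.2 b.2)

instance (X : DistSpace) [MetricSpace X.carrier] [LawfulDist X] : LawfulDist (squareDist X) :=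
  ⟨fun a b => by
    change max (X.edist a.1 b.1) (X.edist a.2 b.2) = edist a b
    rw [LawfulDist.edist_eq, LawfulDist.edist_eq, Prod.edist_eq]⟩

section OptimalCouplings

variable {p : ℝ} [hp : Fact (1 ≤ p)] {X : DistSpace} [MetricSpace X.carrier]
  [CompleteSpace X.carrier] [SecondCountableTopology X.carrier] [BorelSpace X.carrier]
  [LawfulDist X]

/-- The `L^p` norm of the distance under a measure on the square. -/
def couplingCost (p : ℝ) (X : DistSpace) [MetricSpace X.carrier]
    (Γ : Measure (X.carrier × X.carrier)) : ℝ≥0∞ := (∫⁻ z, edist z.1 z.2 ^ p ∂Γ) ^ (1 / p)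

/-- The cost is Lipschitz in the coupling. -/
theorem couplingCost_le_add (Γ Δ : Pp p (squareDist X)) :
    couplingCost p X Γ.1 ≤ couplingCost p X Δ.1 + 2 * edist Γ Δ := by
  have hp0 : 0 < p := exponent_pos
  refine ENNReal.le_of_forall_pos_le_add fun ε hε hfin => ?_
  have hε2 : (ε / 2 : ℝ≥0∞) ≠ 0 := by simp [hε.ne']
  obtain ⟨G, hG, h1, h2, hlt⟩ := exists_coupling_edist_lt (X := squareDist X) (P := Γ.1) (Q := Δ.1)
    hp0 (ENNReal.lt_add_right (Γ.wasserstein_lt_top Δ).ne hε2)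
  have hΓ : couplingCost p X Γ.1 = (∫⁻ z, edist z.1.1 z.1.2 ^ p ∂G) ^ (1 / p) := by
    rw [couplingCost, ← h1, lintegral_map (by fun_prop) measurable_fst]
  have hΔ : couplingCost p X Δ.1 = (∫⁻ z, edist z.2.1 z.2.2 ^ p ∂G) ^ (1 / p) := by
    rw [couplingCost, ← h2, lintegral_map (by fun_prop) measurable_snd]
  have e1 : (∫⁻ z, edist z.1.1 z.2.1 ^ p ∂G) ^ (1 / p) ≤ edist Γ Δ + ε / 2 := by
    refine le_trans ?_ hlt.le
    gcongr with z
    exact le_max_left _ _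
  have e2 : (∫⁻ z, edist z.2.2 z.1.2 ^ p ∂G) ^ (1 / p) ≤ edist Γ Δ + ε / 2 := by
    refine le_trans ?_ hlt.le
    gcongr with z
    rw [edist_comm]
    exact le_max_right _ _
  rw [hΓ, hΔ]
  calc (∫⁻ z, edist z.1.1 z.1.2 ^ p ∂G) ^ (1 / p)
      ≤ (∫⁻ z, edist z.1.1 z.2.1 ^ p ∂G) ^ (1 / p) +
        ((∫⁻ z, edist z.2.1 z.2.2 ^ p ∂G) ^ (1 / p) +
          (∫⁻ z, edist z.2.2 z.1.2 ^ p ∂G) ^ (1 / p)) :=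
        (edist_Lp_triangle hp.out G (g := fun z => z.2.1) (by fun_prop) (by fun_prop)).trans
          (add_le_add le_rfl
            (edist_Lp_triangle hp.out G (g := fun z => z.2.2) (by fun_prop) (by fun_prop)))
    _ ≤ (edist Γ Δ + ε / 2) + ((∫⁻ z, edist z.2.1 z.2.2 ^ p ∂G) ^ (1 / p) +
          (edist Γ Δ + ε / 2)) := by gcongr
    _ = (∫⁻ z, edist z.2.1 z.2.2 ^ p ∂G) ^ (1 / p) + 2 * edist Γ Δ + (ε / 2 + ε / 2) := by ring
    _ = _ := by rw [ENNReal.add_halves]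

/-- A coupling of two measures with finite `p`-th moment has finite `p`-th moment on the square. -/
theorem exists_Pp_square {P Q : Pp p X} {Γ : Measure (X.carrier × X.carrier)}
    (h1 : Γ.map Prod.fst = P.1) (h2 : Γ.map Prod.snd = Q.1) :
    ∃ x₀, ∫⁻ x, (squareDist X).edist x x₀ ^ p ∂Γ < ∞ := by
  have hp0 : 0 < p := exponent_pos
  obtain ⟨x₀⟩ : Nonempty X.carrier := P.1.nonempty
  have hP := P.lintegral_edist_lt_top x₀
  have hQ := Q.lintegral_edist_lt_top x₀
  rw [← h1, lintegral_map (by fun_prop) measurable_fst] at hP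
  rw [← h2, lintegral_map (by fun_prop) measurable_snd] at hQ
  refine ⟨(x₀, x₀), ?_⟩
  refine lt_of_le_of_lt (lintegral_mono (g := fun z : X.carrier × X.carrier =>
    edist z.1 x₀ ^ p + edist z.2 x₀ ^ p) fun z => ?_) ?_
  · change max (X.edist z.1 x₀) (X.edist z.2 x₀) ^ p ≤ _
    rw [LawfulDist.edist_eq, LawfulDist.edist_eq]
    rcases max_choice (edist z.1 x₀) (edist z.2 x₀) with h | h <;> rw [h]
    · exact le_self_add
    · exact le_add_self
  · rw [lintegral_add_left (by fun_prop)]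
    exact ENNReal.add_lt_top.2 ⟨hP, hQ⟩

/-- Maps of Lipschitz constant `1` preserve finiteness of the `p`-th moment; it is applied to the two
projections. -/
theorem exists_marginal (f : X.carrier × X.carrier → X.carrier) (hf : LipschitzWith 1 f)
    (Γ : Pp p (squareDist X)) :
    ∃ P : Pp p X, (P.1 : Measure X.carrier) = (Γ.1 : Measure (X.carrier × X.carrier)).map f := by
  have hp0 : 0 < p := exponent_pos
  have hfm : Measurable f := hf.continuous.measurable
  obtain ⟨x₀⟩ : Nonempty (squareDist X).carrier := Γ.1.nonempty
  refine ⟨⟨⟨(Γ.1 : Measure (X.carrier × X.carrier)).map f,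
    Measure.isProbabilityMeasure_map hfm.aemeasurable⟩, f x₀, ?_⟩, rfl⟩
  change ∫⁻ x, _ ∂((Γ.1 : Measure (X.carrier × X.carrier)).map f) < ∞
  simp only [LawfulDist.edist_eq]
  rw [lintegral_map (by fun_prop) hfm]
  refine lt_of_le_of_lt (lintegral_mono fun z => ?_) (Γ.lintegral_edist_lt_top x₀)
  exact ENNReal.rpow_le_rpow (by simpa using hf.edist_le_mul z x₀) hp0.le

/-- The two marginals of a measure on the square. -/
def marginals (Γ : Pp p (squareDist X)) : Pp p X × Pp p X :=
  ((exists_marginal Prod.fst LipschitzWith.prod_fst Γ).choose,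
    (exists_marginal Prod.snd LipschitzWith.prod_snd Γ).choose)

theorem marginals_fst (Γ : Pp p (squareDist X)) : ((marginals Γ).1.1 : Measure X.carrier) =
    (Γ.1 : Measure (X.carrier × X.carrier)).map Prod.fst :=
  (exists_marginal Prod.fst LipschitzWith.prod_fst Γ).choose_spec

theorem marginals_snd (Γ : Pp p (squareDist X)) : ((marginals Γ).2.1 : Measure X.carrier) =
    (Γ.1 : Measure (X.carrier × X.carrier)).map Prod.snd :=
  (exists_marginal Prod.snd LipschitzWith.prod_snd Γ).choose_spec

theorem edist_map_le {f : X.carrier × X.carrier → X.carrier} (hf : LipschitzWith 1 f)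
    {Γ Δ : Pp p (squareDist X)} {P Q : Pp p X}
    (hP : (P.1 : Measure X.carrier) = (Γ.1 : Measure (X.carrier × X.carrier)).map f)
    (hQ : (Q.1 : Measure X.carrier) = (Δ.1 : Measure (X.carrier × X.carrier)).map f) :
    edist P Q ≤ edist Γ Δ := by
  have hp0 : 0 < p := exponent_pos
  have hfm : Measurable f := hf.continuous.measurable
  refine le_of_forall_gt fun c hc => ?_
  obtain ⟨G, hG, h1, h2, hlt⟩ := exists_coupling_edist_lt (X := squareDist X) (P := Γ.1) (Q := Δ.1)
    hp0 hc
  refine lt_of_le_of_lt (Pp.edist_le_of_map (μ := G) (f := fun z => f z.1) (g := fun z => f z.2)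
    (hfm.comp measurable_fst) (hfm.comp measurable_snd) ?_ ?_) (lt_of_le_of_lt ?_ hlt)
  · rw [hP, ← h1, Measure.map_map hfm measurable_fst]; rfl
  · rw [hQ, ← h2, Measure.map_map hfm measurable_snd]; rfl
  · gcongr with z
    simpa using hf.edist_le_mul z.1 z.2

theorem continuous_marginals : Continuous (marginals (p := p) (X := X)) := by
  refine LipschitzWith.continuous (K := 1) fun Γ Δ => ?_
  rw [Prod.edist_eq, ENNReal.coe_one, one_mul]
  exact max_le (edist_map_le LipschitzWith.prod_fst (marginals_fst Γ) (marginals_fst Δ))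
    (edist_map_le LipschitzWith.prod_snd (marginals_snd Γ) (marginals_snd Δ))

theorem exists_marginals_eq {b : Pp p X × Pp p X} {Γ : Measure (X.carrier × X.carrier)}
    (hΓ : IsProbabilityMeasure Γ) (h1 : Γ.map Prod.fst = b.1.1) (h2 : Γ.map Prod.snd = b.2.1) :
    ∃ Δ : Pp p (squareDist X), marginals Δ = b ∧ (Δ.1 : Measure (X.carrier × X.carrier)) = Γ := by
  refine ⟨⟨⟨Γ, hΓ⟩, exists_Pp_square h1 h2⟩, ?_, rfl⟩
  refine Prod.ext (Subtype.ext (Subtype.ext ?_)) (Subtype.ext (Subtype.ext ?_))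
  · exact (marginals_fst _).trans h1
  · exact (marginals_snd _).trans h2

/-- Couplings can be moved along with their marginals, by gluing. -/
theorem exists_marginals_near (Γ : Pp p (squareDist X)) (b : Pp p X × Pp p X) (c : ℝ≥0∞)
    (hc : 2 * edist (marginals Γ) b < c) : ∃ Δ, marginals Δ = b ∧ edist Γ Δ < c := by
  have hp0 : 0 < p := exponent_pos
  have : Nonempty X.carrier := b.1.1.nonempty
  have hc' : edist (marginals Γ) b < c / 2 := by
    rwa [ENNReal.lt_div_iff_mul_lt (by simp) (by simp), mul_comm]
  rw [Prod.edist_eq, max_lt_iff] at hc'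
  obtain ⟨γ, hγ, h1, h2, hlt⟩ := exists_coupling_edist_lt hp0 hc'.1
  obtain ⟨δ, hδ, h3, h4, hlt'⟩ := exists_coupling_edist_lt hp0 hc'.2
  rw [marginals_fst] at h1
  rw [marginals_snd] at h3
  have hsw : IsProbabilityMeasure ((Γ.1 : Measure (X.carrier × X.carrier)).map Prod.swap) :=
    Measure.isProbabilityMeasure_map measurable_swap.aemeasurable
  obtain ⟨π, hπ, hπ1, hπ2⟩ := exists_glue
    ((Γ.1 : Measure (X.carrier × X.carrier)).map Prod.swap) γ (by
      rw [Measure.map_map measurable_snd measurable_swap, h1]; rfl)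
  have hm : Measurable fun z : (X.carrier × X.carrier) × X.carrier => ((z.1.2, z.2), z.1.1) := by
    fun_prop
  have hπp : IsProbabilityMeasure (π.map fun z => ((z.1.2, z.2), z.1.1)) :=
    Measure.isProbabilityMeasure_map hm.aemeasurable
  obtain ⟨ρ, hρ, hρ1, hρ2⟩ := exists_glue (π.map fun z => ((z.1.2, z.2), z.1.1)) δ (by
      rw [h3, Measure.map_map measurable_snd hm]
      have : Prod.snd ∘ (fun z : (X.carrier × X.carrier) × X.carrier => ((z.1.2, z.2), z.1.1)) =
        Prod.snd ∘ Prod.swap ∘ Prod.fst := rfl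
      rw [this, ← Measure.map_map measurable_snd (by fun_prop),
        ← Measure.map_map measurable_swap (by fun_prop), hπ1,
        Measure.map_map measurable_swap measurable_swap, Prod.swap_swap_eq, Measure.map_id])
  have hmΔ : Measurable fun z : ((X.carrier × X.carrier) × X.carrier) × X.carrier =>
    (z.1.1.2, z.2) := by fun_prop
  -- the law of the first pair under `ρ` is `Γ`
  have hρΓ : ρ.map (fun z => (z.1.1.1, z.1.2)) = Γ.1 := by
    have : (fun z : ((X.carrier × X.carrier) × X.carrier) × X.carrier => (z.1.1.1, z.1.2)) =
      (fun w => (w.1.1, w.2)) ∘ Prod.fst := rfl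
    rw [this, ← Measure.map_map (by fun_prop) measurable_fst, hρ1, Measure.map_map (by fun_prop) hm]
    have : (fun w : (X.carrier × X.carrier) × X.carrier => (w.1.1, w.2)) ∘
      (fun z : (X.carrier × X.carrier) × X.carrier => ((z.1.2, z.2), z.1.1)) =
        Prod.swap ∘ Prod.fst := rfl
    rw [this, ← Measure.map_map measurable_swap measurable_fst, hπ1,
      Measure.map_map measurable_swap measurable_swap, Prod.swap_swap_eq, Measure.map_id]
  have hργ : ρ.map (fun z => z.1.1) = γ := by
    have : (fun z : ((X.carrier × X.carrier) × X.carrier) × X.carrier => z.1.1) =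
      Prod.fst ∘ Prod.fst := rfl
    rw [this, ← Measure.map_map (by fun_prop) measurable_fst, hρ1, Measure.map_map (by fun_prop) hm,
      ← hπ2]
    rfl
  obtain ⟨Δ, hΔ, hΔρ⟩ := exists_marginals_eq (b := b) (Γ := ρ.map fun z => (z.1.1.2, z.2))
    (Measure.isProbabilityMeasure_map hmΔ.aemeasurable) (by
      rw [Measure.map_map measurable_fst hmΔ, ← h2, ← hργ,
        Measure.map_map measurable_snd (by fun_prop)]; rfl) (by
      rw [Measure.map_map measurable_snd hmΔ, ← h4, ← hρ2,
        Measure.map_map measurable_snd (by fun_prop)]; rfl)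
  refine ⟨Δ, hΔ, ?_⟩
  have hle := Pp.edist_le_of_map (P := Γ) (Q := Δ) (μ := ρ) (f := fun z => (z.1.1.1, z.1.2))
    (g := fun z => (z.1.1.2, z.2)) (by fun_prop) hmΔ hρΓ hΔρ.symm
  refine hle.trans_lt ?_
  have hadd : (∫⁻ z, edist (z.1.1.1, z.1.2) (z.1.1.2, z.2) ^ p ∂ρ) ^ (1 / p) ≤
      (∫⁻ z, edist z.1.1.1 z.1.1.2 ^ p ∂ρ) ^ (1 / p) +
        (∫⁻ z, edist z.1.2 z.2 ^ p ∂ρ) ^ (1 / p) := by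
    refine le_trans ?_ (ENNReal.lintegral_Lp_add_le (by fun_prop) (by fun_prop) hp.out)
    gcongr with z
    rw [Prod.edist_eq]
    exact max_le le_self_add le_add_self
  have i1 : ∫⁻ z, edist z.1.1.1 z.1.1.2 ^ p ∂ρ = ∫⁻ z, edist z.1 z.2 ^ p ∂γ := by
    rw [← hργ, lintegral_map (by fun_prop) (by fun_prop)]
  have i2 : ∫⁻ z, edist z.1.2 z.2 ^ p ∂ρ = ∫⁻ z, edist z.1 z.2 ^ p ∂δ := by
    rw [← hρ2, lintegral_map (by fun_prop) (by fun_prop)]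
  rw [i1, i2] at hadd
  exact hadd.trans_lt ((ENNReal.add_lt_add hlt hlt').trans_eq (ENNReal.add_halves c))

/-- Couplings with cost close to the distance can be selected measurably: approximate marginals and
a small cost are open conditions, which a countable selection satisfies, and the marginals are then
corrected to the exact ones at a small cost. -/
theorem exists_measurable_coupling_cost_le {δ : ℝ≥0∞} (hδ : 0 < δ) (hδ' : δ ≠ ∞) :
    ∃ g : Pp p X × Pp p X → Pp p (squareDist X), Measurable g ∧ (∀ b, marginals (g b) = b) ∧
      ∀ b, couplingCost p X (g b).1 ≤ edist b.1 b.2 + 5 * δ := by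
  have hp0 : 0 < p := exponent_pos
  rcases isEmpty_or_nonempty (Pp p X × Pp p X) with hB | ⟨⟨b₀⟩⟩
  · exact ⟨fun b => hB.elim b, measurable_of_empty _, fun b => hB.elim b, fun b => hB.elim b⟩
  have hex : ∀ b : Pp p X × Pp p X, ∃ Γ : Pp p (squareDist X), marginals Γ = b ∧
      couplingCost p X Γ.1 < edist b.1 b.2 + δ := by
    intro b
    obtain ⟨γ, hγ, h1, h2, hlt⟩ := exists_coupling_edist_lt (P := b.1.1) (Q := b.2.1) hp0
      (ENNReal.lt_add_right (b.1.wasserstein_lt_top b.2).ne hδ.ne')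
    obtain ⟨Γ, hΓ, hΓγ⟩ := exists_marginals_eq hγ h1 h2
    exact ⟨Γ, hΓ, by rw [hΓγ]; exact hlt⟩
  have hcont : Continuous fun Γ : Pp p (squareDist X) => couplingCost p X Γ.1 :=
    continuous_of_le_add_edist 2 (by simp) couplingCost_le_add
  have : Nonempty (Pp p (squareDist X)) := ⟨(hex b₀).choose⟩
  obtain ⟨g₀, hg₀, h₀⟩ := exists_measurable_of_dense
    (Φ := fun (b : Pp p X × Pp p X) (Γ : Pp p (squareDist X)) =>
      2 * edist (marginals Γ) b < δ ∧ couplingCost p X Γ.1 < edist b.1 b.2 + δ)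
    (fun Γ => measurableSet_and
      (measurableSet_lt ((measurable_const.edist measurable_id).const_mul 2) measurable_const)
      (measurableSet_lt measurable_const ((measurable_fst.edist measurable_snd).add_const δ)))
    (fun b => IsOpen.and
      (isOpen_lt ((ENNReal.continuous_const_mul (a := 2) (by simp)).comp
        (continuous_marginals.edist continuous_const)) continuous_const)
      (isOpen_lt hcont continuous_const))
    (fun b => by
      obtain ⟨Γ, h1, h2⟩ := hex b
      exact ⟨Γ, by simpa [h1] using hδ, h2⟩)
  obtain ⟨g, hg, hgb, hgd⟩ := exists_measurable_rightInverse continuous_marginals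
    exists_marginals_near hg₀ hδ hδ' fun b => (h₀ b).1
  refine ⟨g, hg, hgb, fun b => (couplingCost_le_add (g b) (g₀ b)).trans ?_⟩
  calc couplingCost p X (g₀ b).1 + 2 * edist (g b) (g₀ b)
      ≤ (edist b.1 b.2 + δ) + 2 * (2 * δ) := by
        gcongr
        · exact (h₀ b).2.le
        · rw [edist_comm]; exact hgd b
    _ = edist b.1 b.2 + 5 * δ := by ring

/-- Nearly optimal couplings can be selected measurably. -/
theorem exists_measurable_coupling {ε : ℝ≥0∞} (hε : 0 < ε) :
    ∃ g : Pp p X × Pp p X → Measure (X.carrier × X.carrier), Measurable g ∧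
      ∀ b, IsProbabilityMeasure (g b) ∧ (g b).map Prod.fst = b.1.1 ∧ (g b).map Prod.snd = b.2.1 ∧
        ∫⁻ z, edist z.1 z.2 ^ p ∂(g b) ≤ edist b.1 b.2 ^ p + ε := by
  classical
  have hp0 : 0 < p := exponent_pos
  have hk : ∀ k : ℕ, (0 : ℝ≥0∞) < 2⁻¹ ^ k := fun k => ENNReal.pow_pos (by simp) k
  choose G hG hGm hGc using fun k : ℕ => exists_measurable_coupling_cost_le (p := p) (X := X)
    (hk k) (ENNReal.pow_ne_top (by simp))
  have hex : ∀ b : Pp p X × Pp p X, ∃ k : ℕ,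
      (edist b.1 b.2 + 5 * 2⁻¹ ^ k) ^ p < edist b.1 b.2 ^ p + ε := by
    intro b
    have h1 : Tendsto (fun k : ℕ => (edist b.1 b.2 + 5 * 2⁻¹ ^ k) ^ p) atTop
        (𝓝 ((edist b.1 b.2 + 5 * 0) ^ p)) :=
      (ENNReal.continuous_rpow_const.tendsto _).comp (Tendsto.const_add _
        (ENNReal.Tendsto.const_mul
          (ENNReal.tendsto_pow_atTop_nhds_zero_of_lt_one (by simp)) (Or.inr (by simp))))
    rw [mul_zero, add_zero] at h1
    refine (h1.eventually_lt_const (ENNReal.lt_add_right ?_ hε.ne')).exists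
    exact ENNReal.rpow_ne_top_of_nonneg hp0.le (edist_ne_top _ _)
  let g : Pp p X × Pp p X → Pp p (squareDist X) := fun b => G (Nat.find (hex b)) b
  have hg : Measurable g := by
    have h1 : Measurable fun q : ℕ × (Pp p X × Pp p X) => G q.1 q.2 :=
      measurable_from_prod_countable_right fun k => hG k
    refine h1.comp (Measurable.prodMk (measurable_find hex fun k => ?_) measurable_id)
    exact measurableSet_lt (by fun_prop) (by fun_prop)
  refine ⟨fun b => (g b).1, Pp.measurable_toMeasure.comp hg, fun b => ⟨inferInstance, ?_, ?_, ?_⟩⟩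
  · rw [← marginals_fst, hGm]
  · rw [← marginals_snd, hGm]
  · have h1 := hGc (Nat.find (hex b)) b
    rw [couplingCost, one_div, ENNReal.rpow_inv_le_iff hp0] at h1
    exact h1.trans (Nat.find_spec (hex b)).le

end OptimalCouplings

/-! ### The spaces of the recursion are Polish -/

section LpMetrics

variable {p : ℝ} [hp : Fact (1 ≤ p)]

/-- A complete metric, transported along a homeomorphism. The topology of `E` is given in advance,
and the metric is compatible with it only propositionally. -/
theorem exists_metricSpace_of_equiv {E F : Type*} [tE : TopologicalSpace E] [MetricSpace F]
    [CompleteSpace F] (e : E ≃ₜ F) : ∃ ms : MetricSpace E,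
      (∀ a b, ms.edist a b = edist (e a) (e b)) ∧
      ms.toPseudoMetricSpace.toUniformSpace.toTopologicalSpace = tE ∧
      @CompleteSpace E ms.toPseudoMetricSpace.toUniformSpace := by
  refine ⟨MetricSpace.induced e e.injective inferInstance, fun a b => rfl, ?_, ?_⟩
  · exact e.isInducing.eq_induced.symm
  · let _ : MetricSpace E := MetricSpace.induced e e.injective inferInstance
    have he : Isometry e := fun a b => rfl
    exact (IsometryEquiv.mk e.toEquiv he).completeSpace

/-- The `ℓ^p` metric on a product induces the product topology and is complete. -/
theorem exists_Lp_prod_metric (E F : Type*) [MetricSpace E] [CompleteSpace E] [MetricSpace F]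
    [CompleteSpace F] : ∃ ms : MetricSpace (E × F),
      (∀ a b, ms.edist a b = (edist a.1 b.1 ^ p + edist a.2 b.2 ^ p) ^ (1 / p)) ∧
      ms.toPseudoMetricSpace.toUniformSpace.toTopologicalSpace = instTopologicalSpaceProd ∧
      @CompleteSpace _ ms.toPseudoMetricSpace.toUniformSpace := by
  have hp0 : 0 < p := exponent_pos
  have : Fact (1 ≤ ENNReal.ofReal p) := ⟨by simpa using hp.out⟩
  have hpr : (ENNReal.ofReal p).toReal = p := ENNReal.toReal_ofReal hp0.le
  obtain ⟨ms, h1, h2, h3⟩ := exists_metricSpace_of_equiv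
    (WithLp.homeomorphProd (ENNReal.ofReal p) E F).symm
  refine ⟨ms, fun a b => ?_, h2, h3⟩
  rw [h1, WithLp.prod_edist_eq_add (by rwa [hpr]), hpr]
  rfl

/-- The `ℓ^p` metric on a finite power induces the product topology and is complete. -/
theorem exists_Lp_pi_metric (ι E : Type*) [Fintype ι] [MetricSpace E] [CompleteSpace E] :
    ∃ ms : MetricSpace (ι → E),
      (∀ a b, ms.edist a b = (∑ i, edist (a i) (b i) ^ p) ^ (1 / p)) ∧
      ms.toPseudoMetricSpace.toUniformSpace.toTopologicalSpace = Pi.topologicalSpace ∧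
      @CompleteSpace _ ms.toPseudoMetricSpace.toUniformSpace := by
  have hp0 : 0 < p := exponent_pos
  have : Fact (1 ≤ ENNReal.ofReal p) := ⟨by simpa using hp.out⟩
  have hpr : (ENNReal.ofReal p).toReal = p := ENNReal.toReal_ofReal hp0.le
  obtain ⟨ms, h1, h2, h3⟩ := exists_metricSpace_of_equiv
    (PiLp.homeomorph (ENNReal.ofReal p) (fun _ : ι => E)).symm
  refine ⟨ms, fun a b => ?_, h2, h3⟩
  rw [h1, PiLp.edist_eq_sum (by rwa [hpr]), hpr]
  rfl

end LpMetrics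

/-- The carrier of `X` is nonempty, its distance is a complete separable metric, and its
`σ`-algebra is the Borel `σ`-algebra. -/
def IsPolish (X : DistSpace) : Prop :=
  Nonempty X.carrier ∧ ∃ _ : MetricSpace X.carrier, CompleteSpace X.carrier ∧
    SecondCountableTopology X.carrier ∧ BorelSpace X.carrier ∧ LawfulDist X

section Nested

variable {p : ℝ} [hp : Fact (1 ≤ p)] {m : MetricSpace ℝ}

theorem isPolish_real
    (hm : m.toPseudoMetricSpace.toUniformSpace.toTopologicalSpace = usualTopology)
    (hc : @CompleteSpace ℝ m.toPseudoMetricSpace.toUniformSpace) (p : ℝ) :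
    IsPolish (nestedSpace p m 0) := by
  refine ⟨⟨(0 : ℝ)⟩, m, hc, ?_, ?_, @LawfulDist.mk (nestedSpace p m 0) m fun _ _ => rfl⟩
  · change @SecondCountableTopology ℝ m.toPseudoMetricSpace.toUniformSpace.toTopologicalSpace
    rw [hm]; infer_instance
  · change @BorelSpace ℝ m.toPseudoMetricSpace.toUniformSpace.toTopologicalSpace _
    rw [hm]; infer_instance

/-- The step of the recursion preserves Polish spaces. Since `𝒫^p(X)` is separable, the Borel
`σ`-algebra of the step is the product `σ`-algebra. -/
theorem isPolish_nestedStep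
    (hm : m.toPseudoMetricSpace.toUniformSpace.toTopologicalSpace = usualTopology)
    (hc : @CompleteSpace ℝ m.toPseudoMetricSpace.toUniformSpace) {X : DistSpace}
    (hX : IsPolish X) : IsPolish (nestedStep p m X) ∧
      (nestedStep p m X).meas = (Prod.instMeasurableSpace : MeasurableSpace (ℝ × Pp p X)) := by
  obtain ⟨⟨x₀⟩, mX, _, _, _, _⟩ := hX
  obtain ⟨ms, h1, h2, h3⟩ := @exists_Lp_prod_metric p _ ℝ (Pp p X) m hc _ _
  rw [hm] at h2
  have hmeas : (nestedStep p m X).meas = borel (ℝ × Pp p X) := by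
    have h := @borelOf_edist (ℝ × Pp p X) ms.toEMetricSpace
    refine Eq.trans ?_ (h.trans (congrArg (@borel (ℝ × Pp p X)) h2))
    change borelOf _ = borelOf _
    congr 1
    ext a b
    exact (h1 a b).symm
  have hprod : (nestedStep p m X).meas =
      (Prod.instMeasurableSpace : MeasurableSpace (ℝ × Pp p X)) := by
    rw [hmeas]; exact (BorelSpace.measurable_eq (α := ℝ × Pp p X)).symm
  refine ⟨⟨⟨((0 : ℝ), Pp.dirac p x₀)⟩, ms, h3, ?_, ?_,
    @LawfulDist.mk (nestedStep p m X) ms fun a b => (h1 a b).symm⟩, hprod⟩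
  · change @SecondCountableTopology (ℝ × Pp p X)
      ms.toPseudoMetricSpace.toUniformSpace.toTopologicalSpace
    rw [h2]; infer_instance
  · refine @BorelSpace.mk (nestedStep p m X).carrier
      ms.toPseudoMetricSpace.toUniformSpace.toTopologicalSpace _ ?_
    exact hmeas.trans (congrArg (@borel (ℝ × Pp p X)) h2).symm

theorem isPolish_nestedSpace
    (hm : m.toPseudoMetricSpace.toUniformSpace.toTopologicalSpace = usualTopology)
    (hc : @CompleteSpace ℝ m.toPseudoMetricSpace.toUniformSpace) (k : ℕ) :
    IsPolish (nestedSpace p m k) := by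
  induction k with
  | zero => exact isPolish_real hm hc p
  | succ k ih => exact (isPolish_nestedStep hm hc ih).1

theorem isPolish_pathSpace
    (hm : m.toPseudoMetricSpace.toUniformSpace.toTopologicalSpace = usualTopology)
    (hc : @CompleteSpace ℝ m.toPseudoMetricSpace.toUniformSpace) (n : ℕ) :
    IsPolish (pathSpace p m n) := by
  obtain ⟨ms, h1, h2, h3⟩ := @exists_Lp_pi_metric p _ (Fin (n + 1)) ℝ _ m hc
  rw [hm] at h2
  refine ⟨⟨fun _ => (0 : ℝ)⟩, ms, h3, ?_, ?_,
    @LawfulDist.mk (pathSpace p m n) ms fun a b => (h1 a b).symm⟩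
  · change @SecondCountableTopology (Fin (n + 1) → ℝ)
      ms.toPseudoMetricSpace.toUniformSpace.toTopologicalSpace
    rw [h2]; infer_instance
  · change @BorelSpace (Fin (n + 1) → ℝ)
      ms.toPseudoMetricSpace.toUniformSpace.toTopologicalSpace _
    rw [h2]; infer_instance

end Nested

/-! ### Causality of couplings -/

theorem measure_eq_of_lintegral_eq {Y : Type*} [MeasurableSpace Y] {μ ν : Measure Y}
    (h : ∀ φ : Y → ℝ≥0∞, Measurable φ → ∫⁻ y, φ y ∂μ = ∫⁻ y, φ y ∂ν) : μ = ν := by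
  refine Measure.ext fun s hs => ?_
  have := h (s.indicator 1) (measurable_one.indicator hs)
  rwa [lintegral_indicator_one hs, lintegral_indicator_one hs] at this

section Causal

variable {Ω : Type*} [MeasurableSpace Ω] [StandardBorelSpace Ω] [Nonempty Ω]
  {μ ν : Measure Ω} [IsProbabilityMeasure μ] [IsProbabilityMeasure ν] {r a : Ω → Ω}

/-- Drawing `w` from the conditional law of `x` given `r x` reproduces the joint law of `(r x, x)`. -/
theorem lintegral_condDistrib_id (hr : Measurable r) {φ : Ω × Ω → ℝ≥0∞} (hφ : Measurable φ) :
    ∫⁻ x, ∫⁻ w, φ (r x, w) ∂(condDistrib id r μ (r x)) ∂μ = ∫⁻ x, φ (r x, x) ∂μ := by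
  have h := compProd_map_condDistrib (mβ := ‹_›) (μ := μ) (X := r) (Y := id) aemeasurable_id
  have h1 : ∫⁻ z, φ z ∂(μ.map r ⊗ₘ condDistrib id r μ) = ∫⁻ x, φ (r x, x) ∂μ := by
    rw [h, lintegral_map hφ (by fun_prop)]
    rfl
  rw [← h1, Measure.lintegral_compProd hφ, lintegral_map _ hr]
  exact hφ.lintegral_kernel_prod_right'

/-- The conditional law of `x` given `r x = c` is carried by the fibre of `r` over `c`. -/
theorem condDistrib_id_ae_eq (hr : Measurable r) :
    ∀ᵐ x ∂μ, ∀ᵐ w ∂(condDistrib id r μ (r x)), r w = r x := by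
  have hs : MeasurableSet {z : Ω × Ω | r z.2 ≠ z.1} :=
    (measurableSet_eq_fun (hr.comp measurable_snd) measurable_fst).compl
  have h := lintegral_condDistrib_id (μ := μ) hr (φ := indicator {z : Ω × Ω | r z.2 ≠ z.1} 1)
    (measurable_one.indicator hs)
  have h0 : ∫⁻ x, indicator {z : Ω × Ω | r z.2 ≠ z.1} (1 : Ω × Ω → ℝ≥0∞) (r x, x) ∂μ = 0 := by
    simp
  rw [h0, lintegral_eq_zero_iff] at h
  · filter_upwards [h] with x hx
    rw [ae_iff]
    have hx' : ∫⁻ w, indicator {w | ¬ r w = r x} (1 : Ω → ℝ≥0∞) w ∂(condDistrib id r μ (r x)) = 0 :=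
      hx
    rwa [lintegral_indicator_one] at hx'
    exact (measurableSet_eq_fun hr measurable_const).compl
  · exact (Measurable.lintegral_kernel_prod_right' (κ := condDistrib id r μ)
      (measurable_one.indicator hs)).comp hr

/-- Causality of `η`, a measure on pairs `(x, y)`, at the time whose past is recorded by `r`: given
the past `(r x, r y)` of both paths, the conditional law of `x` is the conditional law under `μ` of
`x` given its own past `r x`. -/
def CausalAt (r : Ω → Ω) (μ : Measure Ω) [IsFiniteMeasure μ] (η : Measure (Ω × Ω)) : Prop :=
  ∀ φ : (Ω × Ω) × Ω → ℝ≥0∞, Measurable φ → ∫⁻ z, φ ((r z.1, r z.2), z.1) ∂η =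
    ∫⁻ z, ∫⁻ w, φ ((r z.1, r z.2), w) ∂(condDistrib id r μ (r z.1)) ∂η

/-- The measure on pairs of paths whose pasts have joint law `Q` and whose futures are
conditionally independent given the pasts. -/
def liftPast (r : Ω → Ω) (μ ν : Measure Ω) [IsFiniteMeasure μ] [IsFiniteMeasure ν]
    (Q : Measure (Ω × Ω)) : Measure (Ω × Ω) :=
  (condDistrib id r μ ∥ₖ condDistrib id r ν) ∘ₘ Q

instance (Q : Measure (Ω × Ω)) [IsProbabilityMeasure Q] :
    IsProbabilityMeasure (liftPast r μ ν Q) := by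
  unfold liftPast; infer_instance

theorem lintegral_liftPast (Q : Measure (Ω × Ω)) {F : Ω × Ω → ℝ≥0∞} (hF : Measurable F) :
    ∫⁻ z, F z ∂(liftPast r μ ν Q) = ∫⁻ q, ∫⁻ w, ∫⁻ w', F (w, w') ∂(condDistrib id r ν q.2)
      ∂(condDistrib id r μ q.1) ∂Q := by
  rw [liftPast, Measure.lintegral_bind (Kernel.aemeasurable _) hF.aemeasurable]
  refine lintegral_congr fun q => ?_
  rw [Kernel.lintegral_parallelComp _ hF]

theorem liftPast_swap (Q : Measure (Ω × Ω)) :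
    (liftPast r μ ν Q).map Prod.swap = liftPast r ν μ (Q.map Prod.swap) := by
  refine measure_eq_of_lintegral_eq fun φ hφ => ?_
  rw [lintegral_map hφ measurable_swap,
    lintegral_liftPast (F := fun z => φ z.swap) _ (hφ.comp measurable_swap), liftPast,
    Measure.lintegral_bind (Kernel.aemeasurable _) hφ.aemeasurable,
    lintegral_map hφ.lintegral_kernel measurable_swap]
  refine lintegral_congr fun q => ?_
  rw [Kernel.lintegral_parallelComp_symm _ hφ]
  rfl

/-- Under `liftPast r μ ν Q`, the pasts have joint law `Q`. -/
theorem lintegral_liftPast_past (hr : Measurable r) {Q : Measure (Ω × Ω)}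
    (hQ1 : Q.map Prod.fst = μ.map r) (hQ2 : Q.map Prod.snd = ν.map r)
    {F : (Ω × Ω) × (Ω × Ω) → ℝ≥0∞} (hF : Measurable F) :
    ∫⁻ z, F ((r z.1, r z.2), z) ∂(liftPast r μ ν Q) =
      ∫⁻ q, ∫⁻ w, ∫⁻ w', F (q, (w, w')) ∂(condDistrib id r ν q.2)
        ∂(condDistrib id r μ q.1) ∂Q := by
  have key : ∀ {ρ : Measure Ω} [IsProbabilityMeasure ρ], ∀ᵐ q ∂(ρ.map r),
      ∀ᵐ w ∂(condDistrib id r ρ q), r w = q := by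
    intro ρ _
    have h := condDistrib_id_ae_eq (μ := ρ) hr
    refine (ae_map_iff hr.aemeasurable ?_).2 h
    have hs : MeasurableSet {z : Ω × Ω | r z.2 ≠ z.1} :=
      (measurableSet_eq_fun (hr.comp measurable_snd) measurable_fst).compl
    exact measurableSet_eq_fun (f := fun q => condDistrib id r ρ q (Prod.mk q ⁻¹' {z | r z.2 ≠ z.1}))
      (Kernel.measurable_kernel_prodMk_left hs) measurable_const
  have h1 : ∀ᵐ q ∂Q, ∀ᵐ w ∂(condDistrib id r μ q.1), r w = q.1 :=
    ae_of_ae_map measurable_fst.aemeasurable (hQ1 ▸ key)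
  have h2 : ∀ᵐ q ∂Q, ∀ᵐ w ∂(condDistrib id r ν q.2), r w = q.2 :=
    ae_of_ae_map measurable_snd.aemeasurable (hQ2 ▸ key)
  rw [lintegral_liftPast (F := fun z => F ((r z.1, r z.2), z)) Q (by fun_prop)]
  refine lintegral_congr_ae ?_
  filter_upwards [h1, h2] with q hq1 hq2
  refine lintegral_congr_ae ?_
  filter_upwards [hq1] with w hw
  refine lintegral_congr_ae ?_
  filter_upwards [hq2] with w' hw'
  simp only [hw, hw']

theorem liftPast_fst (hr : Measurable r) {Q : Measure (Ω × Ω)}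
    (hQ1 : Q.map Prod.fst = μ.map r) : (liftPast r μ ν Q).map Prod.fst = μ := by
  refine measure_eq_of_lintegral_eq fun φ hφ => ?_
  rw [lintegral_map hφ measurable_fst, lintegral_liftPast Q (by fun_prop)]
  simp only [lintegral_const, measure_univ, mul_one]
  rw [← lintegral_map (f := fun q => ∫⁻ w, φ w ∂(condDistrib id r μ q)) hφ.lintegral_kernel
    measurable_fst, hQ1, lintegral_map hφ.lintegral_kernel hr]
  exact lintegral_condDistrib_id (φ := fun z => φ z.2) hr (by fun_prop)

theorem liftPast_snd (hr : Measurable r) {Q : Measure (Ω × Ω)}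
    (hQ2 : Q.map Prod.snd = ν.map r) : (liftPast r μ ν Q).map Prod.snd = ν := by
  have h := liftPast_fst (μ := ν) (ν := μ) hr (Q := Q.map Prod.swap)
    (by rw [Measure.map_map measurable_fst measurable_swap]; exact hQ2)
  rw [← liftPast_swap, Measure.map_map measurable_fst measurable_swap] at h
  exact h

theorem lintegral_liftPast_pair (hr : Measurable r) {Q : Measure (Ω × Ω)}
    (hQ1 : Q.map Prod.fst = μ.map r) (hQ2 : Q.map Prod.snd = ν.map r)
    {F : Ω × Ω → ℝ≥0∞} (hF : Measurable F) :
    ∫⁻ z, F (r z.1, r z.2) ∂(liftPast r μ ν Q) = ∫⁻ q, F q ∂Q := by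
  rw [lintegral_liftPast_past hr hQ1 hQ2 (F := fun z => F z.1) (by fun_prop)]
  simp

/-- If the futures are conditionally independent given the pasts, then the coupling is causal at the
time of the pasts. -/
theorem causalAt_liftPast (hr : Measurable r) {Q : Measure (Ω × Ω)}
    (hQ1 : Q.map Prod.fst = μ.map r) (hQ2 : Q.map Prod.snd = ν.map r) :
    CausalAt r μ (liftPast r μ ν Q) := by
  intro φ hφ
  rw [lintegral_liftPast_past hr hQ1 hQ2 (F := fun z => φ (z.1, z.2.1)) (by fun_prop),
    lintegral_liftPast_pair hr hQ1 hQ2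
      (F := fun q => ∫⁻ w, φ (q, w) ∂(condDistrib id r μ q.1))]
  · simp
  · exact Measurable.lintegral_kernel_prod_right'
      (κ := (condDistrib id r μ).comap Prod.fst measurable_fst) hφ

variable {E : Type*} [MeasurableSpace E]

/-- The tower property: the law of the path given the coarse past `a` is obtained by drawing `Z`
given `a`, and then the path given the finer past, which is determined by `a` and `Z`. -/
theorem condDistrib_tower (hr : Measurable r) (ha : Measurable a) (har : ∀ x, a (r x) = a x)
    {Z : Ω → E} (hZ : Measurable Z) {f : Ω × E → Ω} (hf : Measurable f)
    (hfr : ∀ x, f (a x, Z x) = r x) {T : Kernel Ω E} [IsMarkovKernel T]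
    (hT : μ.map (fun x => (a x, Z x)) = μ.map a ⊗ₘ T) :
    ∀ᵐ x ∂μ, ∀ φ : Ω → ℝ≥0∞, Measurable φ → ∫⁻ w, φ w ∂(condDistrib id a μ (a x)) =
      ∫⁻ z, ∫⁻ w, φ w ∂(condDistrib id r μ (f (a x, z))) ∂(T (a x)) := by
  -- the composed kernel is a version of the conditional law, by uniqueness of the latter
  let S : Kernel Ω Ω := (T ⊗ₖ ((condDistrib id r μ).comap f hf)).map Prod.snd
  have hSφ : ∀ α (ψ : Ω → ℝ≥0∞), Measurable ψ → ∫⁻ w, ψ w ∂(S α) =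
      ∫⁻ z, ∫⁻ w, ψ w ∂(condDistrib id r μ (f (α, z))) ∂(T α) := by
    intro α ψ hψ
    rw [Kernel.map_apply _ measurable_snd, lintegral_map hψ measurable_snd,
      Kernel.lintegral_compProd _ _ _ (by fun_prop)]
    rfl
  have hS : IsMarkovKernel S := Kernel.IsMarkovKernel.map _ measurable_snd
  have h : condDistrib id a μ =ᵐ[μ.map a] S := by
    refine condDistrib_ae_eq_of_measure_eq_compProd a aemeasurable_id ?_
    refine measure_eq_of_lintegral_eq fun ψ hψ => ?_
    rw [lintegral_map hψ (by fun_prop), Measure.lintegral_compProd hψ]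
    have hm : Measurable fun q : Ω × E =>
        ∫⁻ w, ψ (q.1, w) ∂(condDistrib id r μ (f q)) :=
      Measurable.lintegral_kernel_prod_right'
        (κ := (condDistrib id r μ).comap f hf) (f := fun q : (Ω × E) × Ω => ψ (q.1.1, q.2))
        (by fun_prop)
    have h1 := congrArg (fun ρ => ∫⁻ q, ∫⁻ w, ψ (q.1, w) ∂(condDistrib id r μ (f q)) ∂ρ) hT
    rw [lintegral_map hm (by fun_prop), Measure.lintegral_compProd hm] at h1
    calc ∫⁻ x, ψ (a x, id x) ∂μ
        = ∫⁻ x, (fun z : Ω × Ω => ψ (a z.1, z.2)) (r x, x) ∂μ := by simp [har]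
      _ = ∫⁻ x, ∫⁻ w, ψ (a x, w) ∂(condDistrib id r μ (r x)) ∂μ := by
          rw [← lintegral_condDistrib_id (φ := fun z => ψ (a z.1, z.2)) hr (by fun_prop)]
          simp only [har]
      _ = _ := by
          simp only [hfr] at h1
          rw [h1]
          refine lintegral_congr fun α => ?_
          rw [hSφ α _ (by fun_prop)]
  filter_upwards [ae_of_ae_map ha.aemeasurable h] with x hx ψ hψ
  rw [hx, hSφ _ _ hψ]

/-- A change of the coupling after time `a` does not affect the joint law of the whole first path
and the past of the second one. -/
theorem lintegral_liftPast_eq (hr : Measurable r) (ha : Measurable a) (har : ∀ x, a (r x) = a x)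
    {Z : Ω → E} (hZ : Measurable Z) {f : Ω × E → Ω} (hf : Measurable f)
    (hfr : ∀ x, f (a x, Z x) = r x) {T : Kernel Ω E} [IsMarkovKernel T]
    (hT : μ.map (fun x => (a x, Z x)) = μ.map a ⊗ₘ T)
    {Q η : Measure (Ω × Ω)} (hQ1 : Q.map Prod.fst = μ.map r) (hQ2 : Q.map Prod.snd = ν.map r)
    (hη1 : η.map Prod.fst = μ)
    (hQη : ∀ ψ : Ω × Ω → ℝ≥0∞, Measurable ψ → ∫⁻ q, ψ (q.1, a q.2) ∂Q =
      ∫⁻ z, ∫⁻ e, ψ (f (a z.1, e), a z.2) ∂(T (a z.1)) ∂η)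
    (hη : CausalAt a μ η) {ψ : Ω × Ω → ℝ≥0∞} (hψ : Measurable ψ) :
    ∫⁻ z, ψ (z.1, a z.2) ∂(liftPast r μ ν Q) = ∫⁻ z, ψ (z.1, a z.2) ∂η := by
  have h1 := lintegral_liftPast_past hr hQ1 hQ2 (μ := μ) (ν := ν)
    (F := fun z => ψ (z.2.1, a z.1.2)) (by fun_prop)
  simp only [har, lintegral_const, measure_univ, mul_one] at h1
  rw [h1]
  have hm : Measurable fun q : Ω × Ω => ∫⁻ w, ψ (w, q.2) ∂(condDistrib id r μ q.1) :=
    Measurable.lintegral_kernel_prod_right'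
      (κ := (condDistrib id r μ).comap Prod.fst measurable_fst)
      (f := fun q : (Ω × Ω) × Ω => ψ (q.2, q.1.2)) (by fun_prop)
  have h2 := hQη _ hm
  simp only at h2
  rw [h2, hη (fun z => ψ (z.2, z.1.2)) (by fun_prop)]
  refine lintegral_congr_ae ?_
  have h3 := condDistrib_tower (μ := μ) hr ha har hZ hf hfr hT
  have h4 : ∀ᵐ x ∂(η.map Prod.fst), _ := (congrArg ae hη1) ▸ h3
  filter_upwards [ae_of_ae_map measurable_fst.aemeasurable h4] with z hz
  rw [hz _ (by fun_prop)]

/-- Causality at time `s` involves only the joint law of the first path and the past of the second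
one up to `s`, hence only up to any later time `a`. -/
theorem CausalAt.of_lintegral_eq {a s : Ω → Ω} (hs : Measurable s) (hsa : ∀ x, s (a x) = s x)
    {η η' : Measure (Ω × Ω)} (h : ∀ ψ : Ω × Ω → ℝ≥0∞, Measurable ψ →
      ∫⁻ z, ψ (z.1, a z.2) ∂η' = ∫⁻ z, ψ (z.1, a z.2) ∂η) (hη : CausalAt s μ η) :
    CausalAt s μ η' := by
  intro φ hφ
  have h1 := h (fun z => φ ((s z.1, s z.2), z.1)) (by fun_prop)
  have hm : Measurable fun z : Ω × Ω =>
      ∫⁻ w, φ ((s z.1, s z.2), w) ∂(condDistrib id s μ (s z.1)) :=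
    Measurable.lintegral_kernel_prod_right'
      (κ := (condDistrib id s μ).comap (fun z : Ω × Ω => s z.1) (by fun_prop))
      (f := fun q : (Ω × Ω) × Ω => φ ((s q.1.1, s q.1.2), q.2)) (by fun_prop)
  have h2 := h _ hm
  simp only [hsa] at h1 h2
  rw [h1, h2]
  exact hη φ hφ

/-- One step of the construction of a bicausal coupling: the joint law of the pasts is refined from
time `a` to time `r` by means of a kernel `K` which couples the conditional laws of `Z` and `Z'`
given the past. -/
theorem exists_refined_coupling (hr : Measurable r) (ha : Measurable a)
    (har : ∀ x, a (r x) = a x)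
    {Z Z' : Ω → E} (hZ : Measurable Z) (hZ' : Measurable Z') (hZr : ∀ x, Z (r x) = Z x)
    (hZr' : ∀ x, Z' (r x) = Z' x) {f : Ω × E → Ω} (hf : Measurable f)
    (hfr : ∀ x, f (a x, Z x) = r x) (hfr' : ∀ x, f (a x, Z' x) = r x) [MeasurableEq (Ω × E)]
    {T T' : Kernel Ω E} [IsMarkovKernel T] [IsMarkovKernel T']
    (hT : μ.map (fun x => (a x, Z x)) = μ.map a ⊗ₘ T)
    (hT' : ν.map (fun x => (a x, Z' x)) = ν.map a ⊗ₘ T')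
    {η : Measure (Ω × Ω)} [IsProbabilityMeasure η] (hη1 : η.map Prod.fst = μ)
    (hη2 : η.map Prod.snd = ν) {K : Kernel (Ω × Ω) (E × E)} [IsMarkovKernel K]
    (hK1 : ∀ z, (K z).map Prod.fst = T (a z.1)) (hK2 : ∀ z, (K z).map Prod.snd = T' (a z.2)) :
    ∃ η' : Measure (Ω × Ω), IsProbabilityMeasure η' ∧ η'.map Prod.fst = μ ∧ η'.map Prod.snd = ν ∧
      CausalAt r μ η' ∧ CausalAt r ν (η'.map Prod.swap) ∧
      (CausalAt a μ η → ∀ s, Measurable s → (∀ x, s (a x) = s x) → CausalAt s μ η →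
        CausalAt s μ η') ∧
      (CausalAt a ν (η.map Prod.swap) → ∀ s, Measurable s → (∀ x, s (a x) = s x) →
        CausalAt s ν (η.map Prod.swap) → CausalAt s ν (η'.map Prod.swap)) ∧
      ∀ ψ : (Ω × E) × (Ω × E) → ℝ≥0∞, Measurable ψ →
        ∫⁻ z, ψ ((a z.1, Z z.1), (a z.2, Z' z.2)) ∂η' =
          ∫⁻ z, ∫⁻ e, ψ ((a z.1, e.1), (a z.2, e.2)) ∂(K z) ∂η := by
  let g : (Ω × Ω) × (E × E) → Ω × Ω := fun q => (f (a q.1.1, q.2.1), f (a q.1.2, q.2.2))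
  have hg : Measurable g := by fun_prop
  -- the joint law of the refined pasts
  let Q : Measure (Ω × Ω) := (η ⊗ₘ K).map g
  have hQ : IsProbabilityMeasure Q := Measure.isProbabilityMeasure_map hg.aemeasurable
  have hQψ : ∀ ψ : Ω × Ω → ℝ≥0∞, Measurable ψ → ∫⁻ q, ψ q ∂Q =
      ∫⁻ z, ∫⁻ e, ψ (f (a z.1, e.1), f (a z.2, e.2)) ∂(K z) ∂η := by
    intro ψ hψ
    rw [lintegral_map hψ hg, Measure.lintegral_compProd (by fun_prop)]
  -- the two marginals of `η ⊗ₘ K`, as laws of a past and a value of `Z`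
  have hm1 : (η ⊗ₘ K).map (fun q => (a q.1.1, q.2.1)) = μ.map (fun x => (a x, Z x)) := by
    refine measure_eq_of_lintegral_eq fun ψ hψ => ?_
    rw [lintegral_map hψ (by fun_prop), Measure.lintegral_compProd (by fun_prop), hT,
      Measure.lintegral_compProd hψ, lintegral_map hψ.lintegral_kernel_prod_right' ha, ← hη1,
      lintegral_map (f := fun x => ∫⁻ b, ψ (a x, b) ∂T (a x))
        (hψ.lintegral_kernel_prod_right'.comp ha) measurable_fst]
    refine lintegral_congr fun z => ?_
    rw [← hK1, lintegral_map (by fun_prop) measurable_fst]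
  have hm2 : (η ⊗ₘ K).map (fun q => (a q.1.2, q.2.2)) = ν.map (fun x => (a x, Z' x)) := by
    refine measure_eq_of_lintegral_eq fun ψ hψ => ?_
    rw [lintegral_map hψ (by fun_prop), Measure.lintegral_compProd (by fun_prop), hT',
      Measure.lintegral_compProd hψ, lintegral_map hψ.lintegral_kernel_prod_right' ha, ← hη2,
      lintegral_map (f := fun x => ∫⁻ b, ψ (a x, b) ∂T' (a x))
        (hψ.lintegral_kernel_prod_right'.comp ha) measurable_snd]
    refine lintegral_congr fun z => ?_
    rw [← hK2, lintegral_map (by fun_prop) measurable_snd]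
  have hQ1 : Q.map Prod.fst = μ.map r := by
    have h1 : Prod.fst ∘ g = f ∘ fun q => (a q.1.1, q.2.1) := rfl
    have h2 : r = f ∘ fun x => (a x, Z x) := funext fun x => (hfr x).symm
    rw [Measure.map_map measurable_fst hg, h1, ← Measure.map_map hf (by fun_prop), hm1,
      Measure.map_map hf (by fun_prop), ← h2]
  have hQ2 : Q.map Prod.snd = ν.map r := by
    have h1 : Prod.snd ∘ g = f ∘ fun q => (a q.1.2, q.2.2) := rfl
    have h2 : r = f ∘ fun x => (a x, Z' x) := funext fun x => (hfr' x).symm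
    rw [Measure.map_map measurable_snd hg, h1, ← Measure.map_map hf (by fun_prop), hm2,
      Measure.map_map hf (by fun_prop), ← h2]
  -- a past and a value of `Z` are determined by the refined past
  have ha1 : ∀ᵐ q ∂(η ⊗ₘ K), (a (f (a q.1.1, q.2.1)), Z (f (a q.1.1, q.2.1))) =
      (a q.1.1, q.2.1) := by
    have h : ∀ᵐ q ∂(μ.map (fun x => (a x, Z x))), (a (f q), Z (f q)) = q := by
      refine (ae_map_iff (by fun_prop) (measurableSet_eq_fun (by fun_prop) measurable_id)).2 ?_
      exact Eventually.of_forall fun x => by simp [hfr, har, hZr]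
    exact ae_of_ae_map (by fun_prop) (hm1 ▸ h)
  have ha2 : ∀ᵐ q ∂(η ⊗ₘ K), (a (f (a q.1.2, q.2.2)), Z' (f (a q.1.2, q.2.2))) =
      (a q.1.2, q.2.2) := by
    have h : ∀ᵐ q ∂(ν.map (fun x => (a x, Z' x))), (a (f q), Z' (f q)) = q := by
      refine (ae_map_iff (by fun_prop) (measurableSet_eq_fun (by fun_prop) measurable_id)).2 ?_
      exact Eventually.of_forall fun x => by simp [hfr', har, hZr']
    exact ae_of_ae_map (by fun_prop) (hm2 ▸ h)
  have hswap : IsProbabilityMeasure (η.map Prod.swap) :=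
    Measure.isProbabilityMeasure_map measurable_swap.aemeasurable
  have hQs1 : (Q.map Prod.swap).map Prod.fst = ν.map r := by
    rw [Measure.map_map measurable_fst measurable_swap]; exact hQ2
  have hQs2 : (Q.map Prod.swap).map Prod.snd = μ.map r := by
    rw [Measure.map_map measurable_snd measurable_swap]; exact hQ1
  refine ⟨liftPast r μ ν Q, inferInstance, liftPast_fst hr hQ1, liftPast_snd hr hQ2,
    causalAt_liftPast hr hQ1 hQ2, ?_, ?_, ?_, ?_⟩
  · rw [liftPast_swap]
    exact causalAt_liftPast hr hQs1 hQs2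
  · intro hη s hs hsa hsη
    refine CausalAt.of_lintegral_eq hs hsa (fun ψ hψ => ?_) hsη
    refine lintegral_liftPast_eq hr ha har hZ hf hfr hT hQ1 hQ2 hη1 (fun ψ hψ => ?_) hη hψ
    rw [hQψ _ (by fun_prop), ← Measure.lintegral_compProd (κ := K) (μ := η)
      (f := fun q => ψ (f (a q.1.1, q.2.1), a (f (a q.1.2, q.2.2)))) (by fun_prop)]
    have : ∫⁻ q, ψ (f (a q.1.1, q.2.1), a (f (a q.1.2, q.2.2))) ∂(η ⊗ₘ K) =
        ∫⁻ q, ψ (f (a q.1.1, q.2.1), a q.1.2) ∂(η ⊗ₘ K) := by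
      refine lintegral_congr_ae ?_
      filter_upwards [ha2] with q hq
      rw [(Prod.mk.inj hq).1]
    rw [this, Measure.lintegral_compProd (by fun_prop)]
    refine lintegral_congr fun z => ?_
    rw [← hK1, lintegral_map (by fun_prop) measurable_fst]
  · intro hη s hs hsa hsη
    rw [liftPast_swap]
    have hη1' : (η.map Prod.swap).map Prod.fst = ν := by
      rw [Measure.map_map measurable_fst measurable_swap]; exact hη2
    refine CausalAt.of_lintegral_eq hs hsa (fun ψ hψ => ?_) hsη
    refine lintegral_liftPast_eq hr ha har hZ' hf hfr' hT' hQs1 hQs2 hη1' (fun ψ hψ => ?_) hη hψ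
    have hm : Measurable fun z : Ω × Ω => ∫⁻ e, ψ (f (a z.1, e), a z.2) ∂(T' (a z.1)) :=
      Measurable.lintegral_kernel_prod_right'
        (κ := T'.comap (fun z : Ω × Ω => a z.1) (by fun_prop))
        (f := fun q : (Ω × Ω) × E => ψ (f (a q.1.1, q.2), a q.1.2)) (by fun_prop)
    rw [lintegral_map (by fun_prop) measurable_swap, lintegral_map hm measurable_swap,
      hQψ _ (by fun_prop)]
    simp only [Prod.fst_swap, Prod.snd_swap]
    rw [← Measure.lintegral_compProd (κ := K) (μ := η)
      (f := fun q => ψ (f (a q.1.2, q.2.2), a (f (a q.1.1, q.2.1)))) (by fun_prop)]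
    have : ∫⁻ q, ψ (f (a q.1.2, q.2.2), a (f (a q.1.1, q.2.1))) ∂(η ⊗ₘ K) =
        ∫⁻ q, ψ (f (a q.1.2, q.2.2), a q.1.1) ∂(η ⊗ₘ K) := by
      refine lintegral_congr_ae ?_
      filter_upwards [ha1] with q hq
      rw [(Prod.mk.inj hq).1]
    rw [this, Measure.lintegral_compProd (by fun_prop)]
    refine lintegral_congr fun z => ?_
    rw [← hK2, lintegral_map (by fun_prop) measurable_snd]
  · intro ψ hψ
    have h1 := lintegral_liftPast_pair hr hQ1 hQ2 (μ := μ) (ν := ν)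
      (F := fun q => ψ ((a q.1, Z q.1), (a q.2, Z' q.2))) (by fun_prop)
    simp only [har, hZr, hZr'] at h1
    rw [h1, hQψ _ (by fun_prop), ← Measure.lintegral_compProd (κ := K) (μ := η)
      (f := fun q => ψ ((a (f (a q.1.1, q.2.1)), Z (f (a q.1.1, q.2.1))),
        (a (f (a q.1.2, q.2.2)), Z' (f (a q.1.2, q.2.2))))) (by fun_prop),
      ← Measure.lintegral_compProd (κ := K) (μ := η)
      (f := fun q => ψ ((a q.1.1, q.2.1), (a q.1.2, q.2.2))) (by fun_prop)]
    refine lintegral_congr_ae ?_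
    filter_upwards [ha1, ha2] with q hq1 hq2
    rw [hq1, hq2]

end Causal

/-! ### Truncated paths and conditional laws -/

/-- The path `x` up to time `t` (exclusive), continued by zeros: an idempotent map which generates
the `σ`-algebra of the past. -/
def trunc {N : ℕ} (t : ℕ) (x : Fin N → ℝ) : Fin N → ℝ := fun j => if (j : ℕ) < t then x j else 0

section Trunc

variable {N : ℕ}

theorem trunc_trunc (s t : ℕ) (x : Fin N → ℝ) : trunc s (trunc t x) = trunc (min s t) x := by
  ext j
  by_cases h1 : (j : ℕ) < s <;> by_cases h2 : (j : ℕ) < t <;> simp [trunc, h1, h2]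

theorem trunc_trunc_of_le {s t : ℕ} (h : s ≤ t) (x : Fin N → ℝ) :
    trunc s (trunc t x) = trunc s x := by
  rw [trunc_trunc, min_eq_left h]

theorem trunc_apply_of_lt {t : ℕ} {j : Fin N} (h : (j : ℕ) < t) (x : Fin N → ℝ) :
    trunc t x j = x j := if_pos h

theorem trunc_zero (x : Fin N → ℝ) : trunc 0 x = 0 := funext fun _ => if_neg (Nat.not_lt_zero _)

@[fun_prop]
theorem measurable_trunc (t : ℕ) : Measurable (trunc t : (Fin N → ℝ) → Fin N → ℝ) := by
  refine measurable_pi_lambda _ fun j => ?_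
  by_cases h : (j : ℕ) < t
  · simpa [trunc, h] using measurable_pi_apply j
  · simp [trunc, h]

theorem update_trunc {t : Fin N} (x : Fin N → ℝ) :
    Function.update (trunc t x) t (x t) = trunc (t + 1) x := by
  ext j
  rcases eq_or_ne j t with rfl | h
  · simp [trunc]
  · have h' : (j : ℕ) ≠ t := fun e => h (Fin.ext e)
    have : (j : ℕ) < t ↔ (j : ℕ) < t + 1 := by omega
    simp [trunc, h, this]

/-- Times are counted from `0`, so the past up to and including time `i` is recorded by
`trunc (i + 1)`. -/
theorem coordFiltration_eq {n : ℕ} (i : Fin (n + 1)) :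
    coordFiltration n i = MeasurableSpace.comap (trunc (i + 1)) MeasurableSpace.pi := by
  refine le_antisymm ?_ ?_
  · rintro _ ⟨s, hs, rfl⟩
    refine ⟨Preorder.restrictLe i ⁻¹' s, Preorder.measurable_restrictLe i hs, ?_⟩
    have : (Preorder.restrictLe i : (Fin (n + 1) → ℝ) → _) ∘ trunc (i + 1) =
        Preorder.restrictLe i := by
      ext x j
      exact trunc_apply_of_lt (Nat.lt_succ_of_le j.2) x
    rw [← preimage_comp, this]
  · refine measurable_iff_comap_le.1 ?_
    refine (@measurable_pi_iff _ _ _ (coordFiltration n i) _ _).2 fun j => ?_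
    by_cases h : (j : ℕ) < i + 1
    · have hj : j ∈ Iic i := Fin.le_def.2 (Nat.lt_succ_iff.1 h)
      have : (fun x : Fin (n + 1) → ℝ => trunc (i + 1) x j) =
          (fun y : Iic i → ℝ => y ⟨j, hj⟩) ∘ Preorder.restrictLe i := by
        ext x
        exact trunc_apply_of_lt h x
      rw [this]
      exact (measurable_pi_apply _).comp (comap_measurable _)
    · simp only [trunc, h, if_false]
      exact measurable_const

end Trunc

/-- For an idempotent map `r`, the functions measurable for the `σ`-algebra generated by `r` are
the measurable functions which factor through `r`. -/
theorem measurable_comap_iff_of_idempotent {Ω E : Type*} [mΩ : MeasurableSpace Ω]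
    [MeasurableSpace E] [MeasurableSingletonClass E] {r : Ω → Ω} (hr : Measurable r)
    (hrr : ∀ x, r (r x) = r x) {T : Ω → E} :
    Measurable[mΩ.comap r] T ↔ Measurable T ∧ ∀ x, T (r x) = T x := by
  refine ⟨fun h => ⟨h.mono hr.comap_le le_rfl, fun x => h.factorsThrough (hrr x)⟩, fun h => ?_⟩
  have : T = T ∘ r := funext fun x => (h.2 x).symm
  rw [this]
  exact h.1.comp (comap_measurable r)

/-- The defining property of a conditional law, in terms of joint laws and on rectangles. -/
theorem map_prodMk_eq_compProd_iff {Ω C E : Type*} [MeasurableSpace Ω] [MeasurableSpace C]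
    [MeasurableSpace E] {μ : Measure Ω} [IsFiniteMeasure μ] {r : Ω → C} {Z : Ω → E}
    (hr : Measurable r) (hZ : Measurable Z) (κ : Kernel C E) [IsFiniteKernel κ] :
    μ.map (fun x => (r x, Z x)) = μ.map r ⊗ₘ κ ↔ ∀ A, MeasurableSet A → ∀ B, MeasurableSet B →
      μ (r ⁻¹' A ∩ Z ⁻¹' B) = ∫⁻ x in r ⁻¹' A, κ (r x) B ∂μ := by
  have key : ∀ A, MeasurableSet A → ∀ B, MeasurableSet B →
      (μ.map (fun x => (r x, Z x))) (A ×ˢ B) = μ (r ⁻¹' A ∩ Z ⁻¹' B) ∧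
      (μ.map r ⊗ₘ κ) (A ×ˢ B) = ∫⁻ x in r ⁻¹' A, κ (r x) B ∂μ := by
    intro A hA B hB
    refine ⟨by rw [Measure.map_apply (by fun_prop) (hA.prod hB)]; rfl, ?_⟩
    rw [Measure.compProd_apply_prod hA hB, Measure.restrict_map hr hA,
      lintegral_map (κ.measurable_coe hB) hr]
  refine ⟨fun h A hA B hB => ?_, fun h => Measure.ext_prod fun {A B} hA hB => ?_⟩
  · rw [← (key A hA B hB).1, ← (key A hA B hB).2, h]
  · rw [(key A hA B hB).1, (key A hA B hB).2, h A hA B hB]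

section CondLaw

variable {p : ℝ} [hp : Fact (1 ≤ p)] {X : DistSpace} [MetricSpace X.carrier]
  [CompleteSpace X.carrier] [SecondCountableTopology X.carrier] [BorelSpace X.carrier]
  [LawfulDist X]

/-- A measurable map into `𝒫^p(X)`, as a Markov kernel. -/
def Pp.kernel {Ω : Type*} [MeasurableSpace Ω] (T : Ω → Pp p X) (hT : Measurable T) :
    Kernel Ω X.carrier := ⟨fun ω => (T ω).1, Pp.measurable_iff.1 hT⟩

instance Pp.isMarkovKernel_kernel {Ω : Type*} [MeasurableSpace Ω] {T : Ω → Pp p X}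
    {hT : Measurable T} : IsMarkovKernel (Pp.kernel T hT) := ⟨fun ω => (T ω).1.2⟩

theorem Pp.kernel_apply {Ω : Type*} [MeasurableSpace Ω] (T : Ω → Pp p X) (hT : Measurable T)
    (ω : Ω) : Pp.kernel T hT ω = (T ω).1 := rfl

theorem isCondLaw_iff {n : ℕ} {μ : ProbabilityMeasure (Fin (n + 1) → ℝ)} {i : Fin (n + 1)}
    {Z : (Fin (n + 1) → ℝ) → X.carrier} (hZ : Measurable Z) {T : (Fin (n + 1) → ℝ) → Pp p X} :
    IsCondLaw p X n μ i Z T ↔ ∃ hT : Measurable T, (∀ x, T (trunc (i + 1) x) = T x) ∧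
      (μ : Measure _).map (fun x => (trunc (i + 1) x, Z x)) =
        (μ : Measure _).map (trunc (i + 1)) ⊗ₘ Pp.kernel T hT := by
  have hr : Measurable (trunc (i + 1) : (Fin (n + 1) → ℝ) → Fin (n + 1) → ℝ) := by fun_prop
  rw [IsCondLaw, coordFiltration_eq, measurable_comap_iff_of_idempotent hr
    (trunc_trunc_of_le le_rfl), and_assoc, ← exists_prop]
  refine exists_congr fun hT => and_congr_right fun hTr => ?_
  rw [map_prodMk_eq_compProd_iff hr hZ]
  simp only [Pp.kernel_apply, hTr]
  refine ⟨fun h A hA B hB => h _ ⟨A, hA, rfl⟩ B hB, ?_⟩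
  rintro h _ ⟨A, hA, rfl⟩ B hB
  exact h A hA B hB

variable {Ω C : Type*} [MeasurableSpace Ω] [MeasurableSpace C] {μ : Measure Ω}
  [IsProbabilityMeasure μ]

theorem lintegral_of_map_eq_compProd {E : Type*} [MeasurableSpace E] {r : Ω → C} {Z : Ω → E}
    (hr : Measurable r) (hZ : Measurable Z) {κ : Kernel C E} [IsMarkovKernel κ]
    (h : μ.map (fun x => (r x, Z x)) = μ.map r ⊗ₘ κ) {φ : C × E → ℝ≥0∞} (hφ : Measurable φ) :
    ∫⁻ x, φ (r x, Z x) ∂μ = ∫⁻ x, ∫⁻ z, φ (r x, z) ∂(κ (r x)) ∂μ := by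
  rw [← lintegral_map (g := fun x => (r x, Z x)) hφ (by fun_prop), h,
    Measure.lintegral_compProd hφ, lintegral_map hφ.lintegral_kernel_prod_right' hr]

/-- Conditional laws of a random variable with finite `p`-th moment exist as measurable maps into
`𝒫^p(X)`; the regular conditional law is changed on the null set where its moment is infinite. -/
theorem exists_condLaw {r : Ω → C} {Z : Ω → X.carrier} (hr : Measurable r) (hZ : Measurable Z)
    {z₀ : X.carrier} (hm : ∫⁻ x, edist (Z x) z₀ ^ p ∂μ < ∞) :
    ∃ (T : C → Pp p X) (hT : Measurable T),
      μ.map (fun x => (r x, Z x)) = μ.map r ⊗ₘ Pp.kernel T hT := by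
  classical
  have : Nonempty X.carrier := ⟨z₀⟩
  let κ := condDistrib Z r μ
  have hκ : μ.map (fun x => (r x, Z x)) = μ.map r ⊗ₘ κ := (compProd_map_condDistrib hZ.aemeasurable).symm
  have hmφ : Measurable fun q : C × X.carrier => edist q.2 z₀ ^ p := by fun_prop
  have hmf : Measurable fun c => ∫⁻ z, edist z z₀ ^ p ∂(κ c) :=
    Measurable.lintegral_kernel_prod_right' (κ := κ) hmφ
  let G : Set C := {c | ∫⁻ z, edist z z₀ ^ p ∂(κ c) < ∞}
  have hG : MeasurableSet G := measurableSet_lt hmf measurable_const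
  have hGae : ∀ᵐ c ∂(μ.map r), c ∈ G := by
    refine ae_lt_top hmf ?_
    rw [← Measure.lintegral_compProd (κ := κ) hmφ, ← hκ, lintegral_map hmφ (by fun_prop)]
    exact hm.ne
  let T : C → Pp p X := fun c => if h : c ∈ G then
    ⟨⟨κ c, inferInstance⟩, z₀, by
      simp only [LawfulDist.edist_eq]
      exact h⟩ else Pp.dirac p z₀
  have hTG : ∀ c ∈ G, ((T c).1 : Measure X.carrier) = κ c := by
    intro c hc
    have : T c = _ := dif_pos hc
    rw [this]
    rfl
  have hT : Measurable T := by
    refine Pp.measurable_iff.2 ?_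
    have : (fun c => ((T c).1 : Measure X.carrier)) =
        G.piecewise (fun c => κ c) fun _ => (Pp.dirac p z₀ : Pp p X).1 := by
      ext1 c
      by_cases hc : c ∈ G
      · rw [piecewise_eq_of_mem _ _ _ hc, hTG c hc]
      · rw [piecewise_eq_of_notMem _ _ _ hc]
        have : T c = _ := dif_neg hc
        rw [this]
    rw [this]
    exact κ.measurable.piecewise hG measurable_const
  refine ⟨T, hT, hκ.trans (Measure.compProd_congr ?_)⟩
  filter_upwards [hGae] with c hc
  exact (hTG c hc).symm

/-- The expected distance of the conditional laws of `U` and `V`, given the same information, is at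
most the expected distance of `U` and `V`: the conditional joint law is a coupling. -/
theorem lintegral_edist_condLaw_le {c : Ω → C} (hc : Measurable c) {U V : Ω → X.carrier}
    (hU : Measurable U) (hV : Measurable V) {T T' : C → Pp p X} (hT : Measurable T)
    (hT' : Measurable T') (hTU : μ.map (fun x => (c x, U x)) = μ.map c ⊗ₘ Pp.kernel T hT)
    (hTV : μ.map (fun x => (c x, V x)) = μ.map c ⊗ₘ Pp.kernel T' hT') :
    ∫⁻ x, edist (T (c x)) (T' (c x)) ^ p ∂μ ≤ ∫⁻ x, edist (U x) (V x) ^ p ∂μ := by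
  obtain ⟨ω₀⟩ : Nonempty Ω := nonempty_of_isProbabilityMeasure μ
  have : Nonempty X.carrier := ⟨U ω₀⟩
  let κ := condDistrib (fun x => (U x, V x)) c μ
  have h1 : κ.map Prod.fst =ᵐ[μ.map c] Pp.kernel T hT :=
    (condDistrib_comp c (hU.prodMk hV).aemeasurable measurable_fst).symm.trans
      (condDistrib_ae_eq_of_measure_eq_compProd c hU.aemeasurable hTU)
  have h2 : κ.map Prod.snd =ᵐ[μ.map c] Pp.kernel T' hT' :=
    (condDistrib_comp c (hU.prodMk hV).aemeasurable measurable_snd).symm.trans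
      (condDistrib_ae_eq_of_measure_eq_compProd c hV.aemeasurable hTV)
  have hκ : μ.map (fun x => (c x, (U x, V x))) = μ.map c ⊗ₘ κ :=
    (compProd_map_condDistrib (hU.prodMk hV).aemeasurable).symm
  have h := lintegral_of_map_eq_compProd hc (hU.prodMk hV) hκ
    (φ := fun q => edist q.2.1 q.2.2 ^ p) (by fun_prop)
  rw [h]
  refine lintegral_mono_ae ?_
  filter_upwards [ae_of_ae_map hc.aemeasurable h1, ae_of_ae_map hc.aemeasurable h2] with x hx1 hx2
  have hle := wasserstein_rpow_le (X := X) (p := p) exponent_pos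
    (γ := (⟨κ (c x), inferInstance⟩ : ProbabilityMeasure _)) (P := (T (c x)).1) (Q := (T' (c x)).1)
    ⟨by rw [← Pp.kernel_apply T hT, ← hx1, Kernel.map_apply _ measurable_fst]; rfl,
      by rw [← Pp.kernel_apply T' hT', ← hx2, Kernel.map_apply _ measurable_snd]; rfl⟩
  simp only [LawfulDist.edist_eq] at hle
  exact hle

/-- Under a coupling which is causal at the time recorded by `r`, a conditional law of `Z` given its
own past is also a conditional law given the past of both components. -/
theorem CausalAt.map_eq_compProd {Ω : Type*} [MeasurableSpace Ω] [StandardBorelSpace Ω]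
    [Nonempty Ω] {μ : Measure Ω} [IsProbabilityMeasure μ] {r : Ω → Ω} (hr : Measurable r)
    {η : Measure (Ω × Ω)} [IsProbabilityMeasure η] (hη1 : η.map Prod.fst = μ)
    (hη : CausalAt r μ η) {E : Type*} [MeasurableSpace E] [StandardBorelSpace E] [Nonempty E]
    {Z : Ω → E} (hZ : Measurable Z) {κ : Kernel Ω E} [IsMarkovKernel κ]
    (hκ : μ.map (fun x => (r x, Z x)) = μ.map r ⊗ₘ κ) :
    η.map (fun z => ((r z.1, r z.2), Z z.1)) =
      η.map (fun z => (r z.1, r z.2)) ⊗ₘ κ.comap Prod.fst measurable_fst := by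
  refine measure_eq_of_lintegral_eq fun φ hφ => ?_
  have h1 : (condDistrib id r μ).map Z =ᵐ[μ.map r] κ :=
    (condDistrib_comp r aemeasurable_id hZ).symm.trans
      (condDistrib_ae_eq_of_measure_eq_compProd r hZ.aemeasurable hκ)
  rw [lintegral_map hφ (by fun_prop), Measure.lintegral_compProd hφ,
    lintegral_map hφ.lintegral_kernel_prod_right' (by fun_prop),
    hη (fun q => φ (q.1, Z q.2)) (by fun_prop)]
  refine lintegral_congr_ae ?_
  have hmap : μ.map r = η.map (r ∘ Prod.fst) := by rw [← hη1, Measure.map_map hr measurable_fst]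
  rw [hmap] at h1
  filter_upwards [ae_of_ae_map (by fun_prop) h1] with z hz
  rw [Kernel.comap_apply, show κ (r z.1, r z.2).1 = κ ((r ∘ Prod.fst) z) from rfl, ← hz,
    Kernel.map_apply _ hZ, lintegral_map (by fun_prop) hZ]
  rfl

end CondLaw

/-! ### The two formulations of causality -/

section CausalIff

variable {Ω : Type*} [MeasurableSpace Ω] [StandardBorelSpace Ω] [Nonempty Ω]
  {μ : Measure Ω} [IsProbabilityMeasure μ] {r : Ω → Ω} {γ : Measure (Ω × Ω)}
  [IsProbabilityMeasure γ]

theorem lintegral_eq_condKernel (hγ : γ.map Prod.fst = μ) {F : Ω × Ω → ℝ≥0∞} (hF : Measurable F) :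
    ∫⁻ z, F z ∂γ = ∫⁻ x, ∫⁻ y, F (x, y) ∂(γ.condKernel x) ∂μ := by
  have h : γ.fst ⊗ₘ γ.condKernel = γ := γ.disintegrate γ.condKernel
  calc ∫⁻ z, F z ∂γ = ∫⁻ z, F z ∂(γ.fst ⊗ₘ γ.condKernel) := by rw [h]
    _ = _ := by rw [Measure.lintegral_compProd hF, Measure.fst, hγ]

theorem lintegral_mul_indicator_one {B : Set Ω} (hB : MeasurableSet B) (c : ℝ≥0∞)
    (ν : Measure Ω) : ∫⁻ y, c * B.indicator 1 y ∂ν = c * ν B := by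
  rw [lintegral_const_mul _ (measurable_one.indicator hB), lintegral_indicator_one hB]

theorem lintegral_mul_indicator_condKernel (hγ : γ.map Prod.fst = μ) (hr : Measurable r)
    {B : Set Ω} (hB : MeasurableSet B) {a : Ω → ℝ≥0∞} (ha : Measurable a) :
    ∫⁻ z, a z.1 * B.indicator 1 (r z.2) ∂γ = ∫⁻ x, a x * γ.condKernel x (r ⁻¹' B) ∂μ := by
  have h1 : Measurable (B.indicator (1 : Ω → ℝ≥0∞)) := measurable_one.indicator hB
  rw [lintegral_eq_condKernel hγ (by fun_prop)]
  exact lintegral_congr fun x => lintegral_mul_indicator_one (hr hB) (a x) (γ.condKernel x)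

/-- Causality in terms of the regular conditional law: the conditional probability of an event of
the past of the second component, given the first component, depends only on the past of the
latter. -/
theorem causalAt_iff (hr : Measurable r) (hrr : ∀ x, r (r x) = r x) (hγ : γ.map Prod.fst = μ) :
    CausalAt r μ γ ↔ ∀ B, MeasurableSet B → ∃ g : Ω → ℝ≥0∞, Measurable g ∧ (∀ x, g (r x) = g x) ∧
      (fun x => γ.condKernel x (r ⁻¹' B)) =ᵐ[μ] g := by
  have hκm : ∀ {B}, MeasurableSet B → Measurable fun x => γ.condKernel x (r ⁻¹' B) :=
    fun hB => Kernel.measurable_coe _ (hr hB)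
  have hDm : ∀ {C}, MeasurableSet C → Measurable fun x => condDistrib id r μ x C :=
    fun hC => Kernel.measurable_coe _ hC
  have h1m : ∀ {C}, MeasurableSet C → Measurable (C.indicator (1 : Ω → ℝ≥0∞)) :=
    fun hC => measurable_one.indicator hC
  constructor
  · intro h B hB
    let G : Ω → ℝ≥0∞ := fun c => ∫⁻ w, γ.condKernel w (r ⁻¹' B) ∂(condDistrib id r μ c)
    have hG : Measurable G := (hκm hB).lintegral_kernel
    refine ⟨fun x => G (r x), hG.comp hr, fun x => by simp only [hrr], ?_⟩
    refine ae_eq_of_forall_setLIntegral_eq_of_sigmaFinite (hκm hB) (hG.comp hr)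
      fun C hC _ => ?_
    have hB1 := h1m hB
    have hC1 := h1m hC
    have hD := hDm hC
    have hK := hκm hB
    calc ∫⁻ x in C, γ.condKernel x (r ⁻¹' B) ∂μ
        = ∫⁻ x, C.indicator 1 x * γ.condKernel x (r ⁻¹' B) ∂μ := by
          rw [← lintegral_indicator hC]
          refine lintegral_congr fun x => ?_
          by_cases hx : x ∈ C <;> simp [hx]
      _ = ∫⁻ z, C.indicator 1 z.1 * B.indicator 1 (r z.2) ∂γ :=
          (lintegral_mul_indicator_condKernel hγ hr hB hC1).symm
      _ = ∫⁻ z, ∫⁻ w, C.indicator 1 w * B.indicator 1 (r z.2)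
            ∂(condDistrib id r μ (r z.1)) ∂γ :=
          h (fun q => C.indicator 1 q.2 * B.indicator 1 q.1.2) (by fun_prop)
      _ = ∫⁻ z, condDistrib id r μ (r z.1) C * B.indicator 1 (r z.2) ∂γ := by
          refine lintegral_congr fun z => ?_
          rw [lintegral_mul_const _ hC1, lintegral_indicator_one hC]
      _ = ∫⁻ x, condDistrib id r μ (r x) C * γ.condKernel x (r ⁻¹' B) ∂μ :=
          lintegral_mul_indicator_condKernel hγ hr hB (a := fun x => condDistrib id r μ (r x) C)
            (by fun_prop)
      _ = ∫⁻ x, ∫⁻ w, condDistrib id r μ (r x) C * γ.condKernel w (r ⁻¹' B)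
            ∂(condDistrib id r μ (r x)) ∂μ :=
          (lintegral_condDistrib_id hr
            (φ := fun q => condDistrib id r μ q.1 C * γ.condKernel q.2 (r ⁻¹' B))
            (by fun_prop)).symm
      _ = ∫⁻ x, ∫⁻ w, C.indicator 1 w * G (r x) ∂(condDistrib id r μ (r x)) ∂μ := by
          refine lintegral_congr fun x => ?_
          rw [lintegral_const_mul _ hK, lintegral_mul_const _ hC1, lintegral_indicator_one hC]
      _ = ∫⁻ x, C.indicator 1 x * G (r x) ∂μ :=
          lintegral_condDistrib_id hr (φ := fun q => C.indicator 1 q.2 * G q.1) (by fun_prop)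
      _ = ∫⁻ x in C, G (r x) ∂μ := by
          rw [← lintegral_indicator hC]
          refine lintegral_congr fun x => ?_
          by_cases hx : x ∈ C <;> simp [hx]
  · intro h
    have hm : γ.map (fun z => ((r z.1, r z.2), z.1)) =
        γ.map (fun z => (r z.1, r z.2)) ⊗ₘ (condDistrib id r μ).comap Prod.fst measurable_fst := by
      refine Measure.ext_prod₃' fun {A B C} hA hB hC => ?_
      obtain ⟨g, hg, hgr, hgκ⟩ := h B hB
      have hA1 := h1m hA
      have hB1 := h1m hB
      have hC1 := h1m hC
      have hD := hDm hC
      have hs := (hA.prod hB).prod hC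
      have hs1 : ∀ q : (Ω × Ω) × Ω, ((A ×ˢ B) ×ˢ C).indicator (1 : (Ω × Ω) × Ω → ℝ≥0∞) q =
          A.indicator 1 q.1.1 * C.indicator 1 q.2 * B.indicator 1 q.1.2 := by
        intro q
        by_cases h1 : q.1.1 ∈ A <;> by_cases h2 : q.1.2 ∈ B <;> by_cases h3 : q.2 ∈ C <;>
          simp [indicator, h1, h2, h3]
      have hsm : Measurable fun q : (Ω × Ω) × Ω =>
          A.indicator (1 : Ω → ℝ≥0∞) q.1.1 * C.indicator 1 q.2 * B.indicator 1 q.1.2 := by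
        fun_prop
      rw [← lintegral_indicator_one hs, ← lintegral_indicator_one hs]
      simp only [hs1]
      rw [lintegral_map hsm (by fun_prop), Measure.lintegral_compProd hsm,
        lintegral_map hsm.lintegral_kernel_prod_right' (by fun_prop)]
      calc ∫⁻ z, A.indicator 1 (r z.1) * C.indicator 1 z.1 * B.indicator 1 (r z.2) ∂γ
          = ∫⁻ x, A.indicator 1 (r x) * C.indicator 1 x * γ.condKernel x (r ⁻¹' B) ∂μ :=
            lintegral_mul_indicator_condKernel hγ hr hB
              (a := fun x => A.indicator 1 (r x) * C.indicator 1 x) (by fun_prop)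
        _ = ∫⁻ x, A.indicator 1 (r x) * g (r x) * C.indicator 1 x ∂μ := by
            refine lintegral_congr_ae ?_
            filter_upwards [hgκ] with x hx
            rw [hx, hgr, mul_right_comm]
        _ = ∫⁻ x, ∫⁻ w, A.indicator 1 (r x) * g (r x) * C.indicator 1 w
              ∂(condDistrib id r μ (r x)) ∂μ :=
            (lintegral_condDistrib_id hr
              (φ := fun q => A.indicator 1 q.1 * g q.1 * C.indicator 1 q.2) (by fun_prop)).symm
        _ = ∫⁻ x, A.indicator 1 (r x) * condDistrib id r μ (r x) C *
              γ.condKernel x (r ⁻¹' B) ∂μ := by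
            refine lintegral_congr_ae ?_
            filter_upwards [hgκ] with x hx
            rw [lintegral_mul_indicator_one hC, hx, hgr, mul_right_comm]
        _ = ∫⁻ z, A.indicator 1 (r z.1) * condDistrib id r μ (r z.1) C *
              B.indicator 1 (r z.2) ∂γ :=
            (lintegral_mul_indicator_condKernel hγ hr hB
              (a := fun x => A.indicator 1 (r x) * condDistrib id r μ (r x) C) (by fun_prop)).symm
        _ = ∫⁻ z, ∫⁻ w, A.indicator 1 (r z.1) * C.indicator 1 w * B.indicator 1 (r z.2)
              ∂(condDistrib id r μ (r z.1)) ∂γ := by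
            refine lintegral_congr fun z => ?_
            rw [lintegral_mul_const _ (by fun_prop), lintegral_mul_indicator_one hC]
    intro φ hφ
    rw [← lintegral_map (g := fun z : Ω × Ω => ((r z.1, r z.2), z.1)) hφ (by fun_prop), hm,
      Measure.lintegral_compProd hφ, lintegral_map hφ.lintegral_kernel_prod_right' (by fun_prop)]
    rfl

end CausalIff

/-- Causality of `γ` as a statement about truncated paths. -/
theorem isCausal_iff {n : ℕ} {γ : ProbabilityMeasure ((Fin (n + 1) → ℝ) × (Fin (n + 1) → ℝ))}
    {μ : Measure (Fin (n + 1) → ℝ)} [IsProbabilityMeasure μ]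
    (hγ : (γ : Measure ((Fin (n + 1) → ℝ) × (Fin (n + 1) → ℝ))).map Prod.fst = μ) :
    IsCausal n γ ↔ ∀ i : Fin (n + 1), CausalAt (trunc (i + 1)) μ γ := by
  refine forall_congr' fun i => ?_
  have hr : Measurable (trunc (i + 1) : (Fin (n + 1) → ℝ) → Fin (n + 1) → ℝ) := by fun_prop
  have hrr : ∀ x : Fin (n + 1) → ℝ, trunc (i + 1) (trunc (i + 1) x) = trunc (i + 1) x :=
    trunc_trunc_of_le le_rfl
  rw [causalAt_iff hr hrr hγ, coordFiltration_eq]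
  simp only [measurable_comap_iff_of_idempotent hr hrr, and_assoc]
  rw [Measure.fst, hγ]
  refine ⟨fun h B hB => h _ ⟨B, hB, rfl⟩, ?_⟩
  rintro h _ ⟨B, hB, rfl⟩
  exact h B hB

/-! ### The nested variables and their expected distance under bicausal couplings -/

/-- `m` is a complete metric on the real line which induces the usual topology. -/
def IsCompleteUsual (m : MetricSpace ℝ) : Prop :=
  m.toPseudoMetricSpace.toUniformSpace.toTopologicalSpace = usualTopology ∧
    @CompleteSpace ℝ m.toPseudoMetricSpace.toUniformSpace

/-- The counterpart of `CausalAt.map_eq_compProd` for the second component. -/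
theorem CausalAt.map_eq_compProd_snd {Ω : Type*} [MeasurableSpace Ω] [StandardBorelSpace Ω]
    [Nonempty Ω] {ν : Measure Ω} [IsProbabilityMeasure ν] {r : Ω → Ω} (hr : Measurable r)
    {η : Measure (Ω × Ω)} [IsProbabilityMeasure η] (hη2 : η.map Prod.snd = ν)
    (hη : CausalAt r ν (η.map Prod.swap)) {E : Type*} [MeasurableSpace E] [StandardBorelSpace E]
    [Nonempty E] {Z : Ω → E} (hZ : Measurable Z) {κ : Kernel Ω E} [IsMarkovKernel κ]
    (hκ : ν.map (fun x => (r x, Z x)) = ν.map r ⊗ₘ κ) :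
    η.map (fun z => ((r z.1, r z.2), Z z.2)) =
      η.map (fun z => (r z.1, r z.2)) ⊗ₘ κ.comap Prod.snd measurable_snd := by
  have hs : IsProbabilityMeasure (η.map Prod.swap) :=
    Measure.isProbabilityMeasure_map measurable_swap.aemeasurable
  have h1 : (η.map Prod.swap).map Prod.fst = ν := by
    rw [Measure.map_map measurable_fst measurable_swap]; exact hη2
  have h := hη.map_eq_compProd hr h1 hZ hκ
  refine measure_eq_of_lintegral_eq fun φ hφ => ?_
  have hm : Measurable fun q : (Ω × Ω) × E => φ (q.1.swap, q.2) := by fun_prop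
  have h2 := congrArg (fun m => ∫⁻ q, φ (q.1.swap, q.2) ∂m) h
  beta_reduce at h2
  have hF : Measurable fun c : Ω × Ω => ∫⁻ e, φ (c.swap, e) ∂(κ.comap Prod.fst measurable_fst c) :=
    hm.lintegral_kernel_prod_right'
  rw [lintegral_map hm (by fun_prop), lintegral_map (by fun_prop) measurable_swap,
    Measure.lintegral_compProd hm, lintegral_map hF (by fun_prop),
    lintegral_map (f := fun z : Ω × Ω => ∫⁻ e, φ ((r z.1, r z.2).swap, e)
      ∂(κ.comap Prod.fst measurable_fst (r z.1, r z.2)))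
      (hF.comp (by fun_prop : Measurable fun z : Ω × Ω => (r z.1, r z.2))) measurable_swap] at h2
  rw [lintegral_map hφ (by fun_prop), Measure.lintegral_compProd hφ,
    lintegral_map hφ.lintegral_kernel_prod_right' (by fun_prop)]
  exact h2

theorem IsPolish.measurable_edist {X : DistSpace} (hX : IsPolish X) :
    Measurable fun q : X.carrier × X.carrier => X.edist q.1 q.2 := by
  obtain ⟨_, mX, _, _, _, _⟩ := hX
  simp only [LawfulDist.edist_eq]
  exact _root_.measurable_edist

/-- Named here, where no metric on `ℝ` other than the standard one is in scope. -/
instance standardBorelSpace_path (N : ℕ) : StandardBorelSpace (Fin N → ℝ) := inferInstance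

section NestedVar

variable {p : ℝ} [hp : Fact (1 ≤ p)] {m : MetricSpace ℝ} {n : ℕ}

theorem nestedStep_edist_rpow (X : DistSpace) (a b : (nestedStep p m X).carrier) :
    (nestedStep p m X).edist a b ^ p =
      m.edist a.1 b.1 ^ p + wasserstein p X a.2.1 b.2.1 ^ p := by
  change (_ ^ (1 / p)) ^ p = _
  rw [← ENNReal.rpow_mul, one_div_mul_cancel (exponent_pos (p := p)).ne', ENNReal.rpow_one]

theorem pathSpace_edist_rpow (x y : Fin (n + 1) → ℝ) :
    (pathSpace p m n).edist x y ^ p = ∑ i, m.edist (x i) (y i) ^ p := by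
  change (_ ^ (1 / p)) ^ p = _
  rw [← ENNReal.rpow_mul, one_div_mul_cancel (exponent_pos (p := p)).ne', ENNReal.rpow_one]

theorem measurable_base_edist (hm : IsCompleteUsual m) :
    Measurable fun q : ℝ × ℝ => m.edist q.1 q.2 :=
  (isPolish_real hm.1 hm.2 1).measurable_edist

theorem measurable_base_edist_rpow (hm : IsCompleteUsual m) {Y : Type*} [MeasurableSpace Y]
    {f g : Y → ℝ} (hf : Measurable f) (hg : Measurable g) (q : ℝ) :
    Measurable fun y => m.edist (f y) (g y) ^ q :=
  (((measurable_base_edist hm).comp (hf.prodMk hg) :) : Measurable fun y => m.edist (f y) (g y)).pow_const q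

/-- The first coordinate of a point of `nestedSpace p m k`. -/
def nestedHead : (k : ℕ) → (nestedSpace p m k).carrier → ℝ
  | 0, z => z
  | _ + 1, z => z.1

theorem measurable_nestedHead (hm : IsCompleteUsual m) (k : ℕ) :
    Measurable (nestedHead (p := p) (m := m) k) := by
  cases k with
  | zero => exact measurable_id
  | succ k =>
    have h := (isPolish_nestedStep (p := p) hm.1 hm.2
      (isPolish_nestedSpace (p := p) hm.1 hm.2 k)).2
    change @Measurable (ℝ × Pp p (nestedSpace p m k)) ℝ (nestedStep p m (nestedSpace p m k)).meas _
      Prod.fst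
    rw [h]
    exact measurable_fst

theorem IsNestedVar.head {μ : ProbabilityMeasure (Fin (n + 1) → ℝ)} {k : ℕ}
    {Z : (Fin (n + 1) → ℝ) → (nestedSpace p m k).carrier} (hZ : IsNestedVar p m n μ k Z)
    (x : Fin (n + 1) → ℝ) : nestedHead k (Z x) = x ⟨n - k, by omega⟩ := by
  cases k with
  | zero => rw [hZ]; rfl
  | succ k =>
    obtain ⟨Z', T, -, -, rfl⟩ := hZ
    rfl

/-- The nested variable of time `n - k` is measurable with respect to the past up to that time. -/
theorem IsNestedVar.measurable_and_trunc (hm : IsCompleteUsual m)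
    {μ : ProbabilityMeasure (Fin (n + 1) → ℝ)} {k : ℕ}
    {Z : (Fin (n + 1) → ℝ) → (nestedSpace p m k).carrier} (hZ : IsNestedVar p m n μ k Z) :
    Measurable Z ∧ ∀ x, Z (trunc (n - k + 1) x) = Z x := by
  cases k with
  | zero =>
    rw [IsNestedVar] at hZ
    subst hZ
    exact ⟨measurable_pi_apply _, fun x => trunc_apply_of_lt (by simp) x⟩
  | succ k =>
    obtain ⟨Z', T, -, hT, rfl⟩ := hZ
    have h := (isPolish_nestedStep (p := p) hm.1 hm.2
      (isPolish_nestedSpace (p := p) hm.1 hm.2 k)).2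
    obtain ⟨_, mX, _, _, _, _⟩ := isPolish_nestedSpace (p := p) hm.1 hm.2 k
    have hT := hT.1
    rw [coordFiltration_eq, measurable_comap_iff_of_idempotent (by fun_prop)
      (trunc_trunc_of_le le_rfl)] at hT
    refine ⟨?_, fun x => Prod.ext (trunc_apply_of_lt (by simp) x) (hT.2 x)⟩
    change @Measurable _ (ℝ × Pp p (nestedSpace p m k)) _
      (nestedStep p m (nestedSpace p m k)).meas _
    rw [h]
    exact (measurable_pi_apply _).prodMk hT.1

/-- The nested variables exist and have finite `p`-th moments. -/
theorem exists_nestedVar (hm : IsCompleteUsual m) (μ : Pp p (pathSpace p m n)) {k : ℕ}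
    (hk : k ≤ n) :
    ∃ (Z : (Fin (n + 1) → ℝ) → (nestedSpace p m k).carrier) (z₀ : (nestedSpace p m k).carrier),
      IsNestedVar p m n μ.1 k Z ∧
        ∫⁻ x, (nestedSpace p m k).edist (Z x) z₀ ^ p ∂(μ.1 : Measure (Fin (n + 1) → ℝ)) < ∞ := by
  obtain ⟨x₀, hx₀⟩ := μ.2
  have hcoord : ∀ i, ∫⁻ x, m.edist (x i) (x₀ i) ^ p ∂(μ.1 : Measure (Fin (n + 1) → ℝ)) < ∞ := by
    refine fun i => lt_of_le_of_lt (lintegral_mono fun x => ?_) hx₀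
    rw [pathSpace_edist_rpow]
    exact Finset.single_le_sum (f := fun i => m.edist (x i) (x₀ i) ^ p) (fun _ _ => zero_le)
      (Finset.mem_univ i)
  induction k with
  | zero => exact ⟨_, x₀ (Fin.last n), rfl, hcoord _⟩
  | succ k ih =>
    obtain ⟨Z, z₀, hZ, hZm⟩ := ih (by omega)
    have hZmeas := (hZ.measurable_and_trunc hm).1
    obtain ⟨_, mX, _, _, _, _⟩ := isPolish_nestedSpace (p := p) hm.1 hm.2 k
    simp only [LawfulDist.edist_eq] at hZm
    let i : Fin (n + 1) := ⟨n - (k + 1), by omega⟩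
    have hr : Measurable (trunc (i + 1) : (Fin (n + 1) → ℝ) → Fin (n + 1) → ℝ) := by fun_prop
    have hrr : ∀ x : Fin (n + 1) → ℝ, trunc (i + 1) (trunc (i + 1) x) = trunc (i + 1) x :=
      trunc_trunc_of_le le_rfl
    obtain ⟨T₀, hT₀, h₀⟩ := exists_condLaw (μ := (μ.1 : Measure (Fin (n + 1) → ℝ))) hr hZmeas hZm
    have hT : Measurable fun x => T₀ (trunc (i + 1) x) := hT₀.comp hr
    have h : (μ.1 : Measure (Fin (n + 1) → ℝ)).map (fun x => (trunc (i + 1) x, Z x)) =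
        (μ.1 : Measure (Fin (n + 1) → ℝ)).map (trunc (i + 1)) ⊗ₘ Pp.kernel _ hT := by
      rw [map_prodMk_eq_compProd_iff hr hZmeas] at h₀ ⊢
      simpa only [Pp.kernel_apply, hrr] using h₀
    refine ⟨_, (x₀ i, Pp.dirac p z₀), ⟨Z, _, hZ, (isCondLaw_iff hZmeas).2
      ⟨hT, fun x => by rw [hrr], h⟩, rfl⟩, ?_⟩
    have hle : ∀ x : Fin (n + 1) → ℝ,
        (nestedSpace p m (k + 1)).edist (x i, T₀ (trunc (i + 1) x)) (x₀ i, Pp.dirac p z₀) ^ p ≤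
          m.edist (x i) (x₀ i) ^ p +
            ∫⁻ z, edist z z₀ ^ p ∂(Pp.kernel T₀ hT₀ (trunc (i + 1) x)) := by
      intro x
      refine (nestedStep_edist_rpow _ _ _).trans_le (add_le_add_right ?_ _)
      have h1 := ENNReal.rpow_le_rpow (wasserstein_dirac_le (P := (T₀ (trunc (i + 1) x)).1)
        (exponent_pos (p := p)) z₀) (exponent_pos (p := p)).le
      rwa [← ENNReal.rpow_mul, one_div_mul_cancel (exponent_pos (p := p)).ne',
        ENNReal.rpow_one] at h1
    refine (lintegral_mono hle).trans_lt ?_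
    have hmi : Measurable fun x : Fin (n + 1) → ℝ => m.edist (x i) (x₀ i) ^ p :=
      measurable_base_edist_rpow hm (measurable_pi_apply i) measurable_const p
    rw [lintegral_add_left hmi]
    refine ENNReal.add_lt_top.2 ⟨hcoord i, ?_⟩
    rwa [← lintegral_of_map_eq_compProd hr hZmeas h₀
      (φ := fun q => edist q.2 z₀ ^ p) (by fun_prop)]

theorem filter_le_eq_insert {k : ℕ} (hk : k + 1 ≤ n) :
    (Finset.univ.filter fun i : Fin (n + 1) => n - (k + 1) ≤ i) =
      insert ⟨n - (k + 1), by omega⟩ (Finset.univ.filter fun i : Fin (n + 1) => n - k ≤ i) := by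
  ext i
  simp only [Finset.mem_filter, Finset.mem_univ, true_and, Finset.mem_insert, Fin.ext_iff]
  omega

/-- Under a bicausal coupling the expected distance of the nested variables is at most the expected
distance of the corresponding coordinates of the paths. -/
theorem lintegral_nestedVar_le (hm : IsCompleteUsual m) {μ ν : ProbabilityMeasure (Fin (n + 1) → ℝ)}
    {γ : Measure ((Fin (n + 1) → ℝ) × (Fin (n + 1) → ℝ))} [IsProbabilityMeasure γ]
    (h1 : γ.map Prod.fst = μ) (h2 : γ.map Prod.snd = ν)
    (hc1 : ∀ i : Fin (n + 1), CausalAt (trunc (i + 1)) (μ : Measure (Fin (n + 1) → ℝ)) γ)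
    (hc2 : ∀ i : Fin (n + 1), CausalAt (trunc (i + 1)) (ν : Measure (Fin (n + 1) → ℝ))
      (γ.map Prod.swap)) {k : ℕ} (hk : k ≤ n)
    {Z Z' : (Fin (n + 1) → ℝ) → (nestedSpace p m k).carrier} (hZ : IsNestedVar p m n μ k Z)
    (hZ' : IsNestedVar p m n ν k Z') :
    ∫⁻ z, (nestedSpace p m k).edist (Z z.1) (Z' z.2) ^ p ∂γ ≤
      ∫⁻ z, ∑ i ∈ Finset.univ.filter fun i : Fin (n + 1) => n - k ≤ i,
        m.edist (z.1 i) (z.2 i) ^ p ∂γ := by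
  induction k with
  | zero =>
    rw [IsNestedVar] at hZ hZ'
    subst hZ hZ'
    refine lintegral_mono fun z => ?_
    exact Finset.single_le_sum (f := fun i => m.edist (z.1 i) (z.2 i) ^ p) (fun _ _ => zero_le)
      (by simp)
  | succ k ih =>
    obtain ⟨Y, T, hY, hT, rfl⟩ := hZ
    obtain ⟨Y', T', hY', hT', rfl⟩ := hZ'
    have hYm := (hY.measurable_and_trunc hm).1
    have hYm' := (hY'.measurable_and_trunc hm).1
    have ih := ih (by omega) hY hY'
    obtain ⟨_, mX, _, _, _, _⟩ := isPolish_nestedSpace (p := p) hm.1 hm.2 k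
    obtain ⟨hTm, hTr, hT⟩ := (isCondLaw_iff hYm).1 hT
    obtain ⟨hTm', hTr', hT'⟩ := (isCondLaw_iff hYm').1 hT'
    have hr : Measurable (trunc (n - (k + 1) + 1) : (Fin (n + 1) → ℝ) → Fin (n + 1) → ℝ) := by
      fun_prop
    have hmi : ∀ i : Fin (n + 1), Measurable
        fun z : (Fin (n + 1) → ℝ) × (Fin (n + 1) → ℝ) => m.edist (z.1 i) (z.2 i) ^ p :=
      fun i => measurable_base_edist_rpow hm ((measurable_pi_apply i).comp measurable_fst)
        ((measurable_pi_apply i).comp measurable_snd) p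
    have e1 := (hc1 ⟨n - (k + 1), by omega⟩).map_eq_compProd hr h1 hYm hT
    have e2 := (hc2 ⟨n - (k + 1), by omega⟩).map_eq_compProd_snd hr h2 hYm' hT'
    have key := lintegral_edist_condLaw_le (p := p) (μ := γ)
      (c := fun z => (trunc (n - (k + 1) + 1) z.1, trunc (n - (k + 1) + 1) z.2)) (by fun_prop)
      (hYm.comp measurable_fst) (hYm'.comp measurable_snd) (hTm.comp measurable_fst)
      (hTm'.comp measurable_snd) e1 e2
    simp only [Function.comp_apply] at key
    simp only [LawfulDist.edist_eq] at ih
    have hcost : ∀ z : (Fin (n + 1) → ℝ) × (Fin (n + 1) → ℝ),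
        (nestedSpace p m (k + 1)).edist (z.1 ⟨n - (k + 1), by omega⟩, T z.1)
          (z.2 ⟨n - (k + 1), by omega⟩, T' z.2) ^ p =
        m.edist (z.1 ⟨n - (k + 1), by omega⟩) (z.2 ⟨n - (k + 1), by omega⟩) ^ p +
          edist (T (trunc (n - (k + 1) + 1) z.1)) (T' (trunc (n - (k + 1) + 1) z.2)) ^ p := by
      intro z
      refine (nestedStep_edist_rpow _ _ _).trans ?_
      rw [hTr z.1, hTr' z.2]
      rfl
    simp only [hcost]
    rw [lintegral_add_left (hmi _)]
    simp only [filter_le_eq_insert hk]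
    rw [lintegral_congr fun z => Finset.sum_insert (by simp; omega), lintegral_add_left (hmi _)]
    exact add_le_add_right (key.trans ih) _

/-- The Wasserstein distance of nested laws is at most the nested distance. -/
theorem wasserstein_le_nestedDist (hm : IsCompleteUsual m)
    {μ ν : ProbabilityMeasure (Fin (n + 1) → ℝ)}
    {P Q : ProbabilityMeasure (nestedSpace p m n).carrier} (hP : IsNestedLaw p m n μ P)
    (hQ : IsNestedLaw p m n ν Q) :
    wasserstein p (nestedSpace p m n) P Q ≤ nestedDist p m n μ ν := by
  obtain ⟨Z, hZ, hZm, hP⟩ := hP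
  obtain ⟨Z', hZ', hZm', hQ⟩ := hQ
  have hp0 : 0 < p := exponent_pos
  obtain ⟨_, mX, _, _, _, _⟩ := isPolish_nestedSpace (p := p) hm.1 hm.2 n
  rw [nestedDist, one_div, ENNReal.le_rpow_inv_iff hp0]
  refine le_iInf₂ fun γ hγ => ?_
  obtain ⟨⟨h1, h2⟩, hc1, hc2⟩ := hγ
  have h2' : (γ.map measurable_swap.aemeasurable : Measure ((Fin (n + 1) → ℝ) × (Fin (n + 1) → ℝ))).map
      Prod.fst = ν := by
    rw [ProbabilityMeasure.toMeasure_map, Measure.map_map measurable_fst measurable_swap]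
    exact h2
  rw [isCausal_iff h1] at hc1
  rw [isCausal_iff h2'] at hc2
  have h := lintegral_nestedVar_le hm h1 h2 hc1 hc2 le_rfl hZ hZ'
  have hcost : ∫⁻ z, (pathSpace p m n).edist z.1 z.2 ^ p
      ∂(γ : Measure ((Fin (n + 1) → ℝ) × (Fin (n + 1) → ℝ))) = ∫⁻ z, ∑ i, m.edist (z.1 i) (z.2 i) ^ p
      ∂(γ : Measure ((Fin (n + 1) → ℝ) × (Fin (n + 1) → ℝ))) :=
    lintegral_congr fun z => pathSpace_edist_rpow z.1 z.2
  rw [hcost]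
  simp only [tsub_self, zero_le, Finset.filter_true] at h
  refine le_trans ?_ h
  have hW := wasserstein_le_of_map (X := nestedSpace p m n) hp0
    (μ := (γ : Measure ((Fin (n + 1) → ℝ) × (Fin (n + 1) → ℝ))))
    (hZm.comp measurable_fst) (hZm'.comp measurable_snd) (P := P) (Q := Q)
    (by rw [← Measure.map_map hZm measurable_fst, h1, hP])
    (by rw [← Measure.map_map hZm' measurable_snd, h2, hQ])
  simp only [LawfulDist.edist_eq]
  rwa [one_div, ENNReal.le_rpow_inv_iff hp0] at hW

end NestedVar

/-! ### Construction of bicausal couplings -/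

section Construction

variable {p : ℝ} [hp : Fact (1 ≤ p)] {m : MetricSpace ℝ} {n : ℕ}
  {μ ν : ProbabilityMeasure (Fin (n + 1) → ℝ)}

/-- The coupling `η` of `μ` and `ν` is causal in both directions at the first `t` times. -/
structure IsBicausalUpTo (μ ν : ProbabilityMeasure (Fin (n + 1) → ℝ)) (t : ℕ)
    (η : Measure ((Fin (n + 1) → ℝ) × (Fin (n + 1) → ℝ))) : Prop where
  isProbabilityMeasure : IsProbabilityMeasure η
  map_fst : η.map Prod.fst = μ
  map_snd : η.map Prod.snd = ν
  causal : ∀ s, 1 ≤ s → s ≤ t → CausalAt (trunc s) (μ : Measure (Fin (n + 1) → ℝ)) η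
  causal_swap : ∀ s, 1 ≤ s → s ≤ t →
    CausalAt (trunc s) (ν : Measure (Fin (n + 1) → ℝ)) (η.map Prod.swap)

theorem IsBicausalUpTo.exists_mem_bicausalCouplings {t : ℕ} (ht : n + 1 ≤ t)
    {η : Measure ((Fin (n + 1) → ℝ) × (Fin (n + 1) → ℝ))} (h : IsBicausalUpTo μ ν t η) :
    ∃ γ ∈ bicausalCouplings n μ ν,
      (γ : Measure ((Fin (n + 1) → ℝ) × (Fin (n + 1) → ℝ))) = η := by
  have := h.isProbabilityMeasure
  let γ : ProbabilityMeasure ((Fin (n + 1) → ℝ) × (Fin (n + 1) → ℝ)) := ⟨η, this⟩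
  have h2 : (γ.map measurable_swap.aemeasurable :
      Measure ((Fin (n + 1) → ℝ) × (Fin (n + 1) → ℝ))).map Prod.fst = ν := by
    rw [ProbabilityMeasure.toMeasure_map, Measure.map_map measurable_fst measurable_swap]
    exact h.map_snd
  exact ⟨γ, ⟨⟨h.map_fst, h.map_snd⟩,
    (isCausal_iff h.map_fst).2 fun i => h.causal _ (by omega) (by omega),
    (isCausal_iff h2).2 fun i => h.causal_swap _ (by omega) (by omega)⟩, rfl⟩

/-- A coupling which is bicausal up to time `n - k` is refined to one which is bicausal up to
time `n - k + 1`, by means of nearly optimal couplings of the conditional laws of the nested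
variables. -/
theorem IsBicausalUpTo.exists_succ (hm : IsCompleteUsual m) {k : ℕ}
    {Z Z' : (Fin (n + 1) → ℝ) → (nestedSpace p m k).carrier} (hZ : IsNestedVar p m n μ k Z)
    (hZ' : IsNestedVar p m n ν k Z')
    {T T' : (Fin (n + 1) → ℝ) → Pp p (nestedSpace p m k)} (hTr : ∀ x, T (trunc (n - k) x) = T x)
    (hTr' : ∀ x, T' (trunc (n - k) x) = T' x) (hTm : Measurable T) (hTm' : Measurable T')
    (hT : ∀ A, MeasurableSet A → ∀ B, MeasurableSet B →
      (μ : Measure (Fin (n + 1) → ℝ)) (trunc (n - k) ⁻¹' A ∩ Z ⁻¹' B) =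
        ∫⁻ x in trunc (n - k) ⁻¹' A, ((T x).1 : Measure (nestedSpace p m k).carrier) B
          ∂(μ : Measure (Fin (n + 1) → ℝ)))
    (hT' : ∀ A, MeasurableSet A → ∀ B, MeasurableSet B →
      (ν : Measure (Fin (n + 1) → ℝ)) (trunc (n - k) ⁻¹' A ∩ Z' ⁻¹' B) =
        ∫⁻ x in trunc (n - k) ⁻¹' A, ((T' x).1 : Measure (nestedSpace p m k).carrier) B
          ∂(ν : Measure (Fin (n + 1) → ℝ)))
    {η : Measure ((Fin (n + 1) → ℝ) × (Fin (n + 1) → ℝ))} (hη : IsBicausalUpTo μ ν (n - k) η)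
    {ε : ℝ≥0∞} (hε : 0 < ε) :
    ∃ η', IsBicausalUpTo μ ν (n - k + 1) η' ∧
      ∫⁻ z, (∑ i ∈ Finset.univ.filter fun i : Fin (n + 1) => (i : ℕ) < n - k,
          m.edist (z.1 i) (z.2 i) ^ p) + (nestedSpace p m k).edist (Z z.1) (Z' z.2) ^ p ∂η' ≤
        ∫⁻ z, (∑ i ∈ Finset.univ.filter fun i : Fin (n + 1) => (i : ℕ) < n - k,
          m.edist (z.1 i) (z.2 i) ^ p) +
            wasserstein p (nestedSpace p m k) (T z.1).1 (T' z.2).1 ^ p ∂η + ε := by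
  obtain ⟨hZm, hZr⟩ := hZ.measurable_and_trunc hm
  obtain ⟨hZm', hZr'⟩ := hZ'.measurable_and_trunc hm
  have hhead := measurable_nestedHead (p := p) hm k
  obtain ⟨_, mX, _, _, _, _⟩ := isPolish_nestedSpace (p := p) hm.1 hm.2 k
  have := hη.isProbabilityMeasure
  have ha : Measurable (trunc (n - k) : (Fin (n + 1) → ℝ) → Fin (n + 1) → ℝ) := by fun_prop
  obtain ⟨g, hg, hgb⟩ := exists_measurable_coupling (p := p) (X := nestedSpace p m k) hε
  let K : Kernel ((Fin (n + 1) → ℝ) × (Fin (n + 1) → ℝ))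
      ((nestedSpace p m k).carrier × (nestedSpace p m k).carrier) :=
    ⟨fun z => g (T z.1, T' z.2), hg.comp (by fun_prop)⟩
  have hK : IsMarkovKernel K := ⟨fun z => (hgb _).1⟩
  let t : Fin (n + 1) := ⟨n - k, by omega⟩
  -- the first coordinate of the nested variable is the value of the path at time `t`, so the past
  -- before `t` and the nested variable determine the past up to `t`
  let f : (Fin (n + 1) → ℝ) × (nestedSpace p m k).carrier → Fin (n + 1) → ℝ :=
    fun q => Function.update q.1 t (nestedHead k q.2)
  have hf : Measurable f := by
    refine measurable_pi_lambda _ fun j => ?_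
    by_cases hj : j = t
    · subst hj
      simpa [f, Function.comp_def] using hhead.comp measurable_snd
    · simpa [f, hj, Function.comp_def] using (measurable_pi_apply j).comp measurable_fst
  obtain ⟨η', h1, h2, h3, h4, h5, h6, h7, h8⟩ := exists_refined_coupling
    (μ := (μ : Measure (Fin (n + 1) → ℝ))) (ν := (ν : Measure (Fin (n + 1) → ℝ)))
    (measurable_trunc (n - k + 1)) ha (trunc_trunc_of_le (Nat.le_succ _)) hZm hZm' hZr hZr' hf
    (fun x => by simp only [f, hZ.head]; exact update_trunc (t := t) x)
    (fun x => by simp only [f, hZ'.head]; exact update_trunc (t := t) x)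
    (T := Pp.kernel T hTm) (T' := Pp.kernel T' hTm')
    ((map_prodMk_eq_compProd_iff ha hZm _).2 (by simpa only [Pp.kernel_apply, hTr] using hT))
    ((map_prodMk_eq_compProd_iff ha hZm' _).2 (by simpa only [Pp.kernel_apply, hTr'] using hT'))
    hη.map_fst hη.map_snd (K := K)
    (fun z => by rw [Pp.kernel_apply, hTr]; exact (hgb _).2.1)
    (fun z => by rw [Pp.kernel_apply, hTr']; exact (hgb _).2.2.1)
  refine ⟨η', ⟨h1, h2, h3, fun s hs1 hs => ?_, fun s hs1 hs => ?_⟩, ?_⟩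
  · rcases hs.lt_or_eq with hs | rfl
    · have hs' : s ≤ n - k := Nat.lt_succ_iff.1 hs
      exact h6 (hη.causal _ (hs1.trans hs') le_rfl) _ (by fun_prop) (trunc_trunc_of_le hs')
        (hη.causal s hs1 hs')
    · exact h4
  · rcases hs.lt_or_eq with hs | rfl
    · have hs' : s ≤ n - k := Nat.lt_succ_iff.1 hs
      exact h7 (hη.causal_swap _ (hs1.trans hs') le_rfl) _ (by fun_prop) (trunc_trunc_of_le hs')
        (hη.causal_swap s hs1 hs')
    · exact h5
  · have hsum : Measurable fun z : (Fin (n + 1) → ℝ) × (Fin (n + 1) → ℝ) =>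
        ∑ i ∈ Finset.univ.filter fun i : Fin (n + 1) => (i : ℕ) < n - k,
          m.edist (z.1 i) (z.2 i) ^ p :=
      Finset.measurable_fun_sum _ fun i _ => measurable_base_edist_rpow hm
        ((measurable_pi_apply i).comp measurable_fst) ((measurable_pi_apply i).comp measurable_snd) p
    have hsum_trunc : ∀ z : (Fin (n + 1) → ℝ) × (Fin (n + 1) → ℝ),
        ∑ i ∈ Finset.univ.filter (fun i : Fin (n + 1) => (i : ℕ) < n - k),
          m.edist (trunc (n - k) z.1 i) (trunc (n - k) z.2 i) ^ p =
        ∑ i ∈ Finset.univ.filter (fun i : Fin (n + 1) => (i : ℕ) < n - k),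
          m.edist (z.1 i) (z.2 i) ^ p := by
      intro z
      refine Finset.sum_congr rfl fun i hi => ?_
      have hi' : (i : ℕ) < n - k := (Finset.mem_filter.1 hi).2
      rw [trunc_apply_of_lt hi', trunc_apply_of_lt hi']
    have h9 := h8 (fun q => (∑ i ∈ Finset.univ.filter fun i : Fin (n + 1) => (i : ℕ) < n - k,
      m.edist (q.1.1 i) (q.2.1 i) ^ p) + edist q.1.2 q.2.2 ^ p)
      ((hsum.comp (by fun_prop : Measurable fun q : ((Fin (n + 1) → ℝ) ×
        (nestedSpace p m k).carrier) × ((Fin (n + 1) → ℝ) × (nestedSpace p m k).carrier) =>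
          (q.1.1, q.2.1))).add (by fun_prop))
    simp only [hsum_trunc] at h9
    simp only [LawfulDist.edist_eq]
    rw [h9]
    have hε' : ∫⁻ _, ε ∂η = ε := by simp
    rw [← hε', ← lintegral_add_right _ measurable_const]
    refine lintegral_mono fun z => ?_
    have : IsProbabilityMeasure (K z) := hK.1 z
    rw [lintegral_add_left measurable_const, lintegral_const, measure_univ, mul_one, add_assoc]
    exact add_le_add_right (hgb _).2.2.2 _

theorem filter_lt_eq_insert {k : ℕ} (hk : k + 1 ≤ n) :
    (Finset.univ.filter fun i : Fin (n + 1) => (i : ℕ) < n - k) =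
      insert ⟨n - (k + 1), by omega⟩
        (Finset.univ.filter fun i : Fin (n + 1) => (i : ℕ) < n - (k + 1)) := by
  ext i
  simp only [Finset.mem_filter, Finset.mem_univ, true_and, Finset.mem_insert, Fin.ext_iff]
  omega

/-- Iteration of `IsBicausalUpTo.exists_succ` until the terminal time: the distance of the current
nested variables is replaced, one coordinate at a time, by the distance of the remaining paths, at
the expense of `ε` in each of the `k` steps. -/
theorem IsBicausalUpTo.exists_bicausal (hm : IsCompleteUsual m) {ε : ℝ≥0∞} (hε : 0 < ε) {k : ℕ}
    (hk : k ≤ n) {Z Z' : (Fin (n + 1) → ℝ) → (nestedSpace p m k).carrier}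
    (hZ : IsNestedVar p m n μ k Z) (hZ' : IsNestedVar p m n ν k Z')
    {η : Measure ((Fin (n + 1) → ℝ) × (Fin (n + 1) → ℝ))}
    (hη : IsBicausalUpTo μ ν (n - k + 1) η) :
    ∃ γ, IsBicausalUpTo μ ν (n + 1) γ ∧ ∫⁻ z, ∑ i, m.edist (z.1 i) (z.2 i) ^ p ∂γ ≤
      ∫⁻ z, (∑ i ∈ Finset.univ.filter fun i : Fin (n + 1) => (i : ℕ) < n - k,
        m.edist (z.1 i) (z.2 i) ^ p) + (nestedSpace p m k).edist (Z z.1) (Z' z.2) ^ p ∂η +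
          k * ε := by
  induction k generalizing η with
  | zero =>
    rw [IsNestedVar] at hZ hZ'
    subst hZ hZ'
    refine ⟨η, hη, ?_⟩
    rw [Nat.cast_zero, zero_mul, add_zero]
    refine (lintegral_congr fun z => ?_).le
    have : (Finset.univ : Finset (Fin (n + 1))) = insert (Fin.last n)
        (Finset.univ.filter fun i : Fin (n + 1) => (i : ℕ) < n - 0) := by
      ext i
      simp only [Finset.mem_filter, Finset.mem_univ, true_and, Finset.mem_insert, Fin.ext_iff,
        Fin.val_last, true_iff]
      have := i.2
      omega
    conv_lhs => rw [this]
    rw [Finset.sum_insert (by simp), add_comm]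
    rfl
  | succ k ih =>
    obtain ⟨Y, T, hY, hT, rfl⟩ := hZ
    obtain ⟨Y', T', hY', hT', rfl⟩ := hZ'
    have hk1 : n - (k + 1) + 1 = n - k := by omega
    rw [hk1] at hη
    obtain ⟨η', hη', hle⟩ : ∃ η', IsBicausalUpTo μ ν (n - k + 1) η' ∧
        ∫⁻ z, (∑ i ∈ Finset.univ.filter fun i : Fin (n + 1) => (i : ℕ) < n - k,
          m.edist (z.1 i) (z.2 i) ^ p) + (nestedSpace p m k).edist (Y z.1) (Y' z.2) ^ p ∂η' ≤
        ∫⁻ z, (∑ i ∈ Finset.univ.filter fun i : Fin (n + 1) => (i : ℕ) < n - k,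
          m.edist (z.1 i) (z.2 i) ^ p) +
            wasserstein p (nestedSpace p m k) (T z.1).1 (T' z.2).1 ^ p ∂η + ε := by
      have hYm := (hY.measurable_and_trunc hm).1
      have hYm' := (hY'.measurable_and_trunc hm).1
      have hp' := isPolish_nestedSpace (p := p) hm.1 hm.2 k
      obtain ⟨hTm, hTr, -⟩ : Measurable T ∧ (∀ x, T (trunc (n - k) x) = T x) ∧ True := by
        obtain ⟨_, mX, _, _, _, _⟩ := hp'
        obtain ⟨hTm, hTr, -⟩ := (isCondLaw_iff hYm).1 hT
        simp only [hk1] at hTr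
        exact ⟨hTm, hTr, trivial⟩
      obtain ⟨hTm', hTr', -⟩ : Measurable T' ∧ (∀ x, T' (trunc (n - k) x) = T' x) ∧ True := by
        obtain ⟨_, mX, _, _, _, _⟩ := hp'
        obtain ⟨hTm, hTr, -⟩ := (isCondLaw_iff hYm').1 hT'
        simp only [hk1] at hTr
        exact ⟨hTm, hTr, trivial⟩
      have hF : ∀ A : Set (Fin (n + 1) → ℝ), MeasurableSet A →
          MeasurableSet[coordFiltration n ⟨n - (k + 1), by omega⟩] (trunc (n - k) ⁻¹' A) := by
        intro A hA
        rw [coordFiltration_eq]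
        refine ⟨A, hA, ?_⟩
        change trunc (n - (k + 1) + 1) ⁻¹' A = _
        rw [hk1]
      exact hη.exists_succ hm hY hY' hTr hTr' hTm hTm' (fun A hA => hT.2 _ (hF A hA))
        (fun A hA => hT'.2 _ (hF A hA)) hε
    obtain ⟨γ, hγ, hγle⟩ := ih (by omega) hY hY' hη'
    refine ⟨γ, hγ, hγle.trans ((add_le_add_left hle _).trans (le_of_eq ?_))⟩
    rw [add_assoc, Nat.cast_succ, add_mul, one_mul, add_comm ε]
    congr 1
    refine lintegral_congr fun z => ?_
    rw [filter_lt_eq_insert hk, Finset.sum_insert (by simp), add_comm (m.edist _ _ ^ p), add_assoc]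
    congr 1
    exact (nestedStep_edist_rpow (nestedSpace p m k) (z.1 ⟨n - (k + 1), by omega⟩, T z.1)
      (z.2 ⟨n - (k + 1), by omega⟩, T' z.2)).symm

/-- Given the trivial past at time `0`, the conditional law of `Z` is its law. -/
theorem measure_trunc_zero_inter {μ : Measure (Fin (n + 1) → ℝ)} [IsProbabilityMeasure μ]
    {E : Type*} [MeasurableSpace E] {Z : (Fin (n + 1) → ℝ) → E} (hZ : Measurable Z)
    {P : Measure E} (hP : P = μ.map Z) {A : Set (Fin (n + 1) → ℝ)} {B : Set E}
    (hB : MeasurableSet B) :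
    μ (trunc 0 ⁻¹' A ∩ Z ⁻¹' B) = ∫⁻ _ in trunc 0 ⁻¹' A, P B ∂μ := by
  have h0 : (trunc 0 : (Fin (n + 1) → ℝ) → Fin (n + 1) → ℝ) = fun _ => 0 := funext trunc_zero
  rw [h0, setLIntegral_const, hP, Measure.map_apply hZ hB]
  by_cases h : (0 : Fin (n + 1) → ℝ) ∈ A <;> simp [h]

/-- The nested distance is at most the Wasserstein distance of the nested laws. -/
theorem nestedDist_le_wasserstein (hm : IsCompleteUsual m)
    {P Q : Pp p (nestedSpace p m n)} (hP : IsNestedLaw p m n μ P.1) (hQ : IsNestedLaw p m n ν Q.1) :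
    nestedDist p m n μ ν ≤ wasserstein p (nestedSpace p m n) P.1 Q.1 := by
  obtain ⟨Z, hZ, hZm, hP⟩ := hP
  obtain ⟨Z', hZ', hZm', hQ⟩ := hQ
  have hp0 : 0 < p := exponent_pos
  -- at time `0` there is no causality condition, so that the product coupling can be used
  have hη : IsBicausalUpTo μ ν (n - n) ((μ : Measure (Fin (n + 1) → ℝ)).prod ν) :=
    ⟨inferInstance, by simp, by simp, fun s h1 h2 => by omega, fun s h1 h2 => by omega⟩
  rw [nestedDist, one_div, ENNReal.rpow_inv_le_iff hp0]
  refine ENNReal.le_of_forall_pos_le_add fun ε hε _ => ?_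
  -- the coupling is refined `n + 1` times
  have hε' : (0 : ℝ≥0∞) < ε / (n + 1 : ℕ) :=
    ENNReal.div_pos (by exact_mod_cast hε.ne') (ENNReal.natCast_ne_top _)
  obtain ⟨η', hη', hle⟩ := hη.exists_succ hm hZ hZ' (T := fun _ => P) (T' := fun _ => Q)
    (fun _ => rfl) (fun _ => rfl) measurable_const measurable_const (fun A _ B hB => by
      rw [Nat.sub_self]; exact measure_trunc_zero_inter hZm hP hB) (fun A _ B hB => by
      rw [Nat.sub_self]; exact measure_trunc_zero_inter hZm' hQ hB) hε'
  obtain ⟨γ, hγ, hγle⟩ := hη'.exists_bicausal hm hε' le_rfl hZ hZ'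
  obtain ⟨γ', hγ'mem, hγ'⟩ := hγ.exists_mem_bicausalCouplings le_rfl
  refine (iInf₂_le γ' hγ'mem).trans ?_
  have hcost : ∫⁻ z, (pathSpace p m n).edist z.1 z.2 ^ p
      ∂(γ' : Measure ((Fin (n + 1) → ℝ) × (Fin (n + 1) → ℝ))) =
      ∫⁻ z, ∑ i, m.edist (z.1 i) (z.2 i) ^ p ∂γ := by
    rw [hγ']
    exact lintegral_congr fun z => pathSpace_edist_rpow z.1 z.2
  rw [hcost]
  refine hγle.trans ((add_le_add_left hle _).trans (le_of_eq ?_))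
  rw [add_assoc]
  congr 1
  · simp
  · rw [← one_add_mul, add_comm (1 : ℝ≥0∞), ← Nat.cast_succ]
    exact ENNReal.mul_div_cancel (by simp) (ENNReal.natCast_ne_top _)

end Construction

/-! ### Density of the nested laws of paths -/

theorem IsPolish.lintegral_edist_lt_top {p : ℝ} [Fact (1 ≤ p)] {X : DistSpace} (hX : IsPolish X)
    (P : Pp p X) (x : X.carrier) : ∫⁻ z, X.edist z x ^ p ∂(P.1 : Measure X.carrier) < ∞ := by
  obtain ⟨_, mX, _, _, _, _⟩ := hX
  simp only [LawfulDist.edist_eq]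
  exact P.lintegral_edist_lt_top x

section Mixture

variable {p : ℝ} [hp : Fact (1 ≤ p)] {m : MetricSpace ℝ} {n M : ℕ}

/-- The path `y` preceded by the value `a`. -/
abbrev consPath (a : ℝ) (y : Fin (n + 1) → ℝ) : Fin (n + 2) → ℝ := Fin.cons a y

/-- The path `x` without its first value. -/
abbrev tailPath (x : Fin (n + 2) → ℝ) : Fin (n + 1) → ℝ := fun i => x i.succ

theorem measurable_consPath (a : ℝ) : Measurable (consPath (n := n) a) := by
  refine measurable_pi_lambda _ fun i => ?_
  refine Fin.cases ?_ (fun j => ?_) i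
  · exact measurable_const
  · exact measurable_pi_apply j

theorem measurable_tailPath : Measurable (tailPath (n := n)) :=
  measurable_pi_lambda _ fun i => measurable_pi_apply i.succ

theorem trunc_consPath (t : ℕ) (a : ℝ) (y : Fin (n + 1) → ℝ) :
    trunc (t + 1) (consPath a y) = consPath a (trunc t y) := by
  ext i
  refine Fin.cases ?_ (fun j => ?_) i
  · simp [trunc]
  · simp [trunc]

theorem tailPath_trunc (t : ℕ) (x : Fin (n + 2) → ℝ) :
    tailPath (trunc (t + 1) x) = trunc t (tailPath x) := by
  ext i
  simp [trunc]

/-- The law of a path which starts at `a i` and continues with law `μ i`, the index `i` having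
law `w`. -/
def consMixture (w : Measure (Fin M)) (a : Fin M → ℝ)
    (μ : Fin M → ProbabilityMeasure (Fin (n + 1) → ℝ)) : Measure (Fin (n + 2) → ℝ) :=
  w.bind fun i => (μ i : Measure (Fin (n + 1) → ℝ)).map (consPath (a i))

variable {w : Measure (Fin M)} {a : Fin M → ℝ} {μ : Fin M → ProbabilityMeasure (Fin (n + 1) → ℝ)}

theorem lintegral_consMixture {F : (Fin (n + 2) → ℝ) → ℝ≥0∞} (hF : Measurable F) :
    ∫⁻ x, F x ∂(consMixture w a μ) =
      ∫⁻ i, ∫⁻ y, F (consPath (a i) y) ∂(μ i : Measure (Fin (n + 1) → ℝ)) ∂w := by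
  rw [consMixture, Measure.lintegral_bind Measurable.of_discrete.aemeasurable hF.aemeasurable]
  exact lintegral_congr fun i => lintegral_map hF (measurable_consPath _)

theorem isProbabilityMeasure_consMixture [IsProbabilityMeasure w] :
    IsProbabilityMeasure (consMixture w a μ) := by
  constructor
  rw [← lintegral_one, lintegral_consMixture measurable_const]
  simp

theorem measurable_decode {E : Type*} [MeasurableSpace E] {J : ℝ → Fin M} (hJ : Measurable J)
    {Y : Fin M → (Fin (n + 1) → ℝ) → E} (hY : ∀ i, Measurable (Y i)) :
    Measurable fun x : Fin (n + 2) → ℝ => Y (J (x 0)) (tailPath x) :=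
  (measurable_from_prod_countable_right (f := fun q : Fin M × (Fin (n + 1) → ℝ) => Y q.1 q.2) hY).comp
    ((hJ.comp (measurable_pi_apply 0)).prodMk measurable_tailPath)

/-- If the first value of the path determines the index, the conditional laws under the mixture are
the conditional laws under its components. -/
theorem isCondLaw_consMixture {X : DistSpace} [MetricSpace X.carrier]
    [CompleteSpace X.carrier] [SecondCountableTopology X.carrier] [BorelSpace X.carrier]
    [LawfulDist X] {μ' : ProbabilityMeasure (Fin (n + 2) → ℝ)}
    (hμ' : (μ' : Measure (Fin (n + 2) → ℝ)) = consMixture w a μ) {J : ℝ → Fin M}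
    (hJ : Measurable J) (hJa : ∀ i, J (a i) = i) {t : ℕ} {s : Fin (n + 2)} (hs : (s : ℕ) = t)
    {Y : Fin M → (Fin (n + 1) → ℝ) → X.carrier} (hY : ∀ i, Measurable (Y i))
    {T : Fin M → (Fin (n + 1) → ℝ) → Pp p X} (hT : ∀ i, Measurable (T i))
    (hTr : ∀ i x, T i (trunc t x) = T i x)
    (h : ∀ i, (μ i : Measure (Fin (n + 1) → ℝ)).map (fun x => (trunc t x, Y i x)) =
      (μ i : Measure (Fin (n + 1) → ℝ)).map (trunc t) ⊗ₘ Pp.kernel (T i) (hT i)) :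
    IsCondLaw p X (n + 1) μ' s (fun x => Y (J (x 0)) (tailPath x))
      (fun x => T (J (x 0)) (tailPath x)) := by
  have hY' := measurable_decode hJ hY
  have hT' := measurable_decode hJ hT
  have hr : Measurable (trunc (t + 1) : (Fin (n + 2) → ℝ) → Fin (n + 2) → ℝ) := by fun_prop
  refine (isCondLaw_iff hY').2 ⟨hT', fun x => ?_, ?_⟩
  · simp only [hs]
    rw [tailPath_trunc, hTr, trunc_apply_of_lt (by simp)]
  · simp only [hs]
    refine measure_eq_of_lintegral_eq fun φ hφ => ?_
    have hm := hφ.lintegral_kernel_prod_right' (κ := Pp.kernel _ hT')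
    rw [lintegral_map hφ (hr.prodMk hY'), Measure.lintegral_compProd hφ, lintegral_map hm hr, hμ',
      lintegral_consMixture (F := fun x => φ (trunc (t + 1) x, Y (J (x 0)) (tailPath x)))
        (hφ.comp (hr.prodMk hY')),
      lintegral_consMixture (F := fun x => ∫⁻ b, φ (trunc (t + 1) x, b)
        ∂(Pp.kernel _ hT' (trunc (t + 1) x))) (hm.comp hr)]
    refine lintegral_congr fun i => ?_
    have hi := lintegral_of_map_eq_compProd (by fun_prop) (hY i) (h i)
      (φ := fun q => φ (consPath (a i) q.1, q.2))
      (hφ.comp (((measurable_consPath (a i)).comp measurable_fst).prodMk measurable_snd))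
    simp only [trunc_consPath, Pp.kernel_apply]
    simp only [Pp.kernel_apply, hTr] at hi
    have e1 : ∀ y : Fin (n + 1) → ℝ, Y (J (consPath (a i) y 0)) (tailPath (consPath (a i) y)) = Y i y := by
      intro y
      rw [show consPath (a i) y 0 = a i from rfl, hJa]
      rfl
    have e2 : ∀ y : Fin (n + 1) → ℝ,
        T (J (consPath (a i) (trunc t y) 0)) (tailPath (consPath (a i) (trunc t y))) = T i y := by
      intro y
      rw [show consPath (a i) (trunc t y) 0 = a i from rfl, hJa, ← hTr i y]
      rfl
    simp only [e1, e2]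
    exact hi

/-- The nested variables under the mixture are those under the component which the first value
reveals. -/
theorem isNestedVar_consMixture (hm : IsCompleteUsual m)
    {μ' : ProbabilityMeasure (Fin (n + 2) → ℝ)}
    (hμ' : (μ' : Measure (Fin (n + 2) → ℝ)) = consMixture w a μ) {J : ℝ → Fin M}
    (hJ : Measurable J) (hJa : ∀ i, J (a i) = i) {k : ℕ} (hk : k ≤ n)
    {Z : Fin M → (Fin (n + 1) → ℝ) → (nestedSpace p m k).carrier}
    (hZ : ∀ i, IsNestedVar p m n (μ i) k (Z i)) :
    IsNestedVar p m (n + 1) μ' k fun x => Z (J (x 0)) (tailPath x) := by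
  induction k with
  | zero =>
    simp only [IsNestedVar] at hZ ⊢
    simp only [hZ]
    rfl
  | succ k ih =>
    choose Y T hY hT hZ using hZ
    refine ⟨_, fun x => T (J (x 0)) (tailPath x), ih (by omega) hY, ?_, ?_⟩
    · have hYm := fun i => ((hY i).measurable_and_trunc hm).1
      obtain ⟨_, mX, _, _, _, _⟩ := isPolish_nestedSpace (p := p) hm.1 hm.2 k
      have hT' := fun i => (isCondLaw_iff (hYm i)).1 (hT i)
      choose hTm hTr hTc using hT'
      exact isCondLaw_consMixture hμ' hJ hJa (t := n - (k + 1) + 1) (by simp; omega) hYm hTm hTr hTc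
    · ext1 x
      rw [hZ]
      refine Prod.ext ?_ rfl
      change x (Fin.succ _) = x _
      congr 1
      ext
      simp
      omega

/-- Finitely many real numbers can be made distinct by a small perturbation. Balls are infinite, so
Hall's condition holds for sufficiently large finite subsets of them. -/
theorem exists_injective_edist_lt (hm : IsCompleteUsual m) (x : Fin M → ℝ) {ε : ℝ≥0∞}
    (hε : 0 < ε) : ∃ a : Fin M → ℝ, Function.Injective a ∧ ∀ i, m.edist (x i) (a i) < ε := by
  classical
  have hinf : ∀ i, {y | m.edist (x i) y < ε}.Infinite := by
    intro i
    have h1 : {y | m.edist (x i) y < ε} ∈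
        @nhds ℝ m.toPseudoMetricSpace.toUniformSpace.toTopologicalSpace (x i) := by
      filter_upwards [Metric.eball_mem_nhds (x i) hε] with y hy
      exact Metric.mem_eball'.1 hy
    rw [hm.1] at h1
    exact @infinite_of_mem_nhds ℝ usualTopology _ (x i) _ _ h1
  choose s hs hcard using fun i => (hinf i).exists_subset_card_eq M
  obtain ⟨a, ha, has⟩ := (Finset.all_card_le_biUnion_card_iff_exists_injective s).1 fun I => by
    rcases I.eq_empty_or_nonempty with rfl | ⟨i, hi⟩
    · simp
    · calc I.card ≤ M := by simpa using I.card_le_univ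
        _ = (s i).card := (hcard i).symm
        _ ≤ _ := Finset.card_le_card (Finset.subset_biUnion_of_mem s hi)
  exact ⟨a, ha, fun i => hs i (has i)⟩

theorem exists_measurable_leftInverse {a : Fin M → ℝ} (ha : Function.Injective a)
    (hM : Nonempty (Fin M)) : ∃ J : ℝ → Fin M, Measurable J ∧ ∀ i, J (a i) = i := by
  obtain ⟨J, hJ, h⟩ := ((Measurable.of_discrete (f := a)).measurableEmbedding ha).exists_measurable_extend
    (g := id) measurable_id fun _ => hM
  exact ⟨J, hJ, congrFun h⟩

/-- The nested laws of paths are dense: a nested distribution is approximated by one with finite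
support, whose conditional laws are replaced by nested laws of paths and whose first coordinates
are made distinct, so that the first value of the path reveals the conditional law. -/
theorem exists_isNestedLaw_wasserstein_lt (hm : IsCompleteUsual m) (n : ℕ)
    (P : Pp p (nestedSpace p m n)) {ε : ℝ≥0∞} (hε : 0 < ε) (hε' : ε ≠ ∞) :
    ∃ (μ : Pp p (pathSpace p m n)) (Q : Pp p (nestedSpace p m n)),
      IsNestedLaw p m n μ.1 Q.1 ∧ wasserstein p (nestedSpace p m n) P.1 Q.1 < ε := by
  have hp0 : 0 < p := exponent_pos
  induction n generalizing ε with
  | zero =>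
    let P₀ : Measure ℝ := (P.1 : Measure (nestedSpace p m 0).carrier)
    have hP₀ : IsProbabilityMeasure P₀ := P.1.2
    obtain ⟨x₀, hx₀⟩ : ∃ x₀ : ℝ, ∫⁻ x, m.edist x x₀ ^ p ∂P₀ < ∞ := P.2
    have hc : Measurable fun (x : ℝ) (_ : Fin 1) => x := measurable_pi_lambda _ fun _ => measurable_id
    have hPm : (P₀.map fun (x : ℝ) (_ : Fin 1) => x).map
        (fun x : Fin 1 → ℝ => x (Fin.last 0)) = P₀ := by
      rw [Measure.map_map (measurable_pi_apply _) hc]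
      exact Measure.map_id
    have hd : Measurable fun x : Fin 1 → ℝ => m.edist (x 0) x₀ ^ p :=
      measurable_base_edist_rpow hm (measurable_pi_apply 0) measurable_const p
    have hμ : ∫⁻ x, (pathSpace p m 0).edist x (fun _ => x₀) ^ p
        ∂(P₀.map fun (x : ℝ) (_ : Fin 1) => x) < ∞ := by
      have h1 : ∀ x : Fin 1 → ℝ, (pathSpace p m 0).edist x (fun _ => x₀) ^ p =
          m.edist (x 0) x₀ ^ p := fun x => by
        rw [pathSpace_edist_rpow]
        exact Fin.sum_univ_one _
      rwa [lintegral_congr h1, lintegral_map hd hc]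
    refine ⟨⟨⟨_, Measure.isProbabilityMeasure_map hc.aemeasurable⟩, _, hμ⟩, P,
      ⟨_, rfl, measurable_pi_apply _, hPm.symm⟩, ?_⟩
    obtain ⟨_, mX, _, _, _, _⟩ := isPolish_nestedSpace (p := p) hm.1 hm.2 0
    rwa [wasserstein_self exponent_pos]
  | succ n ih =>
    -- if both components of a point move by less than `c`, then the point moves by at most `ε / 2`,
    -- because `c ^ p + c ^ p = (ε / 2) ^ p`
    let c : ℝ≥0∞ := ((ε / 2) ^ p / 2) ^ (1 / p)
    have hε2 : 0 < ε / 2 := ENNReal.half_pos hε.ne'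
    have hε2' : ε / 2 ≠ ∞ := ENNReal.div_ne_top hε' (by simp)
    have hc : 0 < c := ENNReal.rpow_pos (ENNReal.half_pos
      (ENNReal.rpow_pos hε2 hε2').ne') (ENNReal.div_ne_top (ENNReal.rpow_ne_top_of_nonneg hp0.le hε2')
        (by simp))
    have hc' : c ≠ ∞ := ENNReal.rpow_ne_top_of_nonneg (by positivity)
      (ENNReal.div_ne_top (ENNReal.rpow_ne_top_of_nonneg hp0.le hε2') (by simp))
    have hcc : c ^ p + c ^ p = (ε / 2) ^ p := by
      simp only [c]
      rw [← ENNReal.rpow_mul, one_div_mul_cancel hp0.ne', ENNReal.rpow_one, ENNReal.add_halves]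
    have hpol := isPolish_nestedSpace (p := p) hm.1 hm.2 (n + 1)
    obtain ⟨_, mX, _, _, _, _⟩ := hpol
    let e := TopologicalSpace.denseSeq (nestedSpace p m (n + 1)).carrier
    obtain ⟨N, hN⟩ := P.exists_nearestPt (TopologicalSpace.denseRange_denseSeq _)
      (ENNReal.rpow_pos hε2 hε2' : 0 < (ε / 2) ^ p)
    let j : (nestedSpace p m (n + 1)).carrier → Fin (N + 1) := fun x =>
      ⟨SimpleFunc.nearestPtInd e N x, Nat.lt_succ_of_le (SimpleFunc.nearestPtInd_le e N x)⟩
    have hj : Measurable j := by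
      refine measurable_to_countable' fun i => ?_
      convert! (SimpleFunc.nearestPtInd e N).measurableSet_fiber i.1 using 1
      ext x
      simp [j, Fin.ext_iff]
    let b : Fin (N + 1) → ℝ × Pp p (nestedSpace p m n) := fun i => e i
    choose μ Q hQ hQc using fun i => ih (b i).2 hc hc'
    obtain ⟨a, ha, hac⟩ := exists_injective_edist_lt hm (fun i => (b i).1) hc
    obtain ⟨J, hJ, hJa⟩ := exists_measurable_leftInverse ha ⟨0⟩
    let b' : Fin (N + 1) → (nestedSpace p m (n + 1)).carrier := fun i => (a i, Q i)
    have hb' : Measurable fun x => b' (j x) := (Measurable.of_discrete (f := b')).comp hj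
    -- `x ↦ b' (j x)` moves `P` by less than `ε`: by less than `ε / 2` to the nearest `e i`, and by at
    -- most `ε / 2` from there to `b' i`
    have hle : (∫⁻ x, edist x (b' (j x)) ^ p
        ∂(P.1 : Measure (nestedSpace p m (n + 1)).carrier)) ^ (1 / p) < ε := by
      have hg : Measurable fun x => e (j x) :=
        (Measurable.of_discrete (f := fun i : Fin (N + 1) => e i)).comp hj
      have h1 := edist_Lp_triangle hp.out (P.1 : Measure (nestedSpace p m (n + 1)).carrier)
        (f := id) (g := fun x => e (j x)) (h := fun x => b' (j x))
        (measurable_id.edist hg).aemeasurable (hg.edist hb').aemeasurable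
      refine h1.trans_lt ?_
      rw [← ENNReal.add_halves ε]
      have h2 : (∫⁻ x, edist (e (j x)) (b' (j x)) ^ p
          ∂(P.1 : Measure (nestedSpace p m (n + 1)).carrier)) ^ (1 / p) ≤ ε / 2 := by
        rw [one_div, ENNReal.rpow_inv_le_iff hp0]
        refine (lintegral_mono (g := fun _ => (ε / 2) ^ p) fun x => ?_).trans (by simp)
        rw [← LawfulDist.edist_eq, ← hcc]
        refine (nestedStep_edist_rpow (nestedSpace p m n) (e (j x)) (b' (j x))).trans_le ?_
        exact add_le_add (ENNReal.rpow_le_rpow (hac _).le hp0.le)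
          (ENNReal.rpow_le_rpow (hQc _).le hp0.le)
      refine ENNReal.add_lt_add_of_lt_of_le (ne_top_of_le_ne_top hε2' h2) ?_ h2
      rw [one_div, ENNReal.rpow_inv_lt_iff hp0]
      exact hN
    obtain ⟨P', hP', hPP'⟩ := P.exists_map hb' (by
      rw [one_div, ENNReal.rpow_inv_lt_iff hp0] at hle
      exact hle.trans_le le_top)
    -- the path law: with probability `w i`, start at `a i` and continue with law `μ i`
    let w : Measure (Fin (N + 1)) := (P.1 : Measure (nestedSpace p m (n + 1)).carrier).map j
    have hw : IsProbabilityMeasure w := Measure.isProbabilityMeasure_map hj.aemeasurable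
    let μ' : ProbabilityMeasure (Fin (n + 2) → ℝ) :=
      ⟨consMixture w a fun i => (μ i).1, isProbabilityMeasure_consMixture⟩
    have hμ' : ∫⁻ x, (pathSpace p m (n + 1)).edist x 0 ^ p
        ∂(μ' : Measure (Fin (n + 2) → ℝ)) < ∞ := by
      have hd : ∀ {N : ℕ}, Measurable fun x : Fin N → ℝ => ∑ l, m.edist (x l) 0 ^ p :=
        fun {N} => Finset.measurable_fun_sum _ fun l _ =>
          measurable_base_edist_rpow hm (measurable_pi_apply l) measurable_const p
      have h1 : ∀ {N : ℕ} (x : Fin (N + 1) → ℝ),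
          (pathSpace p m N).edist x 0 ^ p = ∑ l, m.edist (x l) 0 ^ p :=
        fun x => pathSpace_edist_rpow x 0
      rw [lintegral_congr h1]
      change ∫⁻ x, _ ∂(consMixture w a fun i => (μ i).1) < ∞
      rw [lintegral_consMixture hd, lintegral_fintype]
      refine ENNReal.sum_lt_top.2 fun i _ => ENNReal.mul_lt_top ?_ (measure_lt_top _ _)
      have h2 : ∀ y : Fin (n + 1) → ℝ, ∑ l, m.edist (consPath (a i) y l) 0 ^ p =
          m.edist (a i) 0 ^ p + (pathSpace p m n).edist y 0 ^ p := fun y => by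
        rw [h1, Fin.sum_univ_succ]
        rfl
      rw [lintegral_congr h2, lintegral_add_left measurable_const, lintegral_const, measure_univ,
        mul_one]
      exact ENNReal.add_lt_top.2 ⟨ENNReal.rpow_lt_top_of_nonneg hp0.le
        (@edist_ne_top ℝ m.toPseudoMetricSpace _ _),
        (isPolish_pathSpace hm.1 hm.2 n).lintegral_edist_lt_top (μ i) 0⟩
    choose Z hZ hZm hQZ using hQ
    have hnested : IsNestedVar p m (n + 1) μ' (n + 1) fun x => (x 0, Q (J (x 0))) := by
      refine ⟨_, fun x => Q (J (x 0)), isNestedVar_consMixture hm rfl hJ hJa le_rfl hZ, ?_, ?_⟩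
      · obtain ⟨_, mX, _, _, _, _⟩ := isPolish_nestedSpace (p := p) hm.1 hm.2 n
        refine isCondLaw_consMixture rfl hJ hJa (t := 0) (by simp) hZm
          (T := fun i _ => Q i) (fun i => measurable_const) (fun _ _ => rfl) fun i => ?_
        exact (map_prodMk_eq_compProd_iff (by fun_prop) (hZm i) _).2 fun A _ B hB =>
          measure_trunc_zero_inter (hZm i) (hQZ i) hB
      · ext1 x
        refine Prod.ext ?_ rfl
        change x _ = x _
        congr 1
        ext
        simp
    have hZmeas := (hnested.measurable_and_trunc hm).1
    refine ⟨⟨μ', 0, hμ'⟩, P', ⟨_, hnested, hZmeas, ?_⟩, hPP'.trans_lt hle⟩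
    rw [hP']
    refine measure_eq_of_lintegral_eq fun φ hφ => ?_
    rw [lintegral_map hφ hb', lintegral_map hφ hZmeas]
    refine Eq.trans ?_ (lintegral_consMixture (hφ.comp hZmeas)).symm
    rw [← lintegral_map (f := fun i => φ (b' i)) Measurable.of_discrete hj]
    refine lintegral_congr fun i => ?_
    have h1 : ∀ y : Fin (n + 1) → ℝ, (φ ∘ fun x : Fin (n + 2) → ℝ => (x 0, Q (J (x 0))))
        (consPath (a i) y) = φ (b' i) := fun y => by
      change φ (a i, Q (J (a i))) = _
      rw [hJa]
    rw [lintegral_congr h1, lintegral_const, measure_univ, mul_one]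

end Mixture

/-! ### The completion -/

section Completion

variable {p : ℝ} [hp : Fact (1 ≤ p)] {m : MetricSpace ℝ} {n : ℕ}

/-- The isometry property of the map from path laws to nested laws. -/
theorem nestedDist_eq_wasserstein (hm : IsCompleteUsual m)
    {μ ν : ProbabilityMeasure (Fin (n + 1) → ℝ)} {P Q : Pp p (nestedSpace p m n)}
    (hP : IsNestedLaw p m n μ P.1) (hQ : IsNestedLaw p m n ν Q.1) :
    nestedDist p m n μ ν = wasserstein p (nestedSpace p m n) P.1 Q.1 :=
  le_antisymm (nestedDist_le_wasserstein hm hP hQ) (wasserstein_le_nestedDist hm hP hQ)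

/-- The nested distance dominates the Wasserstein distance of path laws, because bicausal couplings
are couplings. -/
theorem wasserstein_pathSpace_le_nestedDist (μ ν : ProbabilityMeasure (Fin (n + 1) → ℝ)) :
    wasserstein p (pathSpace p m n) μ ν ≤ nestedDist p m n μ ν :=
  ENNReal.rpow_le_rpow (biInf_mono fun _ h => h.1) (one_div_pos.2 (exponent_pos (p := p))).le

theorem IsPolish.eq_of_wasserstein_eq_zero {X : DistSpace} (hX : IsPolish X)
    {P Q : ProbabilityMeasure X.carrier} (h : wasserstein p X P Q = 0) : P = Q := by
  obtain ⟨_, mX, _, _, _, _⟩ := hX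
  exact _root_.eq_of_wasserstein_eq_zero exponent_pos h

/-- The diagonal coupling is bicausal. -/
theorem nestedDist_self (hm : IsCompleteUsual m) (μ : ProbabilityMeasure (Fin (n + 1) → ℝ)) :
    nestedDist p m n μ μ = 0 := by
  have hp0 : 0 < p := exponent_pos
  have hΔ : Measurable fun x : Fin (n + 1) → ℝ => (x, x) := by fun_prop
  let γ : ProbabilityMeasure ((Fin (n + 1) → ℝ) × (Fin (n + 1) → ℝ)) := μ.map hΔ.aemeasurable
  have hγ : (γ : Measure ((Fin (n + 1) → ℝ) × (Fin (n + 1) → ℝ))) =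
      (μ : Measure (Fin (n + 1) → ℝ)).map fun x => (x, x) := rfl
  have hswap : γ.map measurable_swap.aemeasurable = γ := by
    refine Subtype.ext ?_
    change (γ : Measure ((Fin (n + 1) → ℝ) × (Fin (n + 1) → ℝ))).map Prod.swap = _
    rw [hγ, Measure.map_map measurable_swap hΔ]
    rfl
  have h1 : (γ : Measure ((Fin (n + 1) → ℝ) × (Fin (n + 1) → ℝ))).map Prod.fst = μ := by
    rw [hγ, Measure.map_map measurable_fst hΔ]
    exact Measure.map_id
  have h2 : (γ : Measure ((Fin (n + 1) → ℝ) × (Fin (n + 1) → ℝ))).map Prod.snd = μ := by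
    rw [hγ, Measure.map_map measurable_snd hΔ]
    exact Measure.map_id
  have hc : IsCausal n γ := by
    refine (isCausal_iff h1).2 fun i φ hφ => ?_
    have hr : Measurable (trunc (i + 1) : (Fin (n + 1) → ℝ) → Fin (n + 1) → ℝ) := by fun_prop
    rw [hγ, lintegral_map (by fun_prop) hΔ]
    refine (lintegral_condDistrib_id hr (φ := fun q => φ ((q.1, q.1), q.2)) (by fun_prop)).symm.trans
      (lintegral_map (f := fun z : (Fin (n + 1) → ℝ) × (Fin (n + 1) → ℝ) =>
        ∫⁻ w, φ ((trunc (i + 1) z.1, trunc (i + 1) z.2), w)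
          ∂(condDistrib id (trunc (i + 1)) (μ : Measure (Fin (n + 1) → ℝ)) (trunc (i + 1) z.1)))
        ?_ hΔ).symm
    exact Measurable.lintegral_kernel_prod_right'
      (κ := (condDistrib id (trunc (i + 1)) (μ : Measure (Fin (n + 1) → ℝ))).comap
        (fun z : (Fin (n + 1) → ℝ) × (Fin (n + 1) → ℝ) => trunc (i + 1) z.1) (by fun_prop))
      (f := fun q : ((Fin (n + 1) → ℝ) × (Fin (n + 1) → ℝ)) × (Fin (n + 1) → ℝ) =>
        φ ((trunc (i + 1) q.1.1, trunc (i + 1) q.1.2), q.2)) (by fun_prop)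
  have hmem : γ ∈ bicausalCouplings n μ μ := ⟨⟨h1, h2⟩, hc, by rwa [hswap]⟩
  have hd : Measurable fun z : (Fin (n + 1) → ℝ) × (Fin (n + 1) → ℝ) =>
      ∑ i, m.edist (z.1 i) (z.2 i) ^ p :=
    Finset.measurable_fun_sum _ fun i _ => measurable_base_edist_rpow hm
      ((measurable_pi_apply i).comp measurable_fst) ((measurable_pi_apply i).comp measurable_snd) p
  have hcost : ∫⁻ z, (pathSpace p m n).edist z.1 z.2 ^ p
      ∂(γ : Measure ((Fin (n + 1) → ℝ) × (Fin (n + 1) → ℝ))) = 0 := by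
    have h : ∫⁻ z, (pathSpace p m n).edist z.1 z.2 ^ p
        ∂(γ : Measure ((Fin (n + 1) → ℝ) × (Fin (n + 1) → ℝ))) =
        ∫⁻ z, ∑ i, m.edist (z.1 i) (z.2 i) ^ p
          ∂(γ : Measure ((Fin (n + 1) → ℝ) × (Fin (n + 1) → ℝ))) :=
      lintegral_congr fun z => pathSpace_edist_rpow z.1 z.2
    have h0 : ∀ a : ℝ, m.edist a a = 0 :=
      @edist_self ℝ m.toPseudoMetricSpace.toPseudoEMetricSpace
    rw [h, hγ, lintegral_map hd hΔ]
    simp [h0, ENNReal.zero_rpow_of_pos hp0]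
  rw [nestedDist, one_div, ENNReal.rpow_eq_zero_iff_of_pos (inv_pos.2 hp0)]
  exact le_antisymm ((iInf₂_le γ hmem).trans_eq hcost) zero_le

theorem exists_isNestedLaw (hm : IsCompleteUsual m) (μ : Pp p (pathSpace p m n)) :
    ∃ P : Pp p (nestedSpace p m n), IsNestedLaw p m n μ.1 P.1 := by
  obtain ⟨Z, z₀, hZ, hz₀⟩ := exists_nestedVar hm μ le_rfl
  have hZm := (hZ.measurable_and_trunc hm).1
  refine ⟨⟨⟨(μ.1 : Measure (Fin (n + 1) → ℝ)).map Z,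
    Measure.isProbabilityMeasure_map hZm.aemeasurable⟩, z₀, ?_⟩, Z, hZ, hZm, rfl⟩
  change ∫⁻ x, _ ∂((μ.1 : Measure (Fin (n + 1) → ℝ)).map Z) < ∞
  have hd : Measurable fun z => (nestedSpace p m n).edist z z₀ :=
    (isPolish_nestedSpace (p := p) hm.1 hm.2 n).measurable_edist.comp
      (measurable_id.prodMk measurable_const)
  exact (lintegral_map (hd.pow_const p) hZm).trans_lt hz₀

/-- The diagonal coupling costs nothing, so the Wasserstein distance of two nested laws of `μ`
vanishes. -/
theorem IsNestedLaw.unique (hm : IsCompleteUsual m) {μ : ProbabilityMeasure (Fin (n + 1) → ℝ)}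
    {P Q : ProbabilityMeasure (nestedSpace p m n).carrier} (hP : IsNestedLaw p m n μ P)
    (hQ : IsNestedLaw p m n μ Q) : P = Q :=
  (isPolish_nestedSpace hm.1 hm.2 n).eq_of_wasserstein_eq_zero <| le_antisymm
    ((wasserstein_le_nestedDist hm hP hQ).trans_eq (nestedDist_self hm μ)) zero_le

end Completion

/-- Let `N = n + 1 ≥ 1`, `p ∈ [1, ∞)` and let `m` be a complete metric on `ℝ` compatible with the
usual topology. Then the nested distance is a metric on `𝒫^p(ℝ^N)`, the Wasserstein distance is a
complete metric on `𝒫^p(R_{1:N})`, and the map `I` is well defined on `𝒫^p(ℝ^N)` and is an isometry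
into `𝒫^p(R_{1:N})` with dense range. -/
theorem mainTheorem1 (n : ℕ) (p : ℝ) (hp : 1 ≤ p) (m : MetricSpace ℝ)
    (hm : m.toPseudoMetricSpace.toUniformSpace.toTopologicalSpace = usualTopology)
    (hc : @CompleteSpace ℝ m.toPseudoMetricSpace.toUniformSpace) :
    ∃ (m₁ : MetricSpace (Pp p (pathSpace p m n))) (m₂ : MetricSpace (Pp p (nestedSpace p m n)))
      (I : Pp p (pathSpace p m n) → Pp p (nestedSpace p m n)),
      (∀ μ ν : Pp p (pathSpace p m n), edist μ ν = nestedDist p m n μ.1 ν.1) ∧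
      (∀ P Q : Pp p (nestedSpace p m n), edist P Q = wasserstein p (nestedSpace p m n) P.1 Q.1) ∧
      (∀ (μ : Pp p (pathSpace p m n)) (P : Pp p (nestedSpace p m n)),
        IsNestedLaw p m n μ.1 P.1 ↔ P = I μ) ∧
      CompleteSpace (Pp p (nestedSpace p m n)) ∧
      Isometry I ∧ DenseRange I := by
  have hp' : Fact (1 ≤ p) := ⟨hp⟩
  have hM : IsCompleteUsual m := ⟨hm, hc⟩
  choose I hI using exists_isNestedLaw (p := p) (n := n) hM
  have hW : ∀ μ ν, nestedDist p m n μ.1 ν.1 = wasserstein p (nestedSpace p m n) (I μ).1 (I ν).1 :=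
    fun μ ν => nestedDist_eq_wasserstein hM (hI μ) (hI ν)
  obtain ⟨_, mX, _, _, _, _⟩ := isPolish_nestedSpace (p := p) hm hc n
  have hinj : Function.Injective I := by
    intro μ ν h
    have h0 : nestedDist p m n μ.1 ν.1 = 0 := by
      rw [hW, h]
      exact wasserstein_self exponent_pos
    exact Subtype.ext <| (isPolish_pathSpace (p := p) hm hc n).eq_of_wasserstein_eq_zero <|
      le_antisymm ((wasserstein_pathSpace_le_nestedDist μ.1 ν.1).trans_eq h0) zero_le
  refine ⟨MetricSpace.induced I hinj inferInstance, Pp.instMetricSpace, I, fun μ ν => (hW μ ν).symm,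
    fun _ _ => rfl, fun μ P => ⟨fun h => Subtype.ext (h.unique hM (hI μ)), ?_⟩, inferInstance,
    fun _ _ => rfl, ?_⟩
  · rintro rfl
    exact hI μ
  · refine fun P => EMetric.mem_closure_iff.2 fun ε hε => ?_
    obtain ⟨μ, Q, hQ, hPQ⟩ := exists_isNestedLaw_wasserstein_lt hM n P
      (lt_min hε one_pos) (min_lt_iff.2 (Or.inr ENNReal.one_lt_top)).ne
    refine ⟨I μ, mem_range_self μ, ?_⟩
    rw [← Subtype.ext (hQ.unique hM (hI μ))]
    exact hPQ.trans_le (min_le_left _ _)
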